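/- A \emph{quadrilateral lattice} is a finite graph $Q\subset\mathbb{C}$ with straight-line edges such that each bounded face is a (not necessarily convex) quadrilateral; it is assumed that the boundary $\partial Q$ of the outer face is a closed curve without self-intersections and that any two distinct bounded (closed) faces intersect in the empty set, a single vertex, or a single edge. It is \emph{orthogonal} if the diagonals of each face are orthogonal. Let $Q^0$ be the set of vertices. A function $f\colon Q^0\to\mathbb{C}$ is \emph{discrete analytic} if $\frac{f(z_1)-f(z_3)}{z_1-z_3}=\frac{f(z_2)-f(z_4)}{z_2-z_4}$ for each face $z_1z_2z_3z_4$; the real part of such a function is called \emph{discrete harmonic}. For $u\colon Q^0\to\mathbb{R}$ the gradient $\nabla_Q u(z_1z_2z_3z_4)\in\mathbb{R}^2$ at a face is the unique vector with $\nabla_Q u\cdot\overrightarrow{z_1z_3}=u(z_3)-u(z_1)$ and $\nabla_Q u\cdot\overrightarrow{z_2z_4}=u(z_4)-u(z_2)$, and the energy is $E_Q(u)=\sum|\nabla_Q u(z_1z_2z_3z_4)|^2\,\mathrm{Area}(z_1z_2z_3z_4)$, the sum being over all bounded faces. Joining opposite vertices of each face gives a graph with two connected components; let $B$ be either of them and $B^0$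 its vertex set. Let $h$ be twice the maximal edge length of $Q$. The \emph{eccentricity} $e$ of $Q$ is the infimum of the numbers $K$ such that (D) for each face both ratios of the lengths of its diagonals are less than $K$ and the angle between the diagonals is greater than $1/K$; and (U) each closed disk of radius equal to the maximal edge length contains fewer than $K$ vertices of $Q$. \textbf{Equicontinuity Lemma.} For each $e$ there is a positive constant $C_e$ depending only on $e$ such that the following holds. Let $Q$ be an orthogonal lattice of eccentricity $e$, let $u\colon Q^0\to\mathbb{R}$ be discrete harmonic, let $z,w\in B^0$ and let $R$ be a closed square of side length $r$ centered at the midpoint of the segment $zw$ with sides parallel and orthogonal to $zw$ (of arbitrary direction if $z=w$). If $|z-w|\ge h$ and $r>3|z-w|$, then $$|u(z)-u(w)|\le C_e\cdot E_Q(u)^{1/2}\cdot\ln^{-1/2}\frac{r}{3|z-w|}+\max_{z',w'\in R\cap\partial Q\cap B^0}|u(z')-u(w')|,$$ where the maximum is over all pairs of boundary vertices $z',w'\in\partial Q\cap B^0$ lying in $R$ and is set to be zero if there are no such vertices. If $|z-w|<h<r/3$, then the same inequality holds with $\ln^{-1/2}\frac{r}{3|z-w|}$ replaced by $\ln^{-1/2}\frac{r}{3h}$.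 -/

import Mathlib

open scoped InnerProductSpace

noncomputable section

/-- A finite graph drawn in the plane `ℂ` with straight line edges; the vertices are points
of `ℂ`, and two edges may meet only at common endpoints. -/
structure PlaneGraph where
  verts : Finset ℂ
  graph : SimpleGraph verts
  vertex_on_edge : ∀ a b v : verts, graph.Adj a b → (v : ℂ) ∈ segment ℝ (a : ℂ) (b : ℂ) →
    v = a ∨ v = b
  edges_meet : ∀ a b c d : verts, graph.Adj a b → graph.Adj c d → s(a, b) ≠ s(c, d) →
    ∀ p ∈ segment ℝ (a : ℂ) (b : ℂ) ∩ segment ℝ (c : ℂ) (d : ℂ),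
      (p = (a : ℂ) ∨ p = (b : ℂ)) ∧ (p = (c : ℂ) ∨ p = (d : ℂ))

namespace PlaneGraph

variable (G : PlaneGraph)

/-- The subset of the plane covered by the vertices and the edges. -/
def drawing : Set ℂ :=
  (G.verts : Set ℂ) ∪
    {p | ∃ a b : G.verts, G.graph.Adj a b ∧ p ∈ segment ℝ (a : ℂ) (b : ℂ)}

/-- The bounded (open) faces: bounded connected components of the complement of the drawing. -/
def boundedFaces : Set (Set ℂ) :=
  {F | ∃ p ∈ G.drawingᶜ, F = connectedComponentIn G.drawingᶜ p ∧ Bornology.IsBounded F}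

/-- The outer (open) face: the points whose component in the complement of the drawing
is unbounded. -/
def outerFace : Set ℂ :=
  {p | p ∈ G.drawingᶜ ∧ ¬ Bornology.IsBounded (connectedComponentIn G.drawingᶜ p)}

/-- The boundary of the graph is the boundary of its outer face. -/
def boundary : Set ℂ := frontier G.outerFace

/-- `q 0, q 1, q 2, q 3` are distinct vertices, consecutive ones are joined by edges of the
graph, and the boundary of the region `F` is the closed broken line `q 0 q 1 q 2 q 3`. -/
def IsQuadOf (q : Fin 4 → G.verts) (F : Set ℂ) : Prop :=
  Function.Injective q ∧ (∀ i, G.graph.Adj (q i) (q (i + 1))) ∧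
    frontier F = ⋃ i, segment ℝ (q i : ℂ) (q (i + 1) : ℂ)

end PlaneGraph

/-- A quadrilateral lattice: a finite plane graph with straight edges such that every bounded
face is a (not necessarily convex) quadrilateral, the boundary of the outer face is a closed
curve without self-intersections, and two distinct bounded faces intersect by the empty set,
by a single vertex, or by a single edge.
The finite set `quads` lists every bounded face exactly once, as the cyclic sequence of its
vertices (in one of the two directions and starting from one of the four vertices). -/
structure QuadLattice extends PlaneGraph where
  quads : Finset (Fin 4 → verts)
  quad_of_face : ∀ F ∈ toPlaneGraph.boundedFaces,
    ∃! q : Fin 4 → verts, q ∈ quads ∧ toPlaneGraph.IsQuadOf q F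
  face_of_quad : ∀ q ∈ quads, ∃ F ∈ toPlaneGraph.boundedFaces, toPlaneGraph.IsQuadOf q F
  boundary_simple : ∃ γ : Circle → ℂ, Continuous γ ∧ Function.Injective γ ∧
    Set.range γ = toPlaneGraph.boundary
  faces_meet : ∀ F ∈ toPlaneGraph.boundedFaces, ∀ F' ∈ toPlaneGraph.boundedFaces, F ≠ F' →
    closure F ∩ closure F' = ∅ ∨
    (∃ v : verts, closure F ∩ closure F' = {(v : ℂ)}) ∨
    (∃ a b : verts, graph.Adj a b ∧ closure F ∩ closure F' = segment ℝ (a : ℂ) (b : ℂ))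

/-- The vector in the plane with prescribed scalar products `s` and `t` with `a` and `b`
respectively (for linearly independent `a` and `b`, see the two facts below). -/
def dualVector (a b : ℂ) (s t : ℝ) : ℂ :=
  ((s : ℂ) * (Complex.I * b) - (t : ℂ) * (Complex.I * a)) / ((⟪a, Complex.I * b⟫_ℝ : ℝ) : ℂ)

theorem dualVector_inner (a b : ℂ) (s t : ℝ) (h : ⟪a, Complex.I * b⟫_ℝ ≠ 0) :
    ⟪dualVector a b s t, a⟫_ℝ = s ∧ ⟪dualVector a b s t, b⟫_ℝ = t := by
  obtain ⟨a1, a2⟩ := a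
  obtain ⟨b1, b2⟩ := b
  simp only [dualVector, Complex.inner, Complex.div_ofReal_re, Complex.div_ofReal_im,
    Complex.mul_re, Complex.mul_im, Complex.conj_re, Complex.conj_im, Complex.sub_re,
    Complex.sub_im, Complex.ofReal_re, Complex.ofReal_im, Complex.I_re, Complex.I_im,
    zero_mul, one_mul, zero_sub, zero_add, mul_neg, neg_mul, sub_neg_eq_add, sub_zero] at h ⊢
  obtain ⟨D, hD⟩ : ∃ D, -(b2 * a1) + b1 * a2 = D := ⟨_, rfl⟩
  rw [hD] at h ⊢
  constructor <;> field_simp <;> rw [← hD] <;> ring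

theorem dualVector_unique (a b v : ℂ) (s t : ℝ) (h : ⟪a, Complex.I * b⟫_ℝ ≠ 0)
    (hs : ⟪v, a⟫_ℝ = s) (ht : ⟪v, b⟫_ℝ = t) : v = dualVector a b s t := by
  subst hs ht
  obtain ⟨a1, a2⟩ := a
  obtain ⟨b1, b2⟩ := b
  obtain ⟨v1, v2⟩ := v
  apply Complex.ext <;>
  simp only [dualVector, Complex.inner, Complex.div_ofReal_re, Complex.div_ofReal_im,
    Complex.mul_re, Complex.mul_im, Complex.conj_re, Complex.conj_im, Complex.sub_re,
    Complex.sub_im, Complex.ofReal_re, Complex.ofReal_im, Complex.I_re, Complex.I_im,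
    zero_mul, one_mul, zero_sub, zero_add, mul_neg, neg_mul, sub_neg_eq_add, sub_zero] at h ⊢ <;>
  obtain ⟨D, hD⟩ : ∃ D, -(b2 * a1) + b1 * a2 = D := ⟨_, rfl⟩ <;>
  rw [hD] at h ⊢ <;> field_simp <;> rw [← hD] <;> ring

/-- The area of the polygon `p 0 p 1 p 2 p 3` (without self-intersections), by the
shoelace formula. -/
def quadArea (p : Fin 4 → ℂ) : ℝ :=
  |∑ i, ((p i).re * (p (i + 1)).im - (p i).im * (p (i + 1)).re)| / 2

namespace QuadLattice

variable (Q : QuadLattice)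

/-- The first diagonal of a quadrilateral, as a vector. -/
def diag₁ (q : Fin 4 → Q.verts) : ℂ := (q 2 : ℂ) - (q 0 : ℂ)

/-- The second diagonal of a quadrilateral, as a vector. -/
def diag₂ (q : Fin 4 → Q.verts) : ℂ := (q 3 : ℂ) - (q 1 : ℂ)

/-- The diagonals of each face are orthogonal. -/
def IsOrthogonal : Prop := ∀ q ∈ Q.quads, ⟪Q.diag₁ q, Q.diag₂ q⟫_ℝ = 0

/-- The difference quotients along the two diagonals of each face are equal. -/
def IsDiscreteAnalytic (f : Q.verts → ℂ) : Prop :=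
  ∀ q ∈ Q.quads, (f (q 0) - f (q 2)) / ((q 0 : ℂ) - (q 2 : ℂ)) =
    (f (q 1) - f (q 3)) / ((q 1 : ℂ) - (q 3 : ℂ))

/-- A discrete harmonic function is the real part of a discrete analytic function. -/
def IsDiscreteHarmonic (u : Q.verts → ℝ) : Prop :=
  ∃ f : Q.verts → ℂ, Q.IsDiscreteAnalytic f ∧ ∀ v, u v = (f v).re

/-- The discrete gradient at a face: the vector whose scalar products with the two diagonals
are the differences of `u` along them. -/
def grad (u : Q.verts → ℝ) (q : Fin 4 → Q.verts) : ℂ :=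
  dualVector (Q.diag₁ q) (Q.diag₂ q) (u (q 2) - u (q 0)) (u (q 3) - u (q 1))

/-- The discrete Dirichlet energy. -/
def energy (u : Q.verts → ℝ) : ℝ :=
  ∑ q ∈ Q.quads, ‖Q.grad u q‖ ^ 2 * quadArea (fun i => (q i : ℂ))

/-- The maximal edge length. -/
def maxEdge : ℝ := sSup {l | ∃ a b : Q.verts, Q.graph.Adj a b ∧ l = dist (a : ℂ) (b : ℂ)}

/-- Twice the maximal edge length. -/
def h : ℝ := 2 * Q.maxEdge

/-- The ratio of the diagonals of each face (in either order) is less than `K` and the angle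
between the diagonals (as lines) is greater than `1 / K`. -/
def CondD (K : ℝ) : Prop :=
  ∀ q ∈ Q.quads, ‖Q.diag₁ q‖ / ‖Q.diag₂ q‖ < K ∧ ‖Q.diag₂ q‖ / ‖Q.diag₁ q‖ < K ∧
    1 / K < InnerProductGeometry.angle (Q.diag₁ q) (Q.diag₂ q) ∧
    1 / K < Real.pi - InnerProductGeometry.angle (Q.diag₁ q) (Q.diag₂ q)

/-- The number of vertices in any disk of radius equal to the maximal edge length is less
than `K`. -/
def CondU (K : ℝ) : Prop :=
  ∀ p : ℂ, (((Q.verts : Set ℂ) ∩ Metric.closedBall p Q.maxEdge).ncard : ℝ) < K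

/-- The eccentricity of the lattice. -/
def ecc : ℝ := sInf {K | Q.CondD K ∧ Q.CondU K}

/-- The graph obtained by joining the opposite vertices of each face. Its two connected
components are the graphs `B` and `W` associated to the lattice. -/
def diagGraph : SimpleGraph Q.verts :=
  SimpleGraph.fromRel fun a c => ∃ q ∈ Q.quads, ∃ i, a = q i ∧ c = q (i + 2)

/-- The maximum of `|u z' - u w'|` over boundary vertices `z', w'` of `B` lying in `R`
(the maximum over the empty set is `sSup ∅ = 0`). -/
def boundaryOsc (u : Q.verts → ℝ) (B : Q.diagGraph.ConnectedComponent) (R : Set ℂ) : ℝ :=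
  sSup {x | ∃ z' ∈ B.supp, ∃ w' ∈ B.supp, (z' : ℂ) ∈ R ∩ Q.boundary ∧
    (w' : ℂ) ∈ R ∩ Q.boundary ∧ x = |u z' - u w'|}

end QuadLattice

/-- The closed square of side length `r` centered at `c` with sides parallel and orthogonal
to the unit vector `θ`. -/
def square (c θ : ℂ) (r : ℝ) : Set ℂ :=
  {p | |⟪θ, p - c⟫_ℝ| ≤ r / 2 ∧ |⟪Complex.I * θ, p - c⟫_ℝ| ≤ r / 2}

end

/-! The proof is a length-area argument over concentric circles. Let c be the midpoint of zw and let
U be u(z) - u(w) minus the boundary oscillation; assume U ≥ 0. Consider a circle about c that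
encloses z and w, avoids all vertices and stays far enough inside the square. Then the faces meeting
the circle carry a total variation of u along their diagonals of at least U/2
(`IsDiscreteHarmonic.sub_le`). By the maximum principle, a value at least u(z) occurs in B either at
a boundary vertex inside the disk or at a face meeting the circle; symmetrically, a value at most
u(w) occurs. From a face on the circle one passes to the next one through common sides crossed by
the circle. Either the boundary of the lattice is reached, or the entire circle is swept by faces;
then all faces on it are joined to each other and no boundary vertex of B lies inside
(`reach_boundary_or_cover`, `outerFace_meets_sphere`).

Condition (U) bounds the number of faces near the circle of radius ρ by a multiple of ρ/h, so
Cauchy-Schwarz bounds U²/ρ by a multiple of h⁻¹ times the sum of the squared variations over these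
faces. Condition (D) compares the squared variation at a face with its energy. Integration over ρ
produces the logarithm on the left; on the right each face is seen only by radii from an interval of
length O(h), so h cancels and U² log ≤ C E remains (`mul_log_le_of_forall`, `sq_mul_log_le`).

Two facts about plane lattices support this. First, u satisfies a Laplace equation with positive
weights at interior vertices: increments of the conjugate function Im f cancel around the vertex,
and each is a positive multiple of an increment of u along the crossing diagonal. The signs agree
because the side of an edge on which a face lies determines the sign of the cross product of its
diagonals (`IsQuadOf.planeCross_pos_zero`). Secondly, the ends of an edge never belong to the same
diagonal component. This holds because closed walks have even length, as a winding number count mod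
2 shows (`even_length`). -/

/-! ### Segments and cross products in the plane -/

/-- The cross product of two plane vectors. -/
noncomputable def planeCross (a b : ℂ) : ℝ := a.re * b.im - a.im * b.re

theorem isClosed_segment_complex (a b : ℂ) : IsClosed (segment ℝ a b) := by
  rw [← convexHull_pair]
  exact ((Set.toFinite {a, b}).isCompact_convexHull ℝ).isClosed

theorem isCompact_segment_complex (a b : ℂ) : IsCompact (segment ℝ a b) := by
  rw [← convexHull_pair]
  exact (Set.toFinite {a, b}).isCompact_convexHull ℝ

theorem planeCross_line (a w : ℂ) (s t : ℝ) :
    planeCross w (a + (s + t * Complex.I) * w - a) = t * ‖w‖ ^ 2 := by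
  rw [← Complex.normSq_eq_norm_sq, Complex.normSq_apply]
  simp [planeCross]; ring

theorem mem_openSegment_complex {a b p : ℂ} :
    p ∈ openSegment ℝ a b ↔ ∃ s : ℝ, 0 < s ∧ s < 1 ∧ p = a + s * (b - a) := by
  rw [openSegment_eq_image']
  constructor
  · rintro ⟨s, ⟨h0, h1⟩, rfl⟩
    exact ⟨s, h0, h1, by simp⟩
  · rintro ⟨s, h0, h1, rfl⟩
    exact ⟨s, ⟨h0, h1⟩, by simp⟩

theorem mem_segment_complex {a b p : ℂ} :
    p ∈ segment ℝ a b ↔ ∃ s : ℝ, 0 ≤ s ∧ s ≤ 1 ∧ p = a + s * (b - a) := by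
  rw [segment_eq_image']
  constructor
  · rintro ⟨s, ⟨h0, h1⟩, rfl⟩
    exact ⟨s, h0, h1, by simp⟩
  · rintro ⟨s, h0, h1, rfl⟩
    exact ⟨s, ⟨h0, h1⟩, by simp⟩

theorem planeCross_eq_zero_of_mem_segment {a b p : ℂ} (h : p ∈ segment ℝ a b) :
    planeCross (b - a) (p - a) = 0 := by
  obtain ⟨s, -, -, rfl⟩ := mem_segment_complex.1 h
  simp [planeCross]; ring

theorem planeCross_add_I_mul (w x y : ℂ) (t : ℝ) :
    planeCross w (x + t * (Complex.I * w) - y) = planeCross w (x - y) + t * ‖w‖ ^ 2 := by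
  rw [← Complex.normSq_eq_norm_sq, Complex.normSq_apply]
  simp [planeCross]; ring

theorem planeCross_swap (a b p : ℂ) :
    planeCross (a - b) (p - b) = - planeCross (b - a) (p - a) := by
  simp [planeCross]; ring

theorem convex_left (w a : ℂ) : Convex ℝ {x : ℂ | 0 < planeCross w (x - a)} := by
  intro x hx y hy s t hs ht hst
  simp only [Set.mem_ofPred_eq] at *
  have : planeCross w (s • x + t • y - a) = s * planeCross w (x - a) + t * planeCross w (y - a) := by
    have h : s = 1 - t := by linarith
    subst h
    simp [planeCross]; ring
  rw [this]
  rcases hs.eq_or_lt with h | h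
  · have : t = 1 := by linarith
    rw [← h, this]; simpa using hy
  · have := mul_nonneg ht hy.le
    have := mul_pos h hx
    linarith

/-! ### Faces of a plane graph and the two sides of an edge -/

namespace PlaneGraph

variable (G : PlaneGraph)

theorem isClosed_drawing : IsClosed G.drawing := by
  apply IsClosed.union G.verts.finite_toSet.isClosed
  have : {p | ∃ a b : G.verts, G.graph.Adj a b ∧ p ∈ segment ℝ (a : ℂ) (b : ℂ)} =
      ⋃ a : G.verts, ⋃ b : G.verts, ⋃ _ : G.graph.Adj a b, segment ℝ (a : ℂ) (b : ℂ) := by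
    ext; simp
  rw [this]
  exact isClosed_iUnion_of_finite fun a => isClosed_iUnion_of_finite fun b =>
    isClosed_iUnion_of_finite fun _ => isClosed_segment_complex _ _

theorem isOpen_compl_drawing : IsOpen G.drawingᶜ := G.isClosed_drawing.isOpen_compl

/-- The part of the drawing away from the edge `ab`. -/
def otherDrawing (a b : G.verts) : Set ℂ :=
  {p | ∃ v : G.verts, v ≠ a ∧ v ≠ b ∧ p = v} ∪
    {p | ∃ c d : G.verts, G.graph.Adj c d ∧ s(a, b) ≠ s(c, d) ∧ p ∈ segment ℝ (c : ℂ) (d : ℂ)}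

theorem isClosed_otherDrawing (a b : G.verts) : IsClosed (G.otherDrawing a b) := by
  apply IsClosed.union
  · apply Set.Finite.isClosed
    apply (G.verts.finite_toSet).subset
    rintro p ⟨v, -, -, rfl⟩
    exact v.2
  · have : {p | ∃ c d : G.verts, G.graph.Adj c d ∧ s(a, b) ≠ s(c, d) ∧
        p ∈ segment ℝ (c : ℂ) (d : ℂ)} =
      ⋃ c : G.verts, ⋃ d : G.verts, ⋃ _ : G.graph.Adj c d ∧ s(a, b) ≠ s(c, d),
        segment ℝ (c : ℂ) (d : ℂ) := by
      ext; simp [and_assoc]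
    rw [this]
    exact isClosed_iUnion_of_finite fun a => isClosed_iUnion_of_finite fun b =>
      isClosed_iUnion_of_finite fun _ => isClosed_segment_complex _ _

variable {G}

theorem coe_ne_of_adj {a b : G.verts} (h : G.graph.Adj a b) : (a : ℂ) ≠ b :=
  fun e => h.ne (Subtype.ext e)

theorem sub_ne_zero_of_adj {a b : G.verts} (h : G.graph.Adj a b) : (b : ℂ) - a ≠ 0 :=
  sub_ne_zero.2 (coe_ne_of_adj h).symm

theorem ne_left_of_mem_openSegment {a b p : ℂ} (hab : a ≠ b) (hp : p ∈ openSegment ℝ a b) :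
    p ≠ a := by
  obtain ⟨s, h0, h1, rfl⟩ := mem_openSegment_complex.1 hp
  intro h
  have : (s : ℂ) * (b - a) = 0 := by linear_combination h
  rcases mul_eq_zero.1 this with h | h
  · exact h0.ne' (by exact_mod_cast h)
  · exact hab (by linear_combination -h)

theorem ne_right_of_mem_openSegment {a b p : ℂ} (hab : a ≠ b) (hp : p ∈ openSegment ℝ a b) :
    p ≠ b :=
  ne_left_of_mem_openSegment hab.symm (openSegment_symm ℝ a b ▸ hp)

theorem not_mem_otherDrawing {a b : G.verts} (h : G.graph.Adj a b) {p : ℂ}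
    (hp : p ∈ openSegment ℝ (a : ℂ) b) : p ∉ G.otherDrawing a b := by
  have ha := ne_left_of_mem_openSegment (coe_ne_of_adj h) hp
  have hb := ne_right_of_mem_openSegment (coe_ne_of_adj h) hp
  have hs := openSegment_subset_segment ℝ _ _ hp
  rintro (⟨v, hva, hvb, rfl⟩ | ⟨c, d, hcd, hne, hpc⟩)
  · rcases G.vertex_on_edge a b v h hs with e | e
    exacts [hva e, hvb e]
  · rcases (G.edges_meet a b c d h hcd hne p ⟨hs, hpc⟩).1 with e | e
    exacts [ha e, hb e]

theorem drawing_subset {a b : G.verts} {p : ℂ} (hp : p ∈ G.drawing) :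
    p ∈ G.otherDrawing a b ∨ p ∈ segment ℝ (a : ℂ) b := by
  rcases hp with hp | ⟨c, d, hcd, hp⟩
  · by_cases ha : p = a
    · right; rw [ha]; exact left_mem_segment ℝ _ _
    by_cases hb : p = b
    · right; rw [hb]; exact right_mem_segment ℝ _ _
    left; left
    exact ⟨⟨p, hp⟩, fun e => ha (by rw [← e]), fun e => hb (by rw [← e]), rfl⟩
  · by_cases hs : s(a, b) = s(c, d)
    · right
      rcases Sym2.eq_iff.1 hs with ⟨rfl, rfl⟩ | ⟨rfl, rfl⟩
      · exact hp
      · rw [segment_symm]; exact hp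
    · left; right; exact ⟨c, d, hcd, hs, hp⟩

theorem segment_subset_drawing {a b : G.verts} (h : G.graph.Adj a b) :
    segment ℝ (a : ℂ) b ⊆ G.drawing := fun _ hp => Or.inr ⟨a, b, h, hp⟩

theorem vert_mem_drawing (a : G.verts) : (a : ℂ) ∈ G.drawing := Or.inl a.2

/-- A compact piece of the open edge has positive distance from the rest of the drawing. Its
thickening is convex, so the part to the left of the edge is convex and free of the drawing, and
hence lies in one face. -/
theorem exists_halfStrip {a b : G.verts} (h : G.graph.Adj a b) {p p' : ℂ}
    (hp : p ∈ openSegment ℝ (a : ℂ) b) (hp' : p' ∈ openSegment ℝ (a : ℂ) b) :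
    ∃ δ > 0, IsPreconnected (Metric.thickening δ (segment ℝ p p') ∩
        {x : ℂ | 0 < planeCross (b - a : ℂ) (x - a)}) ∧
      Metric.thickening δ (segment ℝ p p') ∩ {x : ℂ | 0 < planeCross (b - a : ℂ) (x - a)} ⊆
        G.drawingᶜ ∧ Metric.thickening δ (segment ℝ p p') ∩ G.otherDrawing a b = ∅ := by
  have hsub : segment ℝ p p' ⊆ (G.otherDrawing a b)ᶜ := fun x hx =>
    not_mem_otherDrawing h ((convex_openSegment _ _).segment_subset hp hp' hx)
  obtain ⟨δ, hδ, hδs⟩ := (isCompact_segment_complex p p').exists_thickening_subset_open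
    (G.isClosed_otherDrawing a b).isOpen_compl hsub
  refine ⟨δ, hδ, ?_, ?_, ?_⟩
  · exact (((convex_segment p p').thickening δ).inter (convex_left _ _)).isPreconnected
  · rintro x ⟨hx, hx'⟩ hd
    rcases drawing_subset (a := a) (b := b) hd with h1 | h1
    · exact hδs hx h1
    · have := planeCross_eq_zero_of_mem_segment h1
      simp only [Set.mem_ofPred_eq] at hx'
      linarith
  · ext x; simp only [Set.mem_inter_iff, Set.mem_empty_iff_false, iff_false, not_and]
    exact fun h1 h2 => hδs h1 h2

theorem exists_left_near (a b : ℂ) (hab : b - a ≠ 0) (p : ℂ)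
    (hp : planeCross (b - a) (p - a) = 0) {δ : ℝ} (hδ : 0 < δ) :
    ∃ t₀ > 0, ∀ t : ℝ, 0 < t → t < t₀ → p + t * (Complex.I * (b - a)) ∈ Metric.ball p δ ∧
      0 < planeCross (b - a) (p + t * (Complex.I * (b - a)) - a) := by
  have hn : 0 < ‖b - a‖ := norm_pos_iff.2 hab
  refine ⟨δ / ‖b - a‖, by positivity, fun t ht ht' => ⟨?_, ?_⟩⟩
  · simp [abs_of_pos ht]
    rwa [lt_div_iff₀ hn] at ht'
  · rw [planeCross_add_I_mul, hp]; positivity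

/-- The face on the left does not depend on the point of the open edge: the half-strip from the
midpoint to `p` connects the two left half-disks. -/
theorem exists_left_component {a b : G.verts} (h : G.graph.Adj a b) :
    ∃ x ∈ G.drawingᶜ, ∀ p ∈ openSegment ℝ (a : ℂ) b, ∃ δ > 0,
      Metric.ball p δ ∩ {x : ℂ | 0 < planeCross (b - a : ℂ) (x - a)} ⊆
        connectedComponentIn G.drawingᶜ x := by
  have hm : (a : ℂ) + (1 / 2 : ℝ) * (b - a) ∈ openSegment ℝ (a : ℂ) b :=
    mem_openSegment_complex.2 ⟨1 / 2, by norm_num, by norm_num, rfl⟩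
  set m : ℂ := (a : ℂ) + (1 / 2 : ℝ) * (b - a) with hmdef
  have hm0 := planeCross_eq_zero_of_mem_segment (openSegment_subset_segment ℝ _ _ hm)
  have hw := sub_ne_zero_of_adj h
  obtain ⟨δ, hδ, hc, hs, -⟩ := exists_halfStrip h hm hm
  obtain ⟨t₀, ht₀, ht⟩ := exists_left_near a b hw m hm0 hδ
  have hsub : ∀ (p : ℂ) (δ' : ℝ), Metric.ball m δ' ⊆ Metric.thickening δ' (segment ℝ m p) := by
    intro p δ' x hx
    exact Metric.mem_thickening_iff.2 ⟨m, left_mem_segment ℝ _ _, hx⟩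
  have hx := ht (t₀ / 2) (by positivity) (by linarith)
  set x := m + (t₀ / 2 : ℝ) * (Complex.I * (b - a)) with hxdef
  have hxS := (⟨hsub m δ hx.1, hx.2⟩ : x ∈ Metric.thickening δ (segment ℝ m m) ∩
        {x : ℂ | 0 < planeCross (b - a : ℂ) (x - a)})
  refine ⟨x, hs hxS, fun p hp => ?_⟩
  obtain ⟨δ', hδ', hc', hs', -⟩ := exists_halfStrip h hm hp
  refine ⟨δ', hδ', ?_⟩
  obtain ⟨t₁, ht₁, ht'⟩ := exists_left_near a b hw m hm0 hδ'
  have htm : 0 < min t₀ t₁ := lt_min ht₀ ht₁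
  -- The point `y` is close enough to the midpoint to lie in both half-strips, which identifies
  -- their components.
  have hy := ht (min t₀ t₁ / 2) (by positivity) (by linarith [min_le_left t₀ t₁])
  have hy' := ht' (min t₀ t₁ / 2) (by positivity) (by linarith [min_le_right t₀ t₁])
  set y := m + (min t₀ t₁ / 2 : ℝ) * (Complex.I * (b - a)) with hydef
  have hyc : y ∈ connectedComponentIn G.drawingᶜ x :=
    hc.subset_connectedComponentIn hxS hs ⟨hsub m δ hy.1, hy.2⟩
  rw [connectedComponentIn_eq hyc]
  refine subset_trans ?_ (hc'.subset_connectedComponentIn ⟨hsub p δ' hy'.1, hy'.2⟩ hs')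
  rintro z ⟨hz, hz'⟩
  exact ⟨Metric.mem_thickening_iff.2 ⟨p, right_mem_segment ℝ _ _, hz⟩, hz'⟩

/-- The component of the complement of the drawing on the left of an edge. -/
def leftFace {a b : G.verts} (h : G.graph.Adj a b) : Set ℂ :=
  connectedComponentIn G.drawingᶜ (exists_left_component h).choose

variable (G) in
/-- The components of the complement of the drawing. -/
def IsFace (F : Set ℂ) : Prop := ∃ x ∈ G.drawingᶜ, F = connectedComponentIn G.drawingᶜ x

theorem isFace_leftFace {a b : G.verts} (h : G.graph.Adj a b) : G.IsFace (leftFace h) :=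
  ⟨_, (exists_left_component h).choose_spec.1, rfl⟩

theorem leftFace_spec {a b : G.verts} (h : G.graph.Adj a b) {p : ℂ}
    (hp : p ∈ openSegment ℝ (a : ℂ) b) : ∃ δ > 0,
      Metric.ball p δ ∩ {x : ℂ | 0 < planeCross (b - a : ℂ) (x - a)} ⊆ leftFace h :=
  (exists_left_component h).choose_spec.2 p hp

theorem isFace_of_mem_boundedFaces {F : Set ℂ} (h : F ∈ G.boundedFaces) : G.IsFace F := by
  obtain ⟨p, hp, h, -⟩ := h
  exact ⟨p, hp, h⟩

namespace IsFace

variable {F F' : Set ℂ}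

theorem mem_boundedFaces (h : G.IsFace F) (hb : Bornology.IsBounded F) : F ∈ G.boundedFaces := by
  obtain ⟨x, hx, rfl⟩ := h
  exact ⟨x, hx, rfl, hb⟩

theorem isOpen (h : G.IsFace F) : IsOpen F := by
  obtain ⟨x, hx, rfl⟩ := h
  exact G.isOpen_compl_drawing.connectedComponentIn

theorem isPreconnected (h : G.IsFace F) : IsPreconnected F := by
  obtain ⟨x, hx, rfl⟩ := h
  exact isPreconnected_connectedComponentIn

theorem subset_compl (h : G.IsFace F) : F ⊆ G.drawingᶜ := by
  obtain ⟨x, hx, rfl⟩ := h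
  exact connectedComponentIn_subset _ _

theorem nonempty (h : G.IsFace F) : F.Nonempty := by
  obtain ⟨x, hx, rfl⟩ := h
  exact ⟨x, mem_connectedComponentIn hx⟩

theorem eq_component (h : G.IsFace F) {p : ℂ} (hp : p ∈ F) :
    F = connectedComponentIn G.drawingᶜ p := by
  obtain ⟨x, hx, rfl⟩ := h
  exact connectedComponentIn_eq hp

theorem eq_of_mem (h : G.IsFace F) (h' : G.IsFace F') {p : ℂ} (hp : p ∈ F) (hp' : p ∈ F') :
    F = F' := (h.eq_component hp).trans (h'.eq_component hp').symm

theorem component {p : ℂ} (hp : p ∈ G.drawingᶜ) :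
    G.IsFace (connectedComponentIn G.drawingᶜ p) := ⟨p, hp, rfl⟩

theorem mem_of_mem_closure (h : G.IsFace F) {p : ℂ} (hp : p ∈ closure F) (hd : p ∉ G.drawing) :
    p ∈ F := by
  have hF' := component (G := G) hd
  have hpF' := mem_connectedComponentIn (F := G.drawingᶜ) (x := p) hd
  obtain ⟨y, hy, hy'⟩ := mem_closure_iff.1 hp _ hF'.isOpen hpF'
  rw [h.eq_of_mem hF' hy' hy]; exact hpF'

theorem frontier_eq (h : G.IsFace F) : frontier F = closure F ∩ G.drawing := by
  rw [h.isOpen.frontier_eq]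
  ext p
  constructor
  · rintro ⟨h1, h2⟩
    exact ⟨h1, by_contra fun hd => h2 (h.mem_of_mem_closure h1 hd)⟩
  · rintro ⟨h1, h2⟩
    exact ⟨h1, fun hp => h.subset_compl hp h2⟩

theorem mem_frontier_of_mem_closure (h : G.IsFace F) (h' : G.IsFace F') (hne : F ≠ F') {p : ℂ}
    (hp : p ∈ closure F) (hp' : p ∈ closure F') : p ∈ frontier F := by
  rw [h.isOpen.frontier_eq]
  refine ⟨hp, fun hpF => ?_⟩
  obtain ⟨y, hy, hy'⟩ := mem_closure_iff.1 hp' _ h.isOpen hpF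
  exact hne (h.eq_of_mem h' hy hy')

theorem mem_outerFace (h : G.IsFace F) (hb : ¬ Bornology.IsBounded F) {p : ℂ} (hp : p ∈ F) :
    p ∈ G.outerFace := by
  refine ⟨h.subset_compl hp, ?_⟩
  rwa [← h.eq_component hp]

end IsFace

/-- A small disk about `p` is cut by the edge into a half in the left face and a half in the right
face. An open set accumulating at `p` meets one of them, since it cannot stay inside the line. -/
theorem mem_leftFace_or {a b : G.verts} (h : G.graph.Adj a b) {p : ℂ}
    (hp : p ∈ openSegment ℝ (a : ℂ) b) {U : Set ℂ} (hU : IsOpen U) (hpU : p ∈ closure U) :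
    (U ∩ leftFace h).Nonempty ∨ (U ∩ leftFace h.symm).Nonempty := by
  obtain ⟨δ, hδ, h1⟩ := leftFace_spec h hp
  obtain ⟨δ', hδ', h2⟩ := leftFace_spec h.symm (openSegment_symm ℝ (a : ℂ) b ▸ hp)
  have hw := sub_ne_zero_of_adj h
  obtain ⟨x, hx, hxU⟩ := mem_closure_iff.1 hpU (Metric.ball p (min δ δ')) Metric.isOpen_ball
    (Metric.mem_ball_self (lt_min hδ hδ'))
  have hopen : IsOpen (Metric.ball p (min δ δ') ∩ U) := Metric.isOpen_ball.inter hU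
  have key : ∃ y ∈ Metric.ball p (min δ δ') ∩ U, planeCross (b - a : ℂ) (y - a) ≠ 0 := by
    by_cases h0 : planeCross (b - a : ℂ) (x - a) = 0
    · obtain ⟨η, hη, hη'⟩ := Metric.isOpen_iff.1 hopen x ⟨hx, hxU⟩
      obtain ⟨t₀, ht₀, ht⟩ := exists_left_near a b hw x h0 hη
      have := ht (t₀ / 2) (by positivity) (by linarith)
      exact ⟨_, hη' this.1, this.2.ne'⟩
    · exact ⟨x, ⟨hx, hxU⟩, h0⟩
  obtain ⟨y, ⟨hyb, hyU⟩, hy⟩ := key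
  have hyδ := Metric.ball_subset_ball (min_le_left _ _) hyb
  have hyδ' := Metric.ball_subset_ball (min_le_right _ _) hyb
  rcases lt_or_gt_of_ne hy with hlt | hgt
  · right
    refine ⟨y, hyU, h2 ⟨hyδ', ?_⟩⟩
    simp only [Set.mem_ofPred_eq]
    rw [planeCross_swap]; linarith
  · exact Or.inl ⟨y, hyU, h1 ⟨hyδ, hgt⟩⟩

theorem IsFace.eq_leftFace_or {F : Set ℂ} (hF : G.IsFace F) {a b : G.verts}
    (h : G.graph.Adj a b) {p : ℂ} (hp : p ∈ openSegment ℝ (a : ℂ) b) (hpF : p ∈ closure F) :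
    F = leftFace h ∨ F = leftFace h.symm := by
  rcases mem_leftFace_or h hp hF.isOpen hpF with ⟨y, h1, h2⟩ | ⟨y, h1, h2⟩
  · exact Or.inl (hF.eq_of_mem (isFace_leftFace _) h1 h2)
  · exact Or.inr (hF.eq_of_mem (isFace_leftFace _) h1 h2)

theorem segment_subset_closure_leftFace {a b : G.verts} (h : G.graph.Adj a b) :
    segment ℝ (a : ℂ) b ⊆ closure (leftFace h) := by
  rw [← closure_openSegment]
  apply closure_minimal _ isClosed_closure
  intro p hp
  obtain ⟨δ, hδ, h1⟩ := leftFace_spec h hp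
  rw [Metric.mem_closure_iff]
  intro ε hε
  obtain ⟨t₀, ht₀, ht⟩ := exists_left_near a b (sub_ne_zero_of_adj h) p
    (planeCross_eq_zero_of_mem_segment (openSegment_subset_segment ℝ _ _ hp)) (lt_min hδ hε)
  have := ht (t₀ / 2) (by positivity) (by linarith)
  refine ⟨_, h1 ⟨Metric.ball_subset_ball (min_le_left _ _) this.1, this.2⟩, ?_⟩
  rw [dist_comm]
  exact Metric.ball_subset_ball (min_le_right _ _) this.1

theorem segment_subset_frontier_leftFace {a b : G.verts} (h : G.graph.Adj a b) :
    segment ℝ (a : ℂ) b ⊆ frontier (leftFace h) := by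
  rw [(isFace_leftFace h).frontier_eq]
  exact Set.subset_inter (segment_subset_closure_leftFace h) (segment_subset_drawing h)

variable (G) in
theorem isOpen_outerFace : IsOpen G.outerFace := by
  rw [isOpen_iff_forall_mem_open]
  rintro p ⟨hp, hb⟩
  have hF := IsFace.component (G := G) hp
  exact ⟨_, fun q hq => hF.mem_outerFace hb hq, hF.isOpen, mem_connectedComponentIn hp⟩

theorem IsFace.disjoint_outerFace {F : Set ℂ} (hF : G.IsFace F) (hb : Bornology.IsBounded F) :
    Disjoint F G.outerFace := by
  rw [Set.disjoint_left]
  rintro p hp ⟨h1, h2⟩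
  rw [← hF.eq_component hp] at h2
  exact h2 hb

theorem leftFace_subset_outerFace {a b : G.verts} (h : G.graph.Adj a b)
    (hb : ¬ Bornology.IsBounded (leftFace h)) : leftFace h ⊆ G.outerFace :=
  fun _ hp => (isFace_leftFace h).mem_outerFace hb hp

variable (G) in
theorem boundary_eq : G.boundary = closure G.outerFace ∩ G.drawing := by
  rw [boundary, G.isOpen_outerFace.frontier_eq]
  ext p
  constructor
  · rintro ⟨h1, h2⟩
    refine ⟨h1, by_contra fun hd => h2 ?_⟩
    have hF := IsFace.component (G := G) hd
    obtain ⟨y, hy, hy'⟩ := mem_closure_iff.1 h1 _ hF.isOpen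
      (mem_connectedComponentIn (F := G.drawingᶜ) hd)
    refine ⟨hd, fun hb => ?_⟩
    exact Set.disjoint_left.1 (hF.disjoint_outerFace hb) hy hy'
  · rintro ⟨h1, h2⟩
    exact ⟨h1, fun hp => hp.1 h2⟩

theorem segment_subset_boundary_of_not_isBounded {a b : G.verts} (h : G.graph.Adj a b)
    (hb : ¬ Bornology.IsBounded (leftFace h)) : segment ℝ (a : ℂ) b ⊆ G.boundary := by
  rw [G.boundary_eq]
  exact Set.subset_inter ((segment_subset_closure_leftFace h).trans
    (closure_mono (leftFace_subset_outerFace h hb))) (segment_subset_drawing h)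

/-- A single inner point adherent to the outer face suffices, because the outer face then meets one
of the two faces along the edge; that face is unbounded and adheres to the whole edge. -/
theorem segment_subset_boundary {a b : G.verts} (h : G.graph.Adj a b) {p : ℂ}
    (hp : p ∈ openSegment ℝ (a : ℂ) b) (hpo : p ∈ closure G.outerFace) :
    segment ℝ (a : ℂ) b ⊆ G.boundary := by
  rcases mem_leftFace_or h hp G.isOpen_outerFace hpo with ⟨y, h1, h2⟩ | ⟨y, h1, h2⟩
  · apply segment_subset_boundary_of_not_isBounded h
    intro hb
    exact Set.disjoint_left.1 ((isFace_leftFace h).disjoint_outerFace hb) h2 h1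
  · rw [segment_symm]
    apply segment_subset_boundary_of_not_isBounded h.symm
    intro hb
    exact Set.disjoint_left.1 ((isFace_leftFace h.symm).disjoint_outerFace hb) h2 h1

theorem mem_openSegment_of_ne {a b p : ℂ} (hp : p ∈ segment ℝ a b) (ha : p ≠ a) (hb : p ≠ b) :
    p ∈ openSegment ℝ a b :=
  mem_openSegment_of_ne_left_right ha.symm hb.symm hp

/-- The edge `ab` is one of the sides of the quadrilateral `q`. -/
def HasSide (q : Fin 4 → G.verts) (a b : G.verts) : Prop := ∃ j, s(q j, q (j + 1)) = s(a, b)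

/-- Different edges meet only at endpoints, so an inner point of an edge can lie on a side of `q`
only if that side is the edge itself. -/
theorem IsQuadOf.hasSide {q : Fin 4 → G.verts} {F : Set ℂ} (hq : G.IsQuadOf q F)
    {a b : G.verts} (h : G.graph.Adj a b) {p : ℂ} (hp : p ∈ openSegment ℝ (a : ℂ) b)
    (hpF : p ∈ frontier F) : HasSide q a b := by
  rw [hq.2.2, Set.mem_iUnion] at hpF
  obtain ⟨j, hj⟩ := hpF
  refine ⟨j, by_contra fun hne => ?_⟩
  rcases (G.edges_meet _ _ _ _ h (hq.2.1 j) (Ne.symm hne) p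
    ⟨openSegment_subset_segment ℝ _ _ hp, hj⟩).1 with e | e
  · exact ne_left_of_mem_openSegment (coe_ne_of_adj h) hp e
  · exact ne_right_of_mem_openSegment (coe_ne_of_adj h) hp e

theorem exists_mem_openSegment (a b : ℂ) : ∃ p, p ∈ openSegment ℝ a b :=
  ⟨_, mem_openSegment_complex.2 ⟨1 / 2, by norm_num, by norm_num, rfl⟩⟩

theorem IsQuadOf.hasSide_leftFace {q : Fin 4 → G.verts} {a b : G.verts} {h : G.graph.Adj a b}
    (hq : G.IsQuadOf q (leftFace h)) : HasSide q a b := by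
  obtain ⟨p, hp⟩ := exists_mem_openSegment (a : ℂ) b
  exact hq.hasSide h hp
    (segment_subset_frontier_leftFace h (openSegment_subset_segment ℝ _ _ hp))

theorem HasSide.adj {q : Fin 4 → G.verts} {F : Set ℂ} (hq : G.IsQuadOf q F)
    {a b : G.verts} (h : HasSide q a b) : G.graph.Adj a b := by
  obtain ⟨j, hj⟩ := h
  have := hq.2.1 j
  rcases Sym2.eq_iff.1 hj with ⟨h1, h2⟩ | ⟨h1, h2⟩
  · rwa [h1, h2] at this
  · rw [h1, h2] at this; exact this.symm

theorem IsQuadOf.segment_subset_frontier {q : Fin 4 → G.verts} {F : Set ℂ} (hq : G.IsQuadOf q F)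
    {a b : G.verts} (h : HasSide q a b) : segment ℝ (a : ℂ) b ⊆ frontier F := by
  obtain ⟨j, hj⟩ := h
  have : segment ℝ (a : ℂ) b = segment ℝ (q j : ℂ) (q (j + 1)) := by
    rcases Sym2.eq_iff.1 hj with ⟨h1, h2⟩ | ⟨h1, h2⟩
    · rw [h1, h2]
    · rw [h1, h2, segment_symm]
  rw [this, hq.2.2]
  exact Set.subset_iUnion (fun i => segment ℝ (q i : ℂ) (q (i + 1))) j

theorem IsQuadOf.eq_leftFace_or {q : Fin 4 → G.verts} {F : Set ℂ} (hq : G.IsQuadOf q F)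
    (hF : G.IsFace F) {a b : G.verts} (h : G.graph.Adj a b) (hs : HasSide q a b) :
    F = leftFace h ∨ F = leftFace h.symm := by
  obtain ⟨p, hp⟩ := exists_mem_openSegment (a : ℂ) b
  exact hF.eq_leftFace_or h hp (frontier_subset_closure
    (hq.segment_subset_frontier hs (openSegment_subset_segment ℝ _ _ hp)))

end PlaneGraph

/-! ### Orientation of a quadrilateral face with orthogonal diagonals -/

theorem planeCross_add_right (n x y : ℂ) :
    planeCross n (x + y) = planeCross n x + planeCross n y := by
  simp [planeCross]; ring

theorem planeCross_real_mul_right (n x : ℂ) (t : ℝ) :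
    planeCross n (t * x) = t * planeCross n x := by
  simp [planeCross]; ring

theorem planeCross_segment_nonneg {n v a b x : ℂ} (ha : 0 ≤ planeCross n (a - v))
    (hb : 0 ≤ planeCross n (b - v)) (hx : x ∈ segment ℝ a b) : 0 ≤ planeCross n (x - v) := by
  obtain ⟨s, h0, h1, rfl⟩ := mem_segment_complex.1 hx
  have : planeCross n (a + s * (b - a) - v) =
      (1 - s) * planeCross n (a - v) + s * planeCross n (b - v) := by
    simp [planeCross]; ring
  rw [this]
  have := sub_nonneg.2 h1
  positivity

theorem IsPreconnected.subset_of_notMem_frontier {X : Type*} [TopologicalSpace X] {s F : Set X}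
    (hs : IsPreconnected s) (hF : IsOpen F) (h : ∀ x ∈ s, x ∉ frontier F)
    (hne : (s ∩ F).Nonempty) : s ⊆ F := by
  refine hs.subset_left_of_subset_union hF isClosed_closure.isOpen_compl
    (Set.disjoint_compl_right_iff_subset.2 subset_closure) (fun x hx => ?_) hne
  by_contra hn
  simp only [Set.mem_union, Set.mem_compl_iff, not_or, not_not] at hn
  exact h x hx (hF.frontier_eq ▸ ⟨hn.2, hn.1⟩)

/-- A bounded region whose boundary lies on one side of a line through a corner `v` of the
boundary does not lie on the outer side of the edges at that corner. -/
theorem corner_false {F K : Set ℂ} {v w c n : ℂ} {σ : ℝ} (hF : IsOpen F)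
    (hb : Bornology.IsBounded F)
    (hfr : frontier F ⊆ segment ℝ v (v + w) ∪ segment ℝ v c ∪ K) (hK : IsClosed K) (hvK : v ∉ K)
    (hσ : |σ| = 1) (hn : ∀ x ∈ frontier F, 0 ≤ planeCross n (x - v)) (hw : 0 < planeCross n w)
    (hc : σ * planeCross w (c - v) ≤ 0)
    (hε : ∀ ε : ℝ, 0 < ε → ε < 1 → ∃ δ₀ > 0, ∀ δ : ℝ, 0 < δ → δ < δ₀ →
      v + (ε + (σ * δ : ℝ) * Complex.I) * w ∈ F) : False := by
  obtain ⟨η, hη, hηK⟩ := Metric.isOpen_iff.1 hK.isOpen_compl v hvK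
  have hw0 : w ≠ 0 := by rintro rfl; simp [planeCross] at hw
  have hwn : 0 < ‖w‖ := norm_pos_iff.2 hw0
  -- With `ε‖w‖` and `δ‖w‖` at most `η / 4`, the ray below stays away from `K` for `s ≤ 2 * ε`. The
  -- bound on `δ * B` prevents the lateral shift from keeping the ray in the half-plane of `n` after
  -- that.
  obtain ⟨ε, hε0, hε1, hεη⟩ : ∃ ε : ℝ, 0 < ε ∧ ε < 1 ∧ ε * ‖w‖ ≤ η / 4 := by
    refine ⟨min (1 / 2) (η / 4 / ‖w‖), by positivity, by linarith [min_le_left (1/2) (η / 4 / ‖w‖)],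
      ?_⟩
    rw [← le_div_iff₀ hwn]; exact min_le_right _ _
  obtain ⟨δ₀, hδ₀, hδF⟩ := hε ε hε0 hε1
  set B := |planeCross n (Complex.I * w)| with hB
  have hB0 : 0 ≤ B := abs_nonneg _
  obtain ⟨δ, hδ0, hδ1, hδη, hδB⟩ : ∃ δ : ℝ, 0 < δ ∧ δ < δ₀ ∧ δ * ‖w‖ ≤ η / 4 ∧
      δ * B < ε * planeCross n w := by
    refine ⟨min (δ₀ / 2) (min (η / 4 / ‖w‖) (ε * planeCross n w / (B + 1))), by positivity,
      by linarith [min_le_left (δ₀ / 2) (min (η / 4 / ‖w‖) (ε * planeCross n w / (B + 1)))], ?_, ?_⟩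
    · rw [← le_div_iff₀ hwn]; exact (min_le_right _ _).trans (min_le_left _ _)
    · have h1 : min (δ₀ / 2) (min (η / 4 / ‖w‖) (ε * planeCross n w / (B + 1))) ≤
        ε * planeCross n w / (B + 1) := (min_le_right _ _).trans (min_le_right _ _)
      rw [le_div_iff₀ (by positivity)] at h1
      have : 0 < min (δ₀ / 2) (min (η / 4 / ‖w‖) (ε * planeCross n w / (B + 1))) := by positivity
      linarith
  have hxF := hδF δ hδ0 hδ1
  -- The ray starts in `F` next to the edge and runs parallel to `-w`. It misses the edge `w` and
  -- the segment `vc`, as neither lies strictly on its side of the line through the edge. It misses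
  -- `K` near `v`, and for `s > 2 * ε` it is outside the half-plane containing the frontier. So the
  -- whole ray is in `F`, contrary to boundedness.
  let ray : ℝ → ℂ := fun s => v + (((ε - s : ℝ) : ℂ) + (σ * δ : ℝ) * Complex.I) * w
  have hσ2 : σ * σ = 1 := by rw [← abs_mul_abs_self, hσ]; ring
  have hcross : ∀ s, planeCross w (ray s - v) = σ * δ * ‖w‖ ^ 2 := fun s =>
    planeCross_line v w (ε - s) (σ * δ)
  have hdis : ∀ s, 0 ≤ s → ray s ∉ frontier F := by
    intro s hs hfrs
    rcases hfr hfrs with (h1 | h1) | h1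
    · have := planeCross_eq_zero_of_mem_segment h1
      rw [add_sub_cancel_left, hcross s] at this
      have h2 : σ * (σ * δ * ‖w‖ ^ 2) = 0 := by rw [this]; ring
      have h3 : σ * (σ * δ * ‖w‖ ^ 2) = δ * ‖w‖ ^ 2 := by linear_combination (δ * ‖w‖ ^ 2) * hσ2
      have : 0 < δ * ‖w‖ ^ 2 := by positivity
      linarith
    · obtain ⟨τ, hτ0, -, hτ⟩ := mem_segment_complex.1 h1
      have h2 := hcross s
      rw [hτ, add_sub_cancel_left, planeCross_real_mul_right] at h2
      have h3 : τ * (σ * planeCross w (c - v)) = δ * ‖w‖ ^ 2 := by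
        linear_combination σ * h2 + (δ * ‖w‖ ^ 2) * hσ2
      have : 0 < δ * ‖w‖ ^ 2 := by positivity
      have := mul_nonneg hτ0 (neg_nonneg.2 hc)
      linarith
    · by_cases h2 : s ≤ 2 * ε
      · refine hηK ?_ h1
        rw [mem_ball_iff_norm]
        have e : ray s - v = (((ε - s : ℝ) : ℂ) + (σ * δ : ℝ) * Complex.I) * w := by simp [ray]
        rw [e, norm_mul]
        have h3 : ‖((ε - s : ℝ) : ℂ) + (σ * δ : ℝ) * Complex.I‖ ≤ ε + δ := by
          refine (norm_add_le _ _).trans (add_le_add ?_ ?_)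
          · rw [Complex.norm_real, Real.norm_eq_abs, abs_le]
            constructor <;> linarith
          · rw [norm_mul, Complex.norm_real, Complex.norm_I, Real.norm_eq_abs, abs_mul, hσ,
              abs_of_pos hδ0]
            linarith
        calc _ ≤ (ε + δ) * ‖w‖ := by gcongr
          _ < η := by linarith
      · push Not at h2
        have h3 := hn _ hfrs
        have e : ray s - v = ((ε - s : ℝ) : ℂ) * w + ((σ * δ : ℝ) : ℂ) * (Complex.I * w) := by
          simp only [ray]; ring
        rw [e, planeCross_add_right, planeCross_real_mul_right, planeCross_real_mul_right] at h3
        have h4 : σ * δ * planeCross n (Complex.I * w) ≤ δ * B := by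
          calc _ ≤ |σ * δ * planeCross n (Complex.I * w)| := le_abs_self _
            _ = δ * B := by rw [abs_mul, abs_mul, hσ, abs_of_pos hδ0, hB]; ring
        have h5 : (ε - s) * planeCross n w ≤ (-ε) * planeCross n w := by
          gcongr; linarith
        linarith
  have hray : Continuous ray := by fun_prop
  have hpre : IsPreconnected (ray '' Set.Ici 0) := isPreconnected_Ici.image _ hray.continuousOn
  have hsub : ray '' Set.Ici 0 ⊆ F := by
    refine hpre.subset_of_notMem_frontier hF ?_ ⟨_, ⟨0, Set.self_mem_Ici, rfl⟩, ?_⟩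
    · rintro _ ⟨s, hs, rfl⟩
      exact hdis s hs
    · simpa [ray] using hxF
  obtain ⟨R, hR⟩ := (hb.subset hsub).exists_norm_le
  have h1 := hR (ray (ε + (R + ‖v‖ + 1 + δ * ‖w‖) / ‖w‖)) ⟨_, ?_, rfl⟩
  · have e : ray (ε + (R + ‖v‖ + 1 + δ * ‖w‖) / ‖w‖) =
        v + (-(((R + ‖v‖ + 1 + δ * ‖w‖) / ‖w‖ : ℝ) : ℂ) * w + (σ * δ : ℝ) * Complex.I * w) := by
      simp only [ray]; push_cast; ring
    have hR0 : 0 ≤ R := (norm_nonneg _).trans h1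
    have hbig : ‖-(((R + ‖v‖ + 1 + δ * ‖w‖) / ‖w‖ : ℝ) : ℂ) * w‖ = R + ‖v‖ + 1 + δ * ‖w‖ := by
      rw [norm_mul, norm_neg, Complex.norm_real, Real.norm_eq_abs, abs_of_nonneg (by positivity)]
      field_simp
    have hsm : ‖((σ * δ : ℝ) : ℂ) * Complex.I * w‖ = δ * ‖w‖ := by
      rw [norm_mul, norm_mul, Complex.norm_real, Complex.norm_I, Real.norm_eq_abs, abs_mul, hσ,
        abs_of_pos hδ0]; ring
    have t1 := norm_sub_le_norm_add (-(((R + ‖v‖ + 1 + δ * ‖w‖) / ‖w‖ : ℝ) : ℂ) * w)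
      ((σ * δ : ℝ) * Complex.I * w)
    have t2 := norm_sub_le_norm_add (-(((R + ‖v‖ + 1 + δ * ‖w‖) / ‖w‖ : ℝ) : ℂ) * w +
      (σ * δ : ℝ) * Complex.I * w) v
    rw [add_comm _ v, ← e] at t2
    rw [hbig, hsm] at t1
    linarith
  · have hR0 : 0 ≤ R := (norm_nonneg _).trans (hR _ ⟨0, Set.self_mem_Ici, rfl⟩)
    simp only [Set.mem_Ici]; positivity

namespace PlaneGraph

variable {G : PlaneGraph}

theorem leftFace_left_near {a b : G.verts} (h : G.graph.Adj a b) {ε : ℝ} (h0 : 0 < ε)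
    (h1 : ε < 1) : ∃ δ₀ > 0, ∀ δ : ℝ, 0 < δ → δ < δ₀ →
      (a : ℂ) + (ε + δ * Complex.I) * (b - a) ∈ leftFace h := by
  have hp : (a : ℂ) + ε * (b - a) ∈ openSegment ℝ (a : ℂ) b :=
    mem_openSegment_complex.2 ⟨ε, h0, h1, rfl⟩
  obtain ⟨η, hη, hs⟩ := leftFace_spec h hp
  obtain ⟨t₀, ht₀, ht⟩ := exists_left_near a b (sub_ne_zero_of_adj h) _
    (planeCross_eq_zero_of_mem_segment (openSegment_subset_segment ℝ _ _ hp)) hη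
  refine ⟨t₀, ht₀, fun δ h2 h3 => ?_⟩
  have := hs (ht δ h2 h3)
  convert this using 1
  ring

theorem IsQuadOf.frontier_eq {q : Fin 4 → G.verts} {F : Set ℂ} (hq : G.IsQuadOf q F) :
    frontier F = segment ℝ (q 0 : ℂ) (q 1) ∪ segment ℝ (q 1 : ℂ) (q 2) ∪
      segment ℝ (q 2 : ℂ) (q 3) ∪ segment ℝ (q 3 : ℂ) (q 0) := by
  rw [hq.2.2]
  ext x
  simp only [Set.mem_iUnion, Fin.exists_fin_succ, Set.mem_union]
  simp [or_assoc]

theorem planeCross_frontier_nonneg {q : Fin 4 → G.verts} {F : Set ℂ} (hq : G.IsQuadOf q F)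
    {n v : ℂ} (h : ∀ i, 0 ≤ planeCross n (q i - v)) : ∀ x ∈ frontier F,
      0 ≤ planeCross n (x - v) := by
  intro x hx
  rw [hq.2.2, Set.mem_iUnion] at hx
  obtain ⟨i, hi⟩ := hx
  exact planeCross_segment_nonneg (h i) (h (i + 1)) hi

theorem IsQuadOf.notMem_segment {q : Fin 4 → G.verts} {F : Set ℂ} (hq : G.IsQuadOf q F)
    {i j : Fin 4} (h1 : i ≠ j) (h2 : i ≠ j + 1) : (q i : ℂ) ∉ segment ℝ (q j : ℂ) (q (j + 1)) := by
  intro h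
  rcases G.vertex_on_edge _ _ _ (hq.2.1 j) h with e | e
  · exact h1 (hq.1 e)
  · exact h2 (hq.1 e)

/-- If a bounded quadrilateral face with orthogonal diagonals lies on the left of its first side,
then the quadrilateral is positively oriented. -/
theorem IsQuadOf.planeCross_pos_zero {q : Fin 4 → G.verts} {F : Set ℂ} (hq : G.IsQuadOf q F)
    (hF : F = leftFace (hq.2.1 0)) (hb : Bornology.IsBounded F)
    (ho : ⟪(q 2 : ℂ) - q 0, (q 3 : ℂ) - q 1⟫_ℝ = 0) :
    0 < planeCross ((q 2 : ℂ) - q 0) ((q 3 : ℂ) - q 1) := by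
  have hinj : ∀ i j, i ≠ j → (q i : ℂ) ≠ q j := fun i j hij e => hij (hq.1 (Subtype.ext e))
  have hd : (q 2 : ℂ) - q 0 ≠ 0 := sub_ne_zero.2 (hinj 2 0 (by decide))
  have hnd : 0 < ‖(q 2 : ℂ) - q 0‖ ^ 2 := by have := norm_pos_iff.2 hd; positivity
  obtain ⟨d, hdd⟩ : ∃ d, d = (q 2 : ℂ) - q 0 := ⟨_, rfl⟩
  have h2 : (q 2 : ℂ) = q 0 + d := by rw [hdd]; ring
  -- Complex coordinates with origin `q 0` and unit `d`: the vertices become `0`, `p + m i`, `1`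
  -- and, by orthogonality of the diagonals, `p + (m + μ) i`. The claim is `μ > 0`.
  obtain ⟨p, m, h1⟩ : ∃ p m : ℝ, (q 1 : ℂ) = q 0 + (p + m * Complex.I) * d := by
    refine ⟨(((q 1 : ℂ) - q 0) / d).re, (((q 1 : ℂ) - q 0) / d).im, ?_⟩
    rw [Complex.re_add_im, div_mul_cancel₀ _ (hdd ▸ hd)]; ring
  obtain ⟨μ, h3⟩ : ∃ μ : ℝ, (q 3 : ℂ) = q 1 + μ * Complex.I * d := by
    obtain ⟨e, he⟩ : ∃ e, e = ((q 3 : ℂ) - q 1) / d := ⟨_, rfl⟩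
    have he' : (q 3 : ℂ) - q 1 = e * d := by rw [he, div_mul_cancel₀ _ (hdd ▸ hd)]
    have : e.re = 0 := by
      rw [he', ← hdd] at ho
      have h4 : ⟪d, e * d⟫_ℝ = e.re * ‖d‖ ^ 2 := by
        rw [← Complex.normSq_eq_norm_sq, Complex.normSq_apply, Complex.inner]; simp; ring
      rw [h4, hdd] at ho
      exact (mul_eq_zero.1 ho).resolve_right hnd.ne'
    refine ⟨e.im, ?_⟩
    rw [← sub_eq_iff_eq_add', he']
    congr 1
    apply Complex.ext <;> simp [this]
  rw [← hdd] at hnd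
  have hcr : planeCross d (μ * Complex.I * d) = μ * ‖d‖ ^ 2 := by
    rw [← Complex.normSq_eq_norm_sq, Complex.normSq_apply]; simp [planeCross]; ring
  rw [← hdd, h3, add_sub_cancel_left, hcr]
  have hμ0 : μ ≠ 0 := by
    rintro rfl
    exact hinj 3 1 (by decide) (by rw [h3]; simp)
  by_contra hneg
  have hμ : μ < 0 := by
    rcases lt_or_gt_of_ne hμ0 with h | h
    · exact h
    · exact absurd (by positivity) hneg
  have hFo : IsOpen F := by rw [hF]; exact (isFace_leftFace _).isOpen
  have hnorm : ‖d‖ ^ 2 = d.re * d.re + d.im * d.im := by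
    rw [← Complex.normSq_eq_norm_sq, Complex.normSq_apply]
  rw [hnorm] at hnd
  -- Suppose `μ < 0`. If `p > 0`, then `q 0` is an extreme corner: all vertices have nonnegative
  -- real coordinate. There `F` would lie on the outer side of the side `q 0 q 1`.
  by_cases hp : 0 < p
  · refine corner_false (v := q 0) (w := q 1 - q 0) (c := q 3) (n := -Complex.I * d) (σ := 1)
      (K := segment ℝ (q 1 : ℂ) (q 2) ∪ segment ℝ (q 2 : ℂ) (q 3)) hFo hb ?_
      ((isClosed_segment_complex _ _).union (isClosed_segment_complex _ _)) ?_ (by simp) ?_ ?_ ?_ ?_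
    · rw [hq.frontier_eq, add_sub_cancel, segment_symm ℝ (q 3 : ℂ)]
      intro x; simp only [Set.mem_union]; tauto
    · rintro (h | h)
      · exact hq.notMem_segment (i := 0) (j := 1) (by decide) (by decide) h
      · exact hq.notMem_segment (i := 0) (j := 2) (by decide) (by decide) h
    · apply planeCross_frontier_nonneg hq
      have e1 : planeCross (-Complex.I * d) (q 1 - q 0) = p * (d.re * d.re + d.im * d.im) := by
        rw [h1]; simp [planeCross]; ring
      have e2 : planeCross (-Complex.I * d) (q 2 - q 0) = d.re * d.re + d.im * d.im := by
        rw [h2]; simp [planeCross]; ring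
      have e3 : planeCross (-Complex.I * d) (q 3 - q 0) = p * (d.re * d.re + d.im * d.im) := by
        rw [h3, h1]; simp [planeCross]; ring
      intro i
      fin_cases i
      · simp [planeCross]
      · exact e1 ▸ by positivity
      · exact e2 ▸ hnd.le
      · exact e3 ▸ by positivity
    · have e1 : planeCross (-Complex.I * d) (q 1 - q 0) = p * (d.re * d.re + d.im * d.im) := by
        rw [h1]; simp [planeCross]; ring
      rw [e1]; positivity
    · have e1 : 1 * planeCross ((q 1 : ℂ) - q 0) (q 3 - q 0) =
          (p * μ) * (d.re * d.re + d.im * d.im) := by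
        rw [h3, h1]; simp [planeCross]; ring
      rw [e1]
      exact mul_nonpos_of_nonpos_of_nonneg (mul_nonpos_of_nonneg_of_nonpos hp.le hμ.le) hnd.le
    · intro ε h4 h5
      obtain ⟨δ₀, h6, h7⟩ := leftFace_left_near (hq.2.1 0) h4 h5
      refine ⟨δ₀, h6, fun δ h8 h9 => ?_⟩
      rw [hF, one_mul]; exact h7 δ h8 h9
  -- If `m > 0`, then `q 1` is extreme, having the greatest imaginary coordinate. The edge is now
  -- directed from `q 1` to `q 0`, so the face is on its right and `σ = -1`.
  by_cases hm : 0 < m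
  · refine corner_false (v := q 1) (w := q 0 - q 1) (c := q 2) (n := - d) (σ := -1)
      (K := segment ℝ (q 2 : ℂ) (q 3) ∪ segment ℝ (q 3 : ℂ) (q 0)) hFo hb ?_
      ((isClosed_segment_complex _ _).union (isClosed_segment_complex _ _)) ?_ (by simp) ?_ ?_ ?_ ?_
    · rw [hq.frontier_eq, add_sub_cancel, segment_symm ℝ (q 0 : ℂ)]
      intro x; simp only [Set.mem_union]; tauto
    · rintro (h | h)
      · exact hq.notMem_segment (i := 1) (j := 2) (by decide) (by decide) h
      · exact hq.notMem_segment (i := 1) (j := 3) (by decide) (by decide) h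
    · apply planeCross_frontier_nonneg hq
      have e1 : planeCross (- d) (q 0 - q 1) = m * (d.re * d.re + d.im * d.im) := by
        rw [h1]; simp [planeCross]; ring
      have e2 : planeCross (- d) (q 2 - q 1) = m * (d.re * d.re + d.im * d.im) := by
        rw [h2, h1]; simp [planeCross]; ring
      have e3 : planeCross (- d) (q 3 - q 1) = (-μ) * (d.re * d.re + d.im * d.im) := by
        rw [h3]; simp [planeCross]; ring
      have := neg_pos.2 hμ
      intro i
      fin_cases i
      · exact e1 ▸ by positivity
      · simp [planeCross]
      · exact e2 ▸ by positivity
      · exact e3 ▸ by positivity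
    · have e1 : planeCross (- d) (q 0 - q 1) = m * (d.re * d.re + d.im * d.im) := by
        rw [h1]; simp [planeCross]; ring
      rw [e1]; positivity
    · have e1 : (-1) * planeCross ((q 0 : ℂ) - q 1) (q 2 - q 1) =
          -(m * (d.re * d.re + d.im * d.im)) := by
        rw [h2, h1]; simp [planeCross]; ring
      rw [e1]
      have : 0 < m * (d.re * d.re + d.im * d.im) := by positivity
      linarith
    · intro ε h4 h5
      obtain ⟨δ₀, h6, h7⟩ := leftFace_left_near (hq.2.1 0) (ε := 1 - ε) (by linarith) (by linarith)
      refine ⟨δ₀, h6, fun δ h8 h9 => ?_⟩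
      rw [hF]
      convert h7 δ h8 h9 using 1
      rw [show (q (0 + 1) : ℂ) = q 1 from rfl]
      push_cast
      ring
  -- If `p ≤ 0` and `m ≤ 0`, the opposite sides `q 3 q 0` and `q 1 q 2` intersect, which is
  -- impossible for edges without a common end. The parameters `s` and `t` solve `s * q 3 = q 1 + t
  -- * (q 2 - q 1)` in the above coordinates.
  push Not at hp hm
  have hD : 0 < 1 - p := by linarith
  have hE : m + μ * (1 - p) < 0 := by nlinarith
  set s : ℝ := m / (m + μ * (1 - p)) with hs
  have hs0 : 0 ≤ s := div_nonneg_of_nonpos hm hE.le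
  have hs1 : s ≤ 1 := by
    rw [hs, div_le_one_of_neg hE]; nlinarith
  have hsE : s * (m + μ * (1 - p)) = m := div_mul_cancel₀ _ hE.ne
  set t : ℝ := (-p) * (1 - s) / (1 - p) with ht
  have ht0 : 0 ≤ t := div_nonneg (mul_nonneg (by linarith) (by linarith)) hD.le
  have ht1 : t ≤ 1 := by rw [ht, div_le_one hD]; nlinarith
  have htE : t * (1 - p) = (-p) * (1 - s) := div_mul_cancel₀ _ hD.ne'
  have e1 : s * p = p + t * (1 - p) := by linarith
  have e2 : s * (m + μ) = m - t * m := by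
    have : (1 - p) * (s * (m + μ)) = (1 - p) * (m - t * m) := by
      linear_combination hsE + m * htE
    exact mul_left_cancel₀ hD.ne' this
  have hx1 : (q 0 : ℂ) + s * (q 3 - q 0) ∈ segment ℝ (q 3 : ℂ) (q (3 + 1)) := by
    rw [segment_symm]; exact mem_segment_complex.2 ⟨s, hs0, hs1, rfl⟩
  have hx2 : (q 0 : ℂ) + s * (q 3 - q 0) ∈ segment ℝ (q 1 : ℂ) (q (1 + 1)) := by
    refine mem_segment_complex.2 ⟨t, ht0, ht1, ?_⟩
    have e1' : (s : ℂ) * p = p + t * (1 - p) := by exact_mod_cast e1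
    have e2' : (s : ℂ) * (m + μ) = m - t * m := by exact_mod_cast e2
    have : (q (1 + 1) : ℂ) = q 0 + d := h2
    rw [this, h3, h1]
    linear_combination d * e1' + d * Complex.I * e2'
  have hne : s(q 3, q (3 + 1)) ≠ s(q 1, q (1 + 1)) := by
    intro e
    rcases Sym2.eq_iff.1 e with ⟨h, -⟩ | ⟨h, -⟩
    · exact absurd (hq.1 h) (by decide)
    · exact absurd (hq.1 h) (by decide)
  obtain ⟨h4, h5⟩ := G.edges_meet _ _ _ _ (hq.2.1 3) (hq.2.1 1) hne _ ⟨hx1, hx2⟩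
  rcases h4 with h4 | h4 <;> rcases h5 with h5 | h5 <;> rw [h4] at h5 <;>
    exact absurd h5 (hinj _ _ (by decide))

/-- The quadrilateral with the first vertex shifted. -/
theorem IsQuadOf.shift {q : Fin 4 → G.verts} {F : Set ℂ} (hq : G.IsQuadOf q F) (j : Fin 4) :
    G.IsQuadOf (fun i => q (i + j)) F := by
  refine ⟨fun a b h => add_right_cancel (hq.1 h), fun i => ?_, ?_⟩
  · have := hq.2.1 (i + j)
    rwa [add_right_comm] at this
  · rw [hq.2.2]
    have : ∀ i, segment ℝ (q (i + j) : ℂ) (q (i + 1 + j)) =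
      (fun i => segment ℝ (q i : ℂ) (q (i + 1))) (Equiv.addRight j i) := by
      intro i; simp [add_right_comm]
    simp_rw [this]
    exact ((Equiv.addRight j).surjective.iUnion_comp _).symm

theorem fin_four_neg : ∀ i : Fin 4, -(i + 1) + 1 = -i := by decide

theorem IsQuadOf.rev {q : Fin 4 → G.verts} {F : Set ℂ} (hq : G.IsQuadOf q F) :
    G.IsQuadOf (fun i => q (-i)) F := by
  refine ⟨fun a b h => neg_injective (hq.1 h), fun i => ?_, ?_⟩
  · have := (hq.2.1 (-(i + 1))).symm
    rwa [fin_four_neg i] at this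
  · rw [hq.2.2]
    have : ∀ i, segment ℝ (q (-i) : ℂ) (q (-(i + 1))) =
      (fun i => segment ℝ (q i : ℂ) (q (i + 1))) (Equiv.neg _ (i + 1)) := by
      intro i
      simp only [Equiv.neg_apply]
      rw [segment_symm]
      rw [fin_four_neg i]
    simp_rw [this]
    exact (((Equiv.neg (Fin 4)).surjective.comp (Equiv.addRight 1).surjective).iUnion_comp _).symm

/-- The cross product of the diagonals of a quadrilateral: twice the signed area. -/
noncomputable def orient (q : Fin 4 → G.verts) : ℝ :=
  planeCross ((q 2 : ℂ) - q 0) ((q 3 : ℂ) - q 1)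

theorem orient_shift (q : Fin 4 → G.verts) (j : Fin 4) : orient (fun i => q (i + j)) = orient q := by
  fin_cases j <;> simp [orient, planeCross] <;> ring

theorem orient_rev (q : Fin 4 → G.verts) : orient (fun i => q (-i)) = - orient q := by
  simp [orient, planeCross]
  have h1 : (-1 : Fin 4) = 3 := rfl
  have h2 : (-2 : Fin 4) = 2 := rfl
  have h3 : (-3 : Fin 4) = 1 := rfl
  rw [h1, h2, h3]; ring

theorem inner_shift {q : Fin 4 → G.verts} (ho : ⟪(q 2 : ℂ) - q 0, (q 3 : ℂ) - q 1⟫_ℝ = 0)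
    (j : Fin 4) : ⟪(q (2 + j) : ℂ) - q (0 + j), (q (3 + j) : ℂ) - q (1 + j)⟫_ℝ = 0 := by
  simp only [Complex.inner] at *
  fin_cases j <;> simp at * <;> linarith

theorem leftFace_congr {a b a' b' : G.verts} (h : G.graph.Adj a b) (h' : G.graph.Adj a' b')
    (ha : a = a') (hb : b = b') : leftFace h = leftFace h' := by
  subst ha hb; rfl

/-- A cyclic shift makes any side the first one and changes neither the orientation nor the
orthogonality. -/
theorem IsQuadOf.orient_pos {q : Fin 4 → G.verts} {F : Set ℂ} (hq : G.IsQuadOf q F) {j : Fin 4}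
    (hF : F = leftFace (hq.2.1 j)) (hb : Bornology.IsBounded F)
    (ho : ⟪(q 2 : ℂ) - q 0, (q 3 : ℂ) - q 1⟫_ℝ = 0) : 0 < orient q := by
  rw [← orient_shift q j]
  refine (hq.shift j).planeCross_pos_zero ?_ hb (inner_shift ho j)
  exact hF.trans (leftFace_congr _ _ (by simp) (by rw [zero_add, add_comm]))

/-- Reversing the cyclic order exchanges left and right and negates `orient`. -/
theorem IsQuadOf.orient_neg {q : Fin 4 → G.verts} {F : Set ℂ} (hq : G.IsQuadOf q F) {j : Fin 4}
    (hF : F = leftFace (hq.2.1 j).symm) (hb : Bornology.IsBounded F)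
    (ho : ⟪(q 2 : ℂ) - q 0, (q 3 : ℂ) - q 1⟫_ℝ = 0) : orient q < 0 := by
  rw [← neg_pos, ← orient_rev]
  refine hq.rev.orient_pos (j := -(j + 1)) ?_ hb ?_
  · refine hF.trans (leftFace_congr _ _ ?_ ?_)
    · rw [neg_neg]
    · rw [fin_four_neg, neg_neg]
  · have h1 : (-1 : Fin 4) = 3 := rfl
    have h2 : (-2 : Fin 4) = 2 := rfl
    have h3 : (-3 : Fin 4) = 1 := rfl
    rw [h1, h2, h3, neg_zero, ← neg_sub (q 3 : ℂ), inner_neg_right, ho, neg_zero]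

end PlaneGraph

/-! ### The correspondence between bounded faces and the listed quadrilaterals -/

namespace QuadLattice

open PlaneGraph

variable {Q : QuadLattice}

open Classical in
/-- The bounded face with a given boundary quadrilateral. -/
noncomputable def faceOf (q : Fin 4 → Q.verts) : Set ℂ :=
  if h : q ∈ Q.quads then (Q.face_of_quad q h).choose else ∅

theorem faceOf_mem {q : Fin 4 → Q.verts} (h : q ∈ Q.quads) :
    faceOf q ∈ Q.toPlaneGraph.boundedFaces := by
  rw [faceOf, dif_pos h]; exact (Q.face_of_quad q h).choose_spec.1

theorem isQuadOf_faceOf {q : Fin 4 → Q.verts} (h : q ∈ Q.quads) :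
    Q.toPlaneGraph.IsQuadOf q (faceOf q) := by
  rw [faceOf, dif_pos h]; exact (Q.face_of_quad q h).choose_spec.2

theorem isFace_faceOf {q : Fin 4 → Q.verts} (h : q ∈ Q.quads) :
    Q.toPlaneGraph.IsFace (faceOf q) := isFace_of_mem_boundedFaces (faceOf_mem h)

theorem isBounded_of_mem_boundedFaces {F : Set ℂ} (h : F ∈ Q.toPlaneGraph.boundedFaces) :
    Bornology.IsBounded F := by
  obtain ⟨p, hp, -, hb⟩ := h
  exact hb

theorem eq_of_isQuadOf {q q' : Fin 4 → Q.verts} {F : Set ℂ}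
    (hF : F ∈ Q.toPlaneGraph.boundedFaces) (h : q ∈ Q.quads) (h' : q' ∈ Q.quads)
    (hq : Q.toPlaneGraph.IsQuadOf q F) (hq' : Q.toPlaneGraph.IsQuadOf q' F) : q = q' :=
  (Q.quad_of_face F hF).unique ⟨h, hq⟩ ⟨h', hq'⟩

theorem injective_of_mem {q : Fin 4 → Q.verts} (h : q ∈ Q.quads) : Function.Injective q :=
  (isQuadOf_faceOf h).1

theorem adj_of_mem {q : Fin 4 → Q.verts} (h : q ∈ Q.quads) (j : Fin 4) :
    Q.graph.Adj (q j) (q (j + 1)) := (isQuadOf_faceOf h).2.1 j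

theorem eq_leftFace_of_orient_pos (ho : Q.IsOrthogonal) {q : Fin 4 → Q.verts} (h : q ∈ Q.quads)
    {F : Set ℂ} (hF : F ∈ Q.toPlaneGraph.boundedFaces) (hq : Q.toPlaneGraph.IsQuadOf q F)
    (hpos : 0 < orient q) (j : Fin 4) : F = leftFace (adj_of_mem h j) := by
  rcases hq.eq_leftFace_or (isFace_of_mem_boundedFaces hF) (adj_of_mem h j) ⟨j, rfl⟩ with e | e
  · exact e
  · have := hq.orient_neg e (isBounded_of_mem_boundedFaces hF) (ho q h)
    linarith

theorem eq_leftFace_of_orient_nonpos (ho : Q.IsOrthogonal) {q : Fin 4 → Q.verts}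
    (h : q ∈ Q.quads)
    {F : Set ℂ} (hF : F ∈ Q.toPlaneGraph.boundedFaces) (hq : Q.toPlaneGraph.IsQuadOf q F)
    (hneg : ¬ 0 < orient q) (j : Fin 4) : F = leftFace (adj_of_mem h j).symm := by
  rcases hq.eq_leftFace_or (isFace_of_mem_boundedFaces hF) (adj_of_mem h j) ⟨j, rfl⟩ with e | e
  · exact absurd (hq.orient_pos e (isBounded_of_mem_boundedFaces hF) (ho q h)) hneg
  · exact e

/-- The axioms of the lattice provide for each listed quadrilateral only the existence of a face.
Uniqueness holds because the sign of `orient q` decides on which side of `q 0 q 1` the face lies. -/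
theorem eq_faceOf (ho : Q.IsOrthogonal) {q : Fin 4 → Q.verts} (h : q ∈ Q.quads)
    {F : Set ℂ} (hF : F ∈ Q.toPlaneGraph.boundedFaces) (hq : Q.toPlaneGraph.IsQuadOf q F) :
    faceOf q = F := by
  by_cases hp : 0 < orient q
  · rw [eq_leftFace_of_orient_pos ho h hF hq hp 0]
    exact eq_leftFace_of_orient_pos ho h (faceOf_mem h) (isQuadOf_faceOf h) hp 0
  · rw [eq_leftFace_of_orient_nonpos ho h hF hq hp 0]
    exact eq_leftFace_of_orient_nonpos ho h (faceOf_mem h) (isQuadOf_faceOf h) hp 0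

theorem faceOf_injective {q q' : Fin 4 → Q.verts} (h : q ∈ Q.quads) (h' : q' ∈ Q.quads)
    (e : faceOf q = faceOf q') : q = q' :=
  eq_of_isQuadOf (faceOf_mem h) h h' (isQuadOf_faceOf h) (e ▸ isQuadOf_faceOf h')

theorem exists_quad (ho : Q.IsOrthogonal) {F : Set ℂ} (hF : Q.toPlaneGraph.IsFace F)
    (hb : Bornology.IsBounded F) : ∃ q ∈ Q.quads, faceOf q = F := by
  obtain ⟨q, ⟨hq, hqF⟩, -⟩ := Q.quad_of_face F (hF.mem_boundedFaces hb)
  exact ⟨q, hq, eq_faceOf ho hq (hF.mem_boundedFaces hb) hqF⟩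

/-- A bounded face lying on both sides of an edge would be bounded by a quadrilateral oriented
positively and negatively at once. -/
theorem leftFace_ne (ho : Q.IsOrthogonal) {a b : Q.verts} (h : Q.graph.Adj a b)
    (hb : Bornology.IsBounded (leftFace h)) : leftFace h ≠ leftFace h.symm := by
  intro e
  obtain ⟨q, hq, hqF⟩ := exists_quad ho (isFace_leftFace h) hb
  have hqq := isQuadOf_faceOf hq
  rw [hqF] at hqq
  obtain ⟨j, hj⟩ := hqq.hasSide_leftFace
  have hfin : ∀ {a b : Q.verts} (h : Q.graph.Adj a b), Q.toPlaneGraph.IsQuadOf q (leftFace h) →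
      Bornology.IsBounded (leftFace h) →
      leftFace h = leftFace h.symm → q j = a → q (j + 1) = b → False := by
    rintro a b h hq' hb' e rfl rfl
    have h1 := hq'.orient_pos (j := j) rfl hb' (ho q hq)
    have h2 := hq'.orient_neg (j := j) e hb' (ho q hq)
    linarith
  rcases Sym2.eq_iff.1 hj with ⟨h1, h2⟩ | ⟨h1, h2⟩
  · exact hfin h hqq hb e h1 h2
  · exact hfin h.symm (e ▸ hqq) (e ▸ hb) e.symm h1 h2

theorem hasSide_iff {q : Fin 4 → Q.verts} (hq : q ∈ Q.quads)
    {a b : Q.verts} (h : Q.graph.Adj a b) :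
    HasSide q a b ↔ faceOf q = leftFace h ∨ faceOf q = leftFace h.symm := by
  constructor
  · exact (isQuadOf_faceOf hq).eq_leftFace_or (isFace_faceOf hq) h
  · rintro (e | e)
    · exact (e ▸ isQuadOf_faceOf hq : Q.toPlaneGraph.IsQuadOf q (leftFace h)).hasSide_leftFace
    · obtain ⟨j, hj⟩ := (e ▸ isQuadOf_faceOf hq :
        Q.toPlaneGraph.IsQuadOf q (leftFace h.symm)).hasSide_leftFace
      exact ⟨j, hj.trans Sym2.eq_swap⟩

/-! ### The discrete Laplace equation and the maximum principle -/

/-- The sign of the orientation of a quadrilateral. -/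
noncomputable def orientSign (q : Fin 4 → Q.verts) : ℝ := if 0 < orient q then 1 else -1

theorem orient_pos_iff (ho : Q.IsOrthogonal) {q : Fin 4 → Q.verts} (hq : q ∈ Q.quads) {j : Fin 4}
    {a b : Q.verts} (h : Q.graph.Adj a b) (ha : q j = a) (hb : q (j + 1) = b) :
    0 < orient q ↔ faceOf q = leftFace h := by
  subst ha hb
  constructor
  · intro hp
    exact eq_leftFace_of_orient_pos ho hq (faceOf_mem hq) (isQuadOf_faceOf hq) hp j
  · intro e
    exact (isQuadOf_faceOf hq).orient_pos e (isBounded_of_mem_boundedFaces (faceOf_mem hq))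
      (ho q hq)

open Classical in
/-- The signed number of passages of the boundary of `q` from `a` to `v`. -/
noncomputable def sideSign (q : Fin 4 → Q.verts) (v a : Q.verts) : ℝ :=
  orientSign q * ∑ j, ((if q (j + 1) = v ∧ q j = a then 1 else 0) -
    (if q j = v ∧ q (j + 1) = a then 1 else 0))

theorem sideSign_eq_zero {q : Fin 4 → Q.verts} {v a : Q.verts} (h : ¬ HasSide q v a) :
    sideSign q v a = 0 := by
  rw [sideSign, Finset.sum_eq_zero, mul_zero]
  intro j _
  rw [if_neg, if_neg, sub_zero]
  · rintro ⟨h1, h2⟩; exact h ⟨j, by rw [h1, h2]⟩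
  · rintro ⟨h1, h2⟩; exact h ⟨j, by rw [h1, h2, Sym2.eq_swap]⟩

theorem fin_four_ne : ∀ j : Fin 4, j + 1 ≠ j ∧ j + 2 ≠ j ∧ 2 + j ≠ 0 + j ∧ 3 + j ≠ 1 + j := by decide

theorem fin_four_add_two_ne : ∀ j : Fin 4, j + 1 + 1 ≠ j := by decide

theorem sideSign_of_forward {q : Fin 4 → Q.verts} (hq : q ∈ Q.quads) {j : Fin 4} :
    sideSign q (q j) (q (j + 1)) = - orientSign q := by
  have hi := injective_of_mem hq
  rw [sideSign, Finset.sum_eq_single j]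
  · rw [if_neg, if_pos ⟨rfl, rfl⟩]; · ring
    rintro ⟨h1, -⟩
    exact (fin_four_ne j).1 (hi h1)
  · intro i _ hij
    rw [if_neg, if_neg, sub_zero]
    · rintro ⟨h1, -⟩; exact hij (hi h1)
    · rintro ⟨h1, h2⟩
      have h1 := hi h1
      rw [hi h2] at h1
      exact fin_four_add_two_ne j h1
  · simp

theorem sideSign_of_backward {q : Fin 4 → Q.verts} (hq : q ∈ Q.quads) {j : Fin 4} :
    sideSign q (q (j + 1)) (q j) = orientSign q := by
  have hi := injective_of_mem hq
  rw [sideSign, Finset.sum_eq_single j]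
  · rw [if_pos ⟨rfl, rfl⟩, if_neg]; · ring
    rintro ⟨h1, -⟩
    exact (fin_four_ne j).1 (hi h1).symm
  · intro i _ hij
    rw [if_neg, if_neg, sub_zero]
    · rintro ⟨h1, h2⟩
      have h1 := hi h2
      rw [hi ‹q i = q (j + 1)›] at h1
      exact fin_four_add_two_ne j h1
    · rintro ⟨-, h1⟩; exact hij (hi h1)
  · simp

theorem sideSign_of_left (ho : Q.IsOrthogonal) {q : Fin 4 → Q.verts} (hq : q ∈ Q.quads)
    {v a : Q.verts} (h : Q.graph.Adj v a) (hs : faceOf q = leftFace h) : sideSign q v a = -1 := by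
  obtain ⟨j, hj⟩ := (hasSide_iff hq h).2 (Or.inl hs)
  rcases Sym2.eq_iff.1 hj with ⟨rfl, rfl⟩ | ⟨rfl, rfl⟩
  · rw [sideSign_of_forward hq, orientSign, if_pos ((orient_pos_iff ho hq h rfl rfl).2 hs)]
  · rw [sideSign_of_backward hq, orientSign, if_neg]
    rw [orient_pos_iff ho hq h.symm rfl rfl, hs]
    exact leftFace_ne ho h (hs ▸ isBounded_of_mem_boundedFaces (faceOf_mem hq))

theorem sideSign_of_right (ho : Q.IsOrthogonal) {q : Fin 4 → Q.verts} (hq : q ∈ Q.quads)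
    {v a : Q.verts} (h : Q.graph.Adj v a) (hs : faceOf q = leftFace h.symm) :
    sideSign q v a = 1 := by
  have : sideSign q v a = - sideSign q a v := by
    rw [sideSign, sideSign, ← mul_neg, ← Finset.sum_neg_distrib]
    congr 1
    apply Finset.sum_congr rfl
    intro j _
    rw [neg_sub]
    congr 2 <;> rw [and_comm]
  rw [this, sideSign_of_left ho hq h.symm hs, neg_neg]

/-- Both faces along an edge at an interior vertex are bounded, since otherwise the edge would lie
on the boundary. Traversed positively, they pass the edge in opposite directions, and no other face
contributes. -/
theorem sum_sideSign (ho : Q.IsOrthogonal) {v : Q.verts} (hv : (v : ℂ) ∉ Q.boundary)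
    (a : Q.verts) : ∑ q ∈ Q.quads, sideSign q v a = 0 := by
  classical
  by_cases h : Q.graph.Adj v a
  swap
  · refine Finset.sum_eq_zero fun q hq => sideSign_eq_zero fun hs => h ?_
    exact hs.adj (isQuadOf_faceOf hq)
  have hbd : ∀ {x y : Q.verts} (h : Q.graph.Adj x y), v = x ∨ v = y →
      Bornology.IsBounded (leftFace h) := by
    intro x y h hxy
    by_contra hb
    apply hv
    refine segment_subset_boundary_of_not_isBounded h hb ?_
    rcases hxy with rfl | rfl
    · exact left_mem_segment ℝ _ _
    · exact right_mem_segment ℝ _ _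
  have hbl := hbd h (Or.inl rfl)
  obtain ⟨ql, hql, hqlF⟩ := exists_quad ho (isFace_leftFace h) hbl
  obtain ⟨qr, hqr, hqrF⟩ := exists_quad ho (isFace_leftFace h.symm) (hbd h.symm (Or.inr rfl))
  have hne : ql ≠ qr := by
    rintro rfl
    exact leftFace_ne ho h hbl (hqlF.symm.trans hqrF)
  rw [Finset.sum_eq_add_of_mem ql qr hql hqr hne, sideSign_of_left ho hql h hqlF,
    sideSign_of_right ho hqr h hqrF]
  · ring
  · rintro q hq ⟨h1, h2⟩
    apply sideSign_eq_zero
    rw [hasSide_iff hq h]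
    rintro (e | e)
    · exact h1 (faceOf_injective hq hql (e.trans hqlF.symm))
    · exact h2 (faceOf_injective hq hqr (e.trans hqrF.symm))

theorem fin_four_add_one_three : ∀ j : Fin 4, j + 1 + 3 = j := by decide

open Classical in
-- The increments of `g` around an interior vertex cancel: after regrouping, the coefficient of each
-- `g a` is the signed count of passages of the edge `va`, which vanishes by `sum_sideSign`.
theorem sum_conjugate_eq_zero (ho : Q.IsOrthogonal) {v : Q.verts} (hv : (v : ℂ) ∉ Q.boundary)
    (g : Q.verts → ℝ) : ∑ q ∈ Q.quads, ∑ j, (if q j = v then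
      orientSign q * (g (q (j + 3)) - g (q (j + 1))) else 0) = 0 := by
  have key : ∀ q : Fin 4 → Q.verts, ∑ j, (if q j = v then
      orientSign q * (g (q (j + 3)) - g (q (j + 1))) else 0) = ∑ a, sideSign q v a * g a := by
    intro q
    have h1 : ∑ j, (if q j = v then orientSign q * g (q (j + 3)) else 0) =
        ∑ j, (if q (j + 1) = v then orientSign q * g (q j) else 0) := by
      rw [← Equiv.sum_comp (Equiv.addRight (1 : Fin 4))]
      simp [fin_four_add_one_three]
    have h2 : ∀ j, (if q j = v then
      orientSign q * (g (q (j + 3)) - g (q (j + 1))) else 0) =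
        (if q j = v then orientSign q * g (q (j + 3)) else 0) -
        (if q j = v then orientSign q * g (q (j + 1)) else 0) := by
      intro j; split_ifs <;> ring
    simp_rw [h2, Finset.sum_sub_distrib, h1, sideSign, mul_assoc, Finset.sum_mul,
      Finset.mul_sum]
    rw [Finset.sum_comm, ← Finset.sum_sub_distrib]
    apply Finset.sum_congr rfl
    intro j _
    simp_rw [sub_mul, mul_sub, Finset.sum_sub_distrib]
    congr 1
    · rw [Finset.sum_eq_single (q j)]
      · simp
      · intro a _ ha; rw [if_neg]; · ring
        exact fun h => ha h.2.symm
      · simp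
    · rw [Finset.sum_eq_single (q (j + 1))]
      · simp
      · intro a _ ha; rw [if_neg]; · ring
        exact fun h => ha h.2.symm
      · simp
  simp_rw [key]
  rw [Finset.sum_comm]
  apply Finset.sum_eq_zero
  intro a _
  rw [← Finset.sum_mul, sum_sideSign ho hv, zero_mul]

/-- Orthogonality gives `e = i * (planeCross d e / ‖d‖²) * d`, so `β` is the same imaginary multiple
of `α`. This is the discrete Cauchy-Riemann equation. -/
theorem conjugate_diff {d e α β : ℂ} (hd : d ≠ 0) (he : e ≠ 0) (h : ⟪d, e⟫_ℝ = 0)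
    (hαβ : α / d = β / e) :
    planeCross d e ≠ 0 ∧ β.im = planeCross d e / ‖d‖ ^ 2 * α.re := by
  have hn : 0 < ‖d‖ ^ 2 := by have := norm_pos_iff.2 hd; positivity
  have h1 : ((‖d‖ ^ 2 : ℝ) : ℂ) * e = (planeCross d e : ℝ) * Complex.I * d := by
    rw [← Complex.normSq_eq_norm_sq, Complex.normSq_apply]
    rw [Complex.inner] at h
    simp at h
    apply Complex.ext
    · simp [planeCross]; linear_combination d.re * h
    · simp [planeCross]; linear_combination d.im * h
  constructor
  · intro h0
    rw [h0] at h1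
    simp [hd, he] at h1
  · rw [div_eq_div_iff hd he] at hαβ
    have h2 : (‖d‖ ^ 2 : ℝ) * β = (planeCross d e : ℝ) * Complex.I * α := by
      apply mul_right_cancel₀ hd
      rw [mul_assoc, ← hαβ]; linear_combination α * h1
    have h3 := congrArg Complex.im h2
    rw [Complex.im_ofReal_mul, mul_assoc, Complex.im_ofReal_mul, Complex.I_mul_im] at h3
    field_simp
    linarith

/-- The weight is `|orient q|` over the squared length of the diagonal from `q j`. The orientation
sign makes it positive whichever way `q` is listed. -/
theorem exists_conductance (ho : Q.IsOrthogonal) {f : Q.verts → ℂ} (hf : Q.IsDiscreteAnalytic f)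
    {q : Fin 4 → Q.verts} (hq : q ∈ Q.quads) (j : Fin 4) : ∃ c > 0,
      orientSign q * ((f (q (j + 3))).im - (f (q (j + 1))).im) =
        c * ((f (q (j + 2))).re - (f (q j)).re) := by
  have hi := injective_of_mem hq
  have hne : ∀ i k, i ≠ k → (q i : ℂ) - q k ≠ 0 := fun i k h =>
    sub_ne_zero.2 fun e => h (hi (Subtype.ext e))
  have h0 := inner_shift (ho q hq) j
  have hfj : (f (q (2 + j)) - f (q (0 + j))) / ((q (2 + j) : ℂ) - q (0 + j)) =
      (f (q (3 + j)) - f (q (1 + j))) / ((q (3 + j) : ℂ) - q (1 + j)) := by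
    have h1 := hf q hq
    have h2 : ∀ a b : Fin 4, (f (q a) - f (q b)) / ((q a : ℂ) - q b) =
        (f (q b) - f (q a)) / ((q b : ℂ) - q a) := by
      intro a b; rw [← neg_sub, ← neg_sub (q b : ℂ), neg_div_neg_eq]
    fin_cases j <;> simp
    · rw [h2 2, h2 3]; exact h1
    · rw [h2 3]; exact h1.symm
    · exact h1
    · rw [h2 2]; exact h1.symm
  have hor := orient_shift q j
  obtain ⟨hc0, hc⟩ := conjugate_diff (hne (2 + j) (0 + j) (fin_four_ne j).2.2.1)
    (hne (3 + j) (1 + j) (fin_four_ne j).2.2.2) h0 hfj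
  change orient (fun i => q (i + j)) ≠ 0 at hc0
  change _ = orient (fun i => q (i + j)) / _ * _ at hc
  rw [hor] at hc0 hc
  have hn : 0 < ‖(q (2 + j) : ℂ) - q (0 + j)‖ ^ 2 := by
    have := norm_pos_iff.2 (hne (2 + j) (0 + j) (fin_four_ne j).2.2.1); positivity
  refine ⟨|orient q| / ‖(q (2 + j) : ℂ) - q (0 + j)‖ ^ 2, by positivity, ?_⟩
  rw [zero_add] at hc ⊢
  rw [add_comm j 3, add_comm j 1, add_comm j 2, ← Complex.sub_im, hc, Complex.sub_re, orientSign]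
  split_ifs with hp
  · rw [abs_of_pos hp, one_mul]
  · rw [abs_of_nonpos (not_lt.1 hp)]; ring

/-- The maximum principle at a vertex which is not on the boundary. -/
theorem IsDiscreteHarmonic.eq_of_le (ho : Q.IsOrthogonal) {u : Q.verts → ℝ}
    (hu : Q.IsDiscreteHarmonic u) {v : Q.verts} (hv : (v : ℂ) ∉ Q.boundary)
    (hle : ∀ q ∈ Q.quads, ∀ j, q j = v → u (q (j + 2)) ≤ u v) :
    ∀ q ∈ Q.quads, ∀ j, q j = v → u (q (j + 2)) = u v := by
  classical
  obtain ⟨f, hf, hfu⟩ := hu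
  -- The vanishing sum of conjugate increments becomes a sum of nonpositive terms `c * (u (q (j +
  -- 2)) - u v)` with `c > 0`, so every term is zero.
  have h0 := sum_conjugate_eq_zero ho hv (fun a => (f a).im)
  have hterm : ∀ q ∈ Q.quads, ∀ j, (if q j = v then
      orientSign q * ((f (q (j + 3))).im - (f (q (j + 1))).im) else 0) ≤ 0 := by
    intro q hq j
    split_ifs with h
    · obtain ⟨c, hc, e⟩ := exists_conductance ho hf hq j
      rw [e, ← hfu, ← hfu, h]
      exact mul_nonpos_of_nonneg_of_nonpos hc.le (sub_nonpos.2 (hle q hq j h))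
    · exact le_rfl
  intro q hq j hj
  have h1 := (Finset.sum_eq_zero_iff_of_nonpos
    fun q hq => Finset.sum_nonpos fun j _ => hterm q hq j).1 h0 q hq
  have h2 := (Finset.sum_eq_zero_iff_of_nonpos fun j _ => hterm q hq j).1 h1 j (Finset.mem_univ j)
  rw [if_pos hj] at h2
  obtain ⟨c, hc, e⟩ := exists_conductance ho hf hq j
  rw [e, ← hfu, ← hfu, hj] at h2
  have := (mul_eq_zero.1 h2).resolve_left hc.ne'
  linarith

theorem IsDiscreteHarmonic.neg {u : Q.verts → ℝ} (hu : Q.IsDiscreteHarmonic u) :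
    Q.IsDiscreteHarmonic (-u) := by
  obtain ⟨f, hf, hfu⟩ := hu
  refine ⟨-f, fun q hq => ?_, fun v => by simp [hfu]⟩
  have := hf q hq
  simp only [Pi.neg_apply]
  have h2 : ∀ a b : ℂ, -a - -b = -(a - b) := fun a b => by ring
  rw [h2, h2, neg_div, neg_div, this]

theorem fin_four_add_two_two : ∀ j : Fin 4, j + 2 + 2 = j := by decide

theorem diagGraph_adj {a c : Q.verts} :
    Q.diagGraph.Adj a c ↔ ∃ q ∈ Q.quads, ∃ i, a = q i ∧ c = q (i + 2) := by
  rw [diagGraph, SimpleGraph.fromRel_adj]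
  constructor
  · rintro ⟨-, h | ⟨q, hq, i, h1, h2⟩⟩
    · exact h
    · exact ⟨q, hq, i + 2, h2, by rw [fin_four_add_two_two]; exact h1⟩
  · rintro ⟨q, hq, i, h1, h2⟩
    refine ⟨?_, Or.inl ⟨q, hq, i, h1, h2⟩⟩
    rw [h1, h2]
    intro e
    exact (fin_four_ne i).2.1 (injective_of_mem hq e).symm

end QuadLattice

/-! ### Winding numbers of closed walks -/

section Winding

open Filter Topology

/-- The quotient is real and nonpositive only if `p` lies between `a` and `b`; thus the principal
argument is continuous off the segment. -/
theorem div_mem_slitPlane {a b p : ℂ} (h : p ∉ segment ℝ a b) :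
    (b - p) / (a - p) ∈ Complex.slitPlane := by
  by_contra hn
  rw [Complex.mem_slitPlane_iff, not_or, not_lt, not_not] at hn
  obtain ⟨h1, h2⟩ := hn
  have ha : a - p ≠ 0 := fun e => h (by rw [← sub_eq_zero.1 e]; exact left_mem_segment ℝ _ _)
  obtain ⟨t, ht⟩ : ∃ t : ℝ, t = ((b - p) / (a - p)).re := ⟨_, rfl⟩
  have h3 : (b - p) / (a - p) = t := by
    apply Complex.ext <;> simp [ht, h2]
  rw [← ht] at h1
  rw [div_eq_iff ha] at h3
  apply h
  have h4 : (1 - t : ℂ) ≠ 0 := by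
    have : (1 - t : ℝ) ≠ 0 := by linarith
    exact_mod_cast this
  refine mem_segment_complex.2 ⟨1 / (1 - t), by apply div_nonneg <;> linarith, ?_, ?_⟩
  · rw [div_le_one (by linarith)]; linarith
  · push_cast
    field_simp
    linear_combination -h3

/-- The angle under which the oriented segment `ab` is seen from `p`. -/
noncomputable def viewAngle (a b p : ℂ) : ℝ := Complex.arg ((b - p) / (a - p))

theorem continuousAt_viewAngle {a b p : ℂ} (h : p ∉ segment ℝ a b) :
    ContinuousAt (viewAngle a b) p := by
  have ha : a - p ≠ 0 := fun e => h (by rw [← sub_eq_zero.1 e]; exact left_mem_segment ℝ _ _)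
  refine ContinuousAt.comp (g := Complex.arg) (Complex.continuousAt_arg (div_mem_slitPlane h)) ?_
  exact ContinuousAt.div (by fun_prop) (by fun_prop) ha

theorem exp_viewAngle (a b p : ℂ) (ha : a ≠ p) (hb : b ≠ p) :
    Complex.exp (viewAngle a b p * Complex.I) =
      (b - p) / (a - p) / (‖(b - p)‖ / ‖a - p‖ : ℝ) := by
  have h0 : (b - p) / (a - p) ≠ 0 := div_ne_zero (sub_ne_zero.2 hb) (sub_ne_zero.2 ha)
  have h1 := Complex.norm_mul_exp_arg_mul_I ((b - p) / (a - p))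
  rw [norm_div] at h1
  have h2 : ((‖b - p‖ / ‖a - p‖ : ℝ) : ℂ) ≠ 0 := by
    have h3 := norm_pos_iff.2 (sub_ne_zero.2 hb)
    have h4 := norm_pos_iff.2 (sub_ne_zero.2 ha)
    exact_mod_cast (div_pos h3 h4).ne'
  rw [eq_div_iff h2, mul_comm]
  exact h1

theorem tendsto_viewAngle_cobounded (a b : ℂ) :
    Tendsto (viewAngle a b) (Bornology.cobounded ℂ) (𝓝 0) := by
  have h1 : Tendsto (fun p : ℂ => a - p) (Bornology.cobounded ℂ) (Bornology.cobounded ℂ) := by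
    rw [← tendsto_norm_atTop_iff_cobounded]
    have h2 : Tendsto (fun p : ℂ => ‖p‖ - ‖a‖) (Bornology.cobounded ℂ) atTop :=
      tendsto_atTop_add_const_right _ _ tendsto_norm_cobounded_atTop
    refine tendsto_atTop_mono (fun p => ?_) h2
    rw [norm_sub_rev]; exact norm_sub_norm_le _ _
  have h2 : Tendsto (fun p : ℂ => 1 + (b - a) * (a - p)⁻¹) (Bornology.cobounded ℂ) (𝓝 1) := by
    have := ((tendsto_inv₀_cobounded.comp h1).const_mul (b - a)).const_add 1
    simpa using this
  have h3 := (Complex.continuousAt_arg Complex.one_mem_slitPlane).tendsto.comp h2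
  rw [Complex.arg_one] at h3
  refine h3.congr' ?_
  have h4 : ∀ᶠ p in Bornology.cobounded ℂ, p ≠ a := by
    exact Bornology.isBounded_def.1 Bornology.isBounded_singleton
  filter_upwards [h4] with p hp
  have h5 : a - p ≠ 0 := sub_ne_zero.2 hp.symm
  simp only [Function.comp, viewAngle]
  congr 1
  field_simp
  ring

/-- Crossing a segment changes the angle under which it is seen by `2π`. -/
theorem tendsto_viewAngle_jump {a b : ℂ} (hab : a ≠ b) :
    Tendsto (fun t : ℝ => viewAngle a b (a + (1 / 2 + t * Complex.I) * (b - a)) -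
      viewAngle a b (a + (1 / 2 - t * Complex.I) * (b - a))) (𝓝[>] 0) (𝓝 (2 * Real.pi)) := by
  have hw : b - a ≠ 0 := sub_ne_zero.2 hab.symm
  -- On the two sides of the midpoint the quotients are `r t` and its conjugate, where `r t` tends
  -- to `-1` from above. Their arguments tend to `π` and `-π`.
  let r : ℝ → ℂ := fun t => -(1 / 2 - t * Complex.I) / (1 / 2 + t * Complex.I)
  have hden : ∀ t : ℝ, (1 / 2 + t * Complex.I : ℂ) ≠ 0 := by
    intro t h
    have := congrArg Complex.re h
    norm_num at this
  have hden' : ∀ t : ℝ, (1 / 2 - t * Complex.I : ℂ) ≠ 0 := by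
    intro t h
    have := congrArg Complex.re h
    norm_num at this
  have e1 : ∀ t : ℝ, viewAngle a b (a + (1 / 2 + t * Complex.I) * (b - a)) = Complex.arg (r t) := by
    intro t
    have : a - (a + (1 / 2 + t * Complex.I) * (b - a)) = -((1 / 2 + t * Complex.I) * (b - a)) := by
      ring
    rw [viewAngle, this]
    congr 1
    simp only [r]
    have := hden t
    field_simp
    ring
  have e2 : ∀ t : ℝ, viewAngle a b (a + (1 / 2 - t * Complex.I) * (b - a)) =
      Complex.arg ((starRingEnd ℂ) (r t)) := by
    intro t
    have : a - (a + (1 / 2 - t * Complex.I) * (b - a)) = -((1 / 2 - t * Complex.I) * (b - a)) := by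
      ring
    rw [viewAngle, this]
    congr 1
    have h5 : (starRingEnd ℂ) (r t) = -(1 / 2 + t * Complex.I) / (1 / 2 - t * Complex.I) := by
      simp [r, sub_eq_add_neg, Complex.conj_ofNat]
    rw [h5]
    have := hden' t
    field_simp
    ring
  have him : ∀ t : ℝ, (r t).im = t / (1 / 4 + t ^ 2) := by
    intro t
    have h6 : (1 / 4 + t ^ 2 : ℝ) ≠ 0 := by positivity
    simp [r, Complex.div_im, Complex.normSq_apply]
    field_simp
    ring
  have h0 : r 0 = -1 := by simp [r]
  have hr : ContinuousAt r 0 := ContinuousAt.div (by fun_prop) (by fun_prop) (hden 0)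
  have h1 : Tendsto r (𝓝[>] 0) (𝓝[{z | 0 ≤ z.im}] (-1)) := by
    refine tendsto_nhdsWithin_of_tendsto_nhds_of_eventually_within _ ?_ ?_
    · rw [← h0]; exact hr.tendsto.mono_left nhdsWithin_le_nhds
    · filter_upwards [self_mem_nhdsWithin] with t ht
      have : 0 < t := ht
      change 0 ≤ (r t).im
      rw [him]
      positivity
  have h2 := (Complex.tendsto_arg_nhdsWithin_im_nonneg_of_re_neg_of_im_zero (z := -1)
    (by simp) (by simp)).comp h1
  have h3 := h2.const_mul 2
  refine h3.congr' ?_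
  filter_upwards [self_mem_nhdsWithin] with t ht
  have ht : 0 < t := ht
  rw [e1, e2, Complex.arg_conj, if_neg]
  · simp only [Function.comp]; ring
  · rw [Complex.arg_eq_pi_iff, him]
    have : 0 < t / (1 / 4 + t ^ 2) := by positivity
    intro h; linarith [h.2]

theorem viewAngle_swap_jump {a b : ℂ} (hab : a ≠ b) :
    Tendsto (fun t : ℝ => viewAngle b a (a + (1 / 2 + t * Complex.I) * (b - a)) -
      viewAngle b a (a + (1 / 2 - t * Complex.I) * (b - a))) (𝓝[>] 0) (𝓝 (-(2 * Real.pi))) := by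
  refine (tendsto_viewAngle_jump hab.symm).neg.congr fun t => ?_
  rw [neg_sub]
  congr 2 <;> ring

namespace PlaneGraph

variable {G : PlaneGraph}

/-- The total angle under which a list of oriented edges is seen from a point. -/
noncomputable def totalAngle (l : List G.graph.Dart) (p : ℂ) : ℝ :=
  (l.map fun d => viewAngle d.fst d.snd p).sum

theorem notMem_segment_of_notMem_drawing {a b : G.verts} (h : G.graph.Adj a b) {p : ℂ}
    (hp : p ∉ G.drawing) : p ∉ segment ℝ (a : ℂ) b := fun h' => hp (segment_subset_drawing h h')

theorem continuousAt_totalAngle (l : List G.graph.Dart) {p : ℂ} (hp : p ∉ G.drawing) :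
    ContinuousAt (totalAngle l) p := by
  induction l with
  | nil => exact continuousAt_const (y := (0 : ℝ))
  | cons d l ih =>
    have : totalAngle (d :: l) = fun p => viewAngle d.fst d.snd p + totalAngle l p := by
      ext; simp [totalAngle]
    rw [this]
    exact (continuousAt_viewAngle (notMem_segment_of_notMem_drawing d.adj hp)).add ih

theorem tendsto_totalAngle (l : List G.graph.Dart) :
    Tendsto (totalAngle l) (Bornology.cobounded ℂ) (𝓝 0) := by
  induction l with
  | nil => exact tendsto_const_nhds
  | cons d l ih =>
    have : totalAngle (d :: l) = fun p => viewAngle d.fst d.snd p + totalAngle l p := by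
      ext; simp [totalAngle]
    rw [this]
    simpa using (tendsto_viewAngle_cobounded d.fst d.snd).add ih

theorem ne_of_notMem_drawing {a : G.verts} {p : ℂ} (hp : p ∉ G.drawing) : (a : ℂ) ≠ p :=
  fun e => hp (e ▸ vert_mem_drawing a)

/-- The quotients along the walk telescope. For a closed walk the product is `1`, which makes the
total angle an integer multiple of `2π`. -/
theorem exp_totalAngle {a b : G.verts} (w : G.graph.Walk a b) {p : ℂ} (hp : p ∉ G.drawing) :
    Complex.exp (totalAngle w.darts p * Complex.I) =
      ((b : ℂ) - p) / (a - p) / (‖((b : ℂ) - p)‖ / ‖(a : ℂ) - p‖ : ℝ) := by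
  induction w with
  | nil =>
    rename_i u
    have h := sub_ne_zero.2 (ne_of_notMem_drawing (a := u) hp)
    simp [totalAngle, div_self h, div_self (norm_ne_zero_iff.2 h)]
  | cons h w ih =>
    rename_i u v x
    have : totalAngle (SimpleGraph.Walk.cons h w).darts p =
        viewAngle u v p + totalAngle w.darts p := by simp [totalAngle]
    rw [this]
    push_cast
    rw [add_mul, Complex.exp_add, ih, exp_viewAngle _ _ _ (ne_of_notMem_drawing hp)
      (ne_of_notMem_drawing hp)]
    have h1 := sub_ne_zero.2 (ne_of_notMem_drawing (a := u) hp)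
    have h2 := sub_ne_zero.2 (ne_of_notMem_drawing (a := v) hp)
    have h3 : (‖(u : ℂ) - p‖ : ℂ) ≠ 0 := by exact_mod_cast norm_ne_zero_iff.2 h1
    have h4 : (‖(v : ℂ) - p‖ : ℂ) ≠ 0 := by exact_mod_cast norm_ne_zero_iff.2 h2
    push_cast
    field_simp

theorem exists_windingNumber {a : G.verts} (w : G.graph.Walk a a) {p : ℂ} (hp : p ∉ G.drawing) :
    ∃ n : ℤ, totalAngle w.darts p = n * (2 * Real.pi) := by
  have h := exp_totalAngle w hp
  have h1 := sub_ne_zero.2 (ne_of_notMem_drawing (a := a) hp)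
  rw [div_self h1, div_self (norm_ne_zero_iff.2 h1)] at h
  simp only [Complex.ofReal_one, div_one] at h
  rw [Complex.exp_eq_one_iff] at h
  obtain ⟨n, hn⟩ := h
  refine ⟨n, ?_⟩
  have := congrArg Complex.im hn
  simpa using this

open Classical in
/-- The number of turns of a closed walk around a point. -/
noncomputable def windingNumber {a : G.verts} (w : G.graph.Walk a a) (p : ℂ) : ℤ :=
  if hp : p ∉ G.drawing then (exists_windingNumber w hp).choose else 0

theorem totalAngle_eq {a : G.verts} (w : G.graph.Walk a a) {p : ℂ} (hp : p ∉ G.drawing) :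
    totalAngle w.darts p = windingNumber w p * (2 * Real.pi) := by
  rw [windingNumber, dif_pos hp]; exact (exists_windingNumber w hp).choose_spec

/-- The total angle is continuous on the connected face and takes values in `2πℤ`; a jump would
force a half-integer multiple of `2π` by the intermediate value theorem. -/
theorem IsFace.windingNumber_le {F : Set ℂ} (hF : G.IsFace F) {a : G.verts}
    (w : G.graph.Walk a a) {p p' : ℂ} (hp : p ∈ F) (hp' : p' ∈ F) :
    windingNumber w p' ≤ windingNumber w p := by
  by_contra! hlt
  have hc : ContinuousOn (totalAngle w.darts) F := fun x hx =>
    (continuousAt_totalAngle _ (hF.subset_compl hx)).continuousWithinAt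
  have h1 := hF.isPreconnected.intermediate_value hp hp' hc
  rw [totalAngle_eq w (hF.subset_compl hp), totalAngle_eq w (hF.subset_compl hp')] at h1
  have hlt' : (windingNumber w p : ℝ) + 1 ≤ windingNumber w p' := by exact_mod_cast hlt
  have hpi := Real.pi_pos
  obtain ⟨x, hx, hx'⟩ := h1 (a := (windingNumber w p + 1 / 2) * (2 * Real.pi))
    ⟨by gcongr; linarith, by gcongr; linarith⟩
  rw [totalAngle_eq w (hF.subset_compl hx)] at hx'
  have h2 := mul_right_cancel₀ (by positivity : 2 * Real.pi ≠ 0) hx'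
  have h3 : (2 * windingNumber w x : ℝ) = 2 * windingNumber w p + 1 := by linarith
  have h4 : 2 * windingNumber w x = 2 * windingNumber w p + 1 := by exact_mod_cast h3
  omega

theorem IsFace.windingNumber_eq {F : Set ℂ} (hF : G.IsFace F) {a : G.verts}
    (w : G.graph.Walk a a) {p p' : ℂ} (hp : p ∈ F) (hp' : p' ∈ F) :
    windingNumber w p = windingNumber w p' :=
  le_antisymm (hF.windingNumber_le w hp' hp) (hF.windingNumber_le w hp hp')

/-- All angles of view tend to zero at infinity, and an unbounded face contains points arbitrarily
far away. -/
theorem IsFace.windingNumber_eq_zero {F : Set ℂ} (hF : G.IsFace F)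
    (hb : ¬ Bornology.IsBounded F) {a : G.verts} (w : G.graph.Walk a a) {p : ℂ} (hp : p ∈ F) :
    windingNumber w p = 0 := by
  have hpi := Real.pi_pos
  have h1 : ∀ᶠ x in Bornology.cobounded ℂ, |totalAngle w.darts x| < 2 * Real.pi := by
    have := (tendsto_totalAngle w.darts).abs
    rw [abs_zero] at this
    exact this.eventually (gt_mem_nhds (by positivity))
  obtain ⟨x, hxF, hx⟩ : ∃ x ∈ F, |totalAngle w.darts x| < 2 * Real.pi := by
    by_contra! hcon
    apply hb
    rw [Bornology.isBounded_def]
    filter_upwards [h1] with x hx hxF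
    exact absurd hx (not_lt.2 (hcon x hxF))
  rw [hF.windingNumber_eq w hp hxF]
  rw [totalAngle_eq w (hF.subset_compl hxF), abs_mul, abs_of_pos (by positivity : 0 < 2 * Real.pi)]
    at hx
  have h2 : |(windingNumber w x : ℝ)| < 1 := by
    by_contra! h
    nlinarith
  have h3 : |windingNumber w x| < 1 := by exact_mod_cast h2
  exact Int.abs_lt_one_iff.1 h3

open Classical in
-- Each passage of the edge in either direction contributes `±2π` to the jump across its midpoint,
-- while the other edges contribute a continuous function. Only the parity of the number of passages
-- is retained.
theorem exists_totalAngle_jump {a b : G.verts} (h : G.graph.Adj a b) (l : List G.graph.Dart) :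
    ∃ k : ℤ, ((k : ZMod 2) = (l.map SimpleGraph.Dart.edge).count s(a, b)) ∧
      Tendsto (fun t : ℝ => totalAngle l (a + (1 / 2 + t * Complex.I) * (b - a)) -
      totalAngle l (a + (1 / 2 - t * Complex.I) * (b - a))) (𝓝[>] 0)
        (𝓝 (k * (2 * Real.pi))) := by
  induction l with
  | nil => exact ⟨0, by simp, by simp [totalAngle]⟩
  | cons d l ih =>
    obtain ⟨k, hk, hlim⟩ := ih
    have : ∀ x, totalAngle (d :: l) x = viewAngle d.fst d.snd x + totalAngle l x := by
      intro x; simp [totalAngle]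
    simp_rw [this, add_sub_add_comm]
    rw [List.map_cons, List.count_cons]
    by_cases hd : d.edge = s(a, b)
    · have hd' : s(d.fst, d.snd) = s(a, b) := hd
      rcases Sym2.eq_iff.1 hd' with ⟨h1, h2⟩ | ⟨h1, h2⟩
      · refine ⟨k + 1, by simp [hk, hd], ?_⟩
        rw [h1, h2]
        convert (tendsto_viewAngle_jump (coe_ne_of_adj h)).add hlim using 2
        push_cast; ring
      · refine ⟨k - 1, ?_, ?_⟩
        · simp only [Int.cast_sub, hk, hd]
          simp
          rw [sub_eq_add_neg]; congr 1
        rw [h1, h2]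
        convert (viewAngle_swap_jump (coe_ne_of_adj h)).add hlim using 2
        push_cast; ring
    · refine ⟨k, by simp [hk, hd], ?_⟩
      have hm : (a : ℂ) + (1 / 2 : ℝ) * (b - a) ∈ openSegment ℝ (a : ℂ) b :=
        mem_openSegment_complex.2 ⟨1 / 2, by norm_num, by norm_num, rfl⟩
      have hns : (a : ℂ) + (1 / 2 : ℝ) * (b - a) ∉ segment ℝ (d.fst : ℂ) d.snd := fun hs =>
        not_mem_otherDrawing h hm (Or.inr ⟨d.fst, d.snd, d.adj, Ne.symm hd, hs⟩)
      have hc := continuousAt_viewAngle hns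
      have g1 : Tendsto (fun t : ℝ => (a : ℂ) + (1 / 2 + t * Complex.I) * (b - a)) (𝓝[>] 0)
          (𝓝 ((a : ℂ) + (1 / 2 : ℝ) * (b - a))) := by
        have : Continuous (fun t : ℝ => (a : ℂ) + (1 / 2 + t * Complex.I) * (b - a)) := by fun_prop
        have := (this.tendsto 0).mono_left (nhdsWithin_le_nhds (s := Set.Ioi 0))
        simpa using this
      have g2 : Tendsto (fun t : ℝ => (a : ℂ) + (1 / 2 - t * Complex.I) * (b - a)) (𝓝[>] 0)
          (𝓝 ((a : ℂ) + (1 / 2 : ℝ) * (b - a))) := by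
        have : Continuous (fun t : ℝ => (a : ℂ) + (1 / 2 - t * Complex.I) * (b - a)) := by fun_prop
        have := (this.tendsto 0).mono_left (nhdsWithin_le_nhds (s := Set.Ioi 0))
        simpa using this
      have := ((hc.tendsto.comp g1).sub (hc.tendsto.comp g2)).add hlim
      simpa using this

open Classical in
theorem windingNumber_jump {a b : G.verts} (h : G.graph.Adj a b) {v : G.verts}
    (w : G.graph.Walk v v) {p p' : ℂ} (hp : p ∈ leftFace h) (hp' : p' ∈ leftFace h.symm) :
    (w.edges.count s(a, b) : ZMod 2) = windingNumber w p + windingNumber w p' := by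
  obtain ⟨k, hk, hlim⟩ := exists_totalAngle_jump h w.darts
  obtain ⟨δ, hδ, h1⟩ := leftFace_left_near h (ε := 1 / 2) (by norm_num) (by norm_num)
  obtain ⟨δ', hδ', h2⟩ := leftFace_left_near h.symm (ε := 1 / 2) (by norm_num) (by norm_num)
  have hpi := Real.pi_pos
  have hev : (fun t : ℝ => totalAngle w.darts (a + (1 / 2 + t * Complex.I) * (b - a)) -
      totalAngle w.darts (a + (1 / 2 - t * Complex.I) * (b - a))) =ᶠ[𝓝[>] 0]
      fun _ => ((windingNumber w p - windingNumber w p' : ℤ) : ℝ) * (2 * Real.pi) := by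
    filter_upwards [Ioo_mem_nhdsGT (lt_min hδ hδ')] with t ht
    have h3 := h1 t ht.1 (ht.2.trans_le (min_le_left _ _))
    have h4 := h2 t ht.1 (ht.2.trans_le (min_le_right _ _))
    have e : (b : ℂ) + ((1 / 2 : ℝ) + t * Complex.I) * (a - b) =
        a + (1 / 2 - t * Complex.I) * (b - a) := by push_cast; ring
    rw [e] at h4
    have e' : (a : ℂ) + ((1 / 2 : ℝ) + t * Complex.I) * (b - a) =
        a + (1 / 2 + t * Complex.I) * (b - a) := by push_cast; ring
    rw [e'] at h3
    rw [totalAngle_eq w ((isFace_leftFace h).subset_compl h3),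
      totalAngle_eq w ((isFace_leftFace h.symm).subset_compl h4),
      (isFace_leftFace h).windingNumber_eq w h3 hp,
      (isFace_leftFace h.symm).windingNumber_eq w h4 hp']
    push_cast; ring
  have hlim2 := tendsto_nhds_unique (hlim.congr' hev) tendsto_const_nhds
  have h5 := mul_right_cancel₀ (by positivity : 2 * Real.pi ≠ 0) hlim2
  have h6 : k = windingNumber w p - windingNumber w p' := by exact_mod_cast h5
  change ((w.darts.map SimpleGraph.Dart.edge).count s(a, b) : ZMod 2) = _
  rw [← hk, h6]
  push_cast
  rw [sub_eq_add_neg, ZMod.neg_eq_self_mod_two]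

end PlaneGraph

/-! ### Closed walks have even length -/

namespace QuadLattice

open PlaneGraph

variable {Q : QuadLattice}

open Classical in
/-- The winding number of a closed walk around a face of the lattice. -/
noncomputable def faceWinding {v : Q.verts} (w : Q.graph.Walk v v) (F : Set ℂ) : ZMod 2 :=
  if h : F.Nonempty then (windingNumber w h.some : ZMod 2) else 0

theorem faceWinding_eq {v : Q.verts} (w : Q.graph.Walk v v) {F : Set ℂ}
    (hF : Q.toPlaneGraph.IsFace F) {p : ℂ} (hp : p ∈ F) :
    faceWinding w F = (windingNumber w p : ZMod 2) := by
  have h : F.Nonempty := ⟨p, hp⟩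
  rw [faceWinding, dif_pos h, hF.windingNumber_eq w hp h.some_mem]

open Classical in
-- Sums over all faces may be taken over bounded faces only, since the winding number vanishes on
-- the unbounded ones.
theorem sum_faceWinding (ho : Q.IsOrthogonal) {v : Q.verts} (w : Q.graph.Walk v v) {F : Set ℂ}
    (hF : Q.toPlaneGraph.IsFace F) :
    ∑ q ∈ Q.quads, (if faceOf q = F then faceWinding w (faceOf q) else 0) = faceWinding w F := by
  by_cases hb : Bornology.IsBounded F
  · obtain ⟨q, hq, hqF⟩ := exists_quad ho hF hb
    rw [Finset.sum_eq_single_of_mem q hq, if_pos hqF, hqF]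
    intro q' hq' hne
    rw [if_neg]
    exact fun e => hne (faceOf_injective hq' hq (e.trans hqF.symm))
  · obtain ⟨p, hp⟩ := hF.nonempty
    rw [faceWinding_eq w hF hp, hF.windingNumber_eq_zero hb w hp]
    rw [Finset.sum_eq_zero]; · simp
    intro q hq
    rw [if_neg]
    exact fun e => hb (e ▸ isBounded_of_mem_boundedFaces (faceOf_mem hq))

open Classical in
-- Modulo 2, a closed walk is the boundary of the chain of bounded faces weighted by their winding
-- numbers.
theorem count_edges_eq (ho : Q.IsOrthogonal) {v : Q.verts} (w : Q.graph.Walk v v)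
    (e : Sym2 Q.verts) : (w.edges.count e : ZMod 2) =
      ∑ q ∈ Q.quads, (if ∃ j, s(q j, q (j + 1)) = e then faceWinding w (faceOf q) else 0) := by
  induction e with
  | _ a b =>
  by_cases h : Q.graph.Adj a b
  · have hL := isFace_leftFace h
    have hR := isFace_leftFace h.symm
    obtain ⟨p, hp⟩ := hL.nonempty
    obtain ⟨p', hp'⟩ := hR.nonempty
    rw [windingNumber_jump h w hp hp', ← faceWinding_eq w hL hp, ← faceWinding_eq w hR hp',
      ← sum_faceWinding ho w hL, ← sum_faceWinding ho w hR, ← Finset.sum_add_distrib]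
    refine Finset.sum_congr rfl fun q hq => ?_
    have hiff : (∃ j, s(q j, q (j + 1)) = s(a, b)) ↔ _ := hasSide_iff hq h
    by_cases h1 : faceOf q = leftFace h
    · have h2 : faceOf q ≠ leftFace h.symm := by
        rw [h1]
        exact leftFace_ne ho h (h1 ▸ isBounded_of_mem_boundedFaces (faceOf_mem hq))
      rw [if_pos h1, if_neg h2, if_pos (hiff.2 (Or.inl h1)), add_zero]
    · by_cases h2 : faceOf q = leftFace h.symm
      · rw [if_neg h1, if_pos h2, if_pos (hiff.2 (Or.inr h2)), zero_add]
      · rw [if_neg h1, if_neg h2, if_neg (fun hs => (hiff.1 hs).elim h1 h2), add_zero]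
  · rw [List.count_eq_zero.2 (fun hm => h (SimpleGraph.Walk.edges_subset_edgeSet w hm)),
      Finset.sum_eq_zero]
    · simp
    · intro q hq
      rw [if_neg]
      exact fun hs => h (HasSide.adj (isQuadOf_faceOf hq) hs)

theorem sides_injective {q : Fin 4 → Q.verts} (hq : q ∈ Q.quads) :
    Function.Injective fun j => s(q j, q (j + 1)) := by
  intro i j h
  have hi := injective_of_mem hq
  rcases Sym2.eq_iff.1 h with ⟨h1, -⟩ | ⟨h1, h2⟩
  · exact hi h1
  · exact absurd ((congrArg (· + 1) (hi h1)).symm.trans (hi h2)) (fin_four_add_two_ne j)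

/-- All closed walks in a quadrilateral lattice have even length. -/
theorem even_length (ho : Q.IsOrthogonal) {v : Q.verts} (w : Q.graph.Walk v v) :
    Even w.length := by
  classical
  rw [← ZMod.natCast_eq_zero_iff_even]
  have h1 : ∑ e : Sym2 Q.verts, w.edges.count e = w.length := by
    rw [← SimpleGraph.Walk.length_edges]
    have := Multiset.sum_count_eq_card (s := Finset.univ) (m := (↑w.edges : Multiset (Sym2 Q.verts)))
      (fun a _ => Finset.mem_univ a)
    simpa using this
  rw [← h1, Nat.cast_sum]
  simp_rw [count_edges_eq ho w]
  rw [Finset.sum_comm]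
  apply Finset.sum_eq_zero
  intro q hq
  rw [← Finset.sum_filter, Finset.sum_const]
  have h2 : (Finset.univ.filter fun e => ∃ j, s(q j, q (j + 1)) = e) =
      Finset.univ.image fun j => s(q j, q (j + 1)) := by
    ext e; simp
  -- Each face contributes its winding number once for each of its four distinct sides, hence an
  -- even amount.
  rw [h2, Finset.card_image_of_injective _ (sides_injective hq), Finset.card_univ,
    Fintype.card_fin, nsmul_eq_mul]
  have : ((4 : ℕ) : ZMod 2) = 0 := rfl
  rw [this, zero_mul]

theorem exists_even_walk {a b : Q.verts} (h : Q.diagGraph.Reachable a b) :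
    ∃ w : Q.graph.Walk a b, Even w.length := by
  obtain ⟨w⟩ := h
  induction w with
  | nil => exact ⟨.nil, by simp⟩
  | cons h _ ih =>
    obtain ⟨w, hw⟩ := ih
    obtain ⟨q, hq, i, rfl, rfl⟩ := diagGraph_adj.1 h
    have h2 := adj_of_mem hq (i + 1)
    rw [add_assoc] at h2
    refine ⟨.cons (adj_of_mem hq i) (.cons h2 w), ?_⟩
    simp only [SimpleGraph.Walk.length_cons]
    rw [add_assoc]
    exact hw.add (by decide)

/-- The ends of an edge are not joined by a path of diagonals. -/
theorem not_reachable_of_adj (ho : Q.IsOrthogonal) {a b : Q.verts} (h : Q.graph.Adj a b) :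
    ¬ Q.diagGraph.Reachable a b := by
  intro hr
  obtain ⟨w, hw⟩ := exists_even_walk hr
  have := even_length ho (SimpleGraph.Walk.cons h.symm w)
  rw [SimpleGraph.Walk.length_cons, Nat.even_add_one] at this
  exact this hw

end QuadLattice

end Winding

/-! ### Oscillation in a disk versus variation along its boundary circle -/

theorem exists_mem_sphere_of_isPreconnected {S : Set ℂ} (hS : IsPreconnected S) {c x y : ℂ} {ρ : ℝ}
    (hx : x ∈ S) (hy : y ∈ S) (hxρ : dist x c ≤ ρ) (hyρ : ρ ≤ dist y c) :
    (S ∩ Metric.sphere c ρ).Nonempty := by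
  obtain ⟨p, hp, hpρ⟩ := hS.intermediate_value hx hy (f := fun p => dist p c)
    (by fun_prop) ⟨hxρ, hyρ⟩
  exact ⟨p, hp, hpρ⟩

namespace QuadLattice

open PlaneGraph

variable {Q : QuadLattice}

theorem add_two_mem_supp {B : Q.diagGraph.ConnectedComponent} {q : Fin 4 → Q.verts}
    (hq : q ∈ Q.quads) {i : Fin 4} (h : q i ∈ B.supp) : q (i + 2) ∈ B.supp := by
  rw [SimpleGraph.ConnectedComponent.mem_supp_iff] at *
  rw [← h]
  exact (SimpleGraph.ConnectedComponent.connectedComponentMk_eq_of_adj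
    (diagGraph_adj.2 ⟨q, hq, i, rfl, rfl⟩)).symm

/-- The total variation of a function along the two diagonals of a quadrilateral. -/
noncomputable def diagVar (u : Q.verts → ℝ) (q : Fin 4 → Q.verts) : ℝ :=
  |u (q 2) - u (q 0)| + |u (q 3) - u (q 1)|

theorem diagVar_nonneg (u : Q.verts → ℝ) (q : Fin 4 → Q.verts) : 0 ≤ diagVar u q := by
  unfold diagVar; positivity

theorem abs_sub_le_diagVar (u : Q.verts → ℝ) (q : Fin 4 → Q.verts) (i : Fin 4) :
    |u (q i) - u (q (i + 2))| ≤ diagVar u q := by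
  have h0 := abs_nonneg (u (q 2) - u (q 0))
  have h1 := abs_nonneg (u (q 3) - u (q 1))
  fin_cases i <;> simp [diagVar]
  · rw [abs_sub_comm]; linarith
  · rw [abs_sub_comm]; linarith

/-- The boundary of the quadrilateral meets the set `A`. -/
def Meets (q : Fin 4 → Q.verts) (A : Set ℂ) : Prop :=
  ∃ j, (segment ℝ (q j : ℂ) (q (j + 1)) ∩ A).Nonempty

open Classical in
/-- The total variation of `u` along the diagonals of the quadrilaterals meeting `A`. -/
noncomputable def varAlong (u : Q.verts → ℝ) (A : Set ℂ) : ℝ :=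
  ∑ q ∈ Q.quads with Meets q A, diagVar u q

theorem varAlong_nonneg (u : Q.verts → ℝ) (A : Set ℂ) : 0 ≤ varAlong u A :=
  Finset.sum_nonneg fun q _ => diagVar_nonneg u q

variable (Q) in
/-- Two quadrilaterals are joined if they have a common side meeting `A`. -/
def adjGraph (A : Set ℂ) : SimpleGraph (Fin 4 → Q.verts) where
  Adj q q' := q ≠ q' ∧ q ∈ Q.quads ∧ q' ∈ Q.quads ∧ ∃ a b, HasSide q a b ∧ HasSide q' a b ∧
    (segment ℝ (a : ℂ) b ∩ A).Nonempty
  symm := ⟨fun _ _ ⟨h1, h2, h3, a, b, h4, h5, h6⟩ => ⟨h1.symm, h3, h2, a, b, h5, h4, h6⟩⟩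
  loopless := ⟨fun _ h => h.1 rfl⟩

theorem Meets.of_hasSide {q : Fin 4 → Q.verts} {A : Set ℂ} {a b : Q.verts} (h : HasSide q a b)
    (hA : (segment ℝ (a : ℂ) b ∩ A).Nonempty) : Meets q A := by
  obtain ⟨j, hj⟩ := h
  refine ⟨j, ?_⟩
  rcases Sym2.eq_iff.1 hj with ⟨h1, h2⟩ | ⟨h1, h2⟩
  · rwa [h1, h2]
  · rwa [h1, h2, segment_symm]

/-- Every side has one end on each diagonal, so from `q i` one reaches an end of the side by moving
along at most one diagonal. -/
theorem exists_mem_side {B : Q.diagGraph.ConnectedComponent} (u : Q.verts → ℝ)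
    {q : Fin 4 → Q.verts} (hq : q ∈ Q.quads)
    {i : Fin 4} (h : q i ∈ B.supp) {a b : Q.verts} (hs : HasSide q a b) :
    ∃ k, (q k = a ∨ q k = b) ∧ q k ∈ B.supp ∧ |u (q i) - u (q k)| ≤ diagVar u q := by
  have key : ∀ k, (k = i ∨ k = i + 2) → q k ∈ B.supp ∧ |u (q i) - u (q k)| ≤ diagVar u q := by
    rintro k (rfl | rfl)
    · exact ⟨h, by simpa using diagVar_nonneg u q⟩
    · exact ⟨add_two_mem_supp hq h, abs_sub_le_diagVar u q i⟩
  obtain ⟨j, hj⟩ := hs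
  have hij : ∀ i j : Fin 4, (j = i ∨ j = i + 2) ∨ (j + 1 = i ∨ j + 1 = i + 2) := by decide
  rcases hij i j with hk | hk
  · refine ⟨j, ?_, key j hk⟩
    rcases Sym2.eq_iff.1 hj with ⟨h1, -⟩ | ⟨h1, -⟩
    exacts [Or.inl h1, Or.inr h1]
  · refine ⟨j + 1, ?_, key _ hk⟩
    rcases Sym2.eq_iff.1 hj with ⟨-, h1⟩ | ⟨-, h1⟩
    exacts [Or.inr h1, Or.inl h1]

theorem HasSide.exists_index {q : Fin 4 → Q.verts} {a b : Q.verts} (h : HasSide q a b) :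
    (∃ k, q k = a) ∧ ∃ k, q k = b := by
  obtain ⟨j, hj⟩ := h
  rcases Sym2.eq_iff.1 hj with ⟨h1, h2⟩ | ⟨h1, h2⟩
  exacts [⟨⟨_, h1⟩, ⟨_, h2⟩⟩, ⟨⟨_, h2⟩, ⟨_, h1⟩⟩]

theorem eq_or_eq_add_two (ho : Q.IsOrthogonal) {B : Q.diagGraph.ConnectedComponent}
    {q : Fin 4 → Q.verts} (hq : q ∈ Q.quads) {i k : Fin 4} (hi : q i ∈ B.supp)
    (hk : q k ∈ B.supp) : k = i ∨ k = i + 2 := by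
  have h : Q.diagGraph.Reachable (q i) (q k) := by
    rw [SimpleGraph.ConnectedComponent.mem_supp_iff] at *
    exact SimpleGraph.ConnectedComponent.exact (hi.trans hk.symm)
  have hik : ∀ i k : Fin 4, (k = i ∨ k = i + 2) ∨ k = i + 1 ∨ i = k + 1 := by decide
  rcases hik i k with h' | rfl | rfl
  · exact h'
  · exact absurd h (not_reachable_of_adj ho (adj_of_mem hq i))
  · exact absurd h (not_reachable_of_adj ho (adj_of_mem hq k).symm)

/-- In each quadrilateral the value of `u` is carried within `B` to an end of the side shared with
the next one. In the last quadrilateral, two vertices of `B` are equal or opposite because ends of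
an edge lie in different components. -/
theorem abs_sub_le_sum_support (ho : Q.IsOrthogonal) {B : Q.diagGraph.ConnectedComponent}
    (u : Q.verts → ℝ) {A : Set ℂ} {q q' : Fin 4 → Q.verts} (p : (Q.adjGraph A).Walk q q')
    (hq : q ∈ Q.quads) {i k : Fin 4} (hi : q i ∈ B.supp) (hk : q' k ∈ B.supp) :
    |u (q i) - u (q' k)| ≤ (p.support.map (diagVar u)).sum := by
  induction p generalizing i with
  | nil =>
    simp only [SimpleGraph.Walk.support_nil, List.map_cons, List.map_nil, List.sum_cons,
      List.sum_nil, add_zero]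
    rcases eq_or_eq_add_two ho hq hi hk with rfl | rfl
    · simpa using diagVar_nonneg u _
    · exact abs_sub_le_diagVar u _ i
  | cons h p ih =>
    obtain ⟨-, -, hq1, a, b, h1, h2, -⟩ := id h
    obtain ⟨k', hk', hkB, hle⟩ := exists_mem_side u hq hi h1
    obtain ⟨i', hi'⟩ : ∃ i', (_ : Fin 4 → Q.verts) i' = _ := hk'.elim
      (fun e => e ▸ (HasSide.exists_index h2).1) (fun e => e ▸ (HasSide.exists_index h2).2)
    have := ih hq1 (hi'.symm ▸ hkB) hk
    rw [hi'] at this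
    simp only [SimpleGraph.Walk.support_cons, List.map_cons, List.sum_cons]
    exact (abs_sub_le _ _ _).trans (add_le_add hle this)

theorem meets_of_mem_support {A : Set ℂ} {q q' : Fin 4 → Q.verts} (p : (Q.adjGraph A).Walk q q')
    (hq : q ∈ Q.quads) (hm : Meets q A) : ∀ s ∈ p.support, s ∈ Q.quads ∧ Meets s A := by
  induction p with
  | nil => intro s hs; simp at hs; exact hs ▸ ⟨hq, hm⟩
  | cons h p ih =>
    obtain ⟨-, -, hq1, a, b, h1, h2, h3⟩ := id h
    intro s hs
    rw [SimpleGraph.Walk.support_cons, List.mem_cons] at hs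
    rcases hs with rfl | hs
    · exact ⟨hq, hm⟩
    · exact ih hq1 (Meets.of_hasSide h2 h3) s hs

/-- Replacing the walk by a path ensures that each quadrilateral is counted at most once. -/
theorem abs_sub_le_varAlong (ho : Q.IsOrthogonal) {B : Q.diagGraph.ConnectedComponent}
    (u : Q.verts → ℝ) {A : Set ℂ} {q q' : Fin 4 → Q.verts} (h : (Q.adjGraph A).Reachable q q')
    (hq : q ∈ Q.quads) (hm : Meets q A) {i k : Fin 4} (hi : q i ∈ B.supp) (hk : q' k ∈ B.supp) :
    |u (q i) - u (q' k)| ≤ varAlong u A := by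
  classical
  obtain ⟨w⟩ := h
  refine (abs_sub_le_sum_support ho u (w.toPath : (Q.adjGraph A).Walk q q') hq hi hk).trans ?_
  rw [← List.sum_toFinset _ w.toPath.2.support_nodup]
  apply Finset.sum_le_sum_of_subset_of_nonneg
  · intro s hs
    rw [Finset.mem_filter]
    exact meets_of_mem_support _ hq hm s (List.mem_toFinset.1 hs)
  · intro s _ _; exact diagVar_nonneg u s

theorem exists_side_of_mem_frontier {q : Fin 4 → Q.verts} (hq : q ∈ Q.quads) {p : ℂ}
    (hp : p ∈ frontier (faceOf q)) (hv : ∀ v : Q.verts, (v : ℂ) ≠ p) :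
    ∃ a b, Q.graph.Adj a b ∧ HasSide q a b ∧ p ∈ openSegment ℝ (a : ℂ) b := by
  rw [(isQuadOf_faceOf hq).2.2, Set.mem_iUnion] at hp
  obtain ⟨j, hj⟩ := hp
  exact ⟨q j, q (j + 1), adj_of_mem hq j, ⟨j, rfl⟩,
    mem_openSegment_of_ne hj (hv _).symm (hv _).symm⟩

theorem exists_face_mem_closure {p : ℂ} (hv : ∀ v : Q.verts, (v : ℂ) ≠ p) :
    ∃ F, Q.toPlaneGraph.IsFace F ∧ p ∈ closure F := by
  by_cases hp : p ∈ Q.toPlaneGraph.drawing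
  · rcases hp with hp | ⟨a, b, h, hp⟩
    · exact absurd rfl (hv ⟨p, hp⟩)
    · exact ⟨_, isFace_leftFace h, segment_subset_closure_leftFace h hp⟩
  · exact ⟨_, IsFace.component hp, subset_closure (mem_connectedComponentIn hp)⟩

theorem adjGraph_reachable_of_mem {A : Set ℂ} {q q' : Fin 4 → Q.verts} (hq : q ∈ Q.quads)
    (hq' : q' ∈ Q.quads) {p : ℂ} (hpA : p ∈ A) (hv : ∀ v : Q.verts, (v : ℂ) ≠ p)
    (hp : p ∈ frontier (faceOf q)) (hp' : p ∈ frontier (faceOf q')) :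
    (Q.adjGraph A).Reachable q q' := by
  by_cases h : q = q'
  · rw [h]
  obtain ⟨a, b, hab, hs, hpo⟩ := exists_side_of_mem_frontier hq hp hv
  exact SimpleGraph.Adj.reachable ⟨h, hq, hq', a, b, hs, (isQuadOf_faceOf hq').hasSide hab hpo hp',
    p, openSegment_subset_segment ℝ _ _ hpo, hpA⟩

/-- Moving along a connected curve through the faces of a lattice one either reaches the boundary
or covers the whole curve by the faces. -/
theorem reach_boundary_or_cover (ho : Q.IsOrthogonal) {A : Set ℂ} (hA : IsPreconnected A)
    (hv : ∀ v : Q.verts, (v : ℂ) ∉ A) {q₀ : Fin 4 → Q.verts} (hq₀ : q₀ ∈ Q.quads)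
    (hm : Meets q₀ A) :
    (∃ q, (Q.adjGraph A).Reachable q₀ q ∧ q ∈ Q.quads ∧ ∃ a b, Q.graph.Adj a b ∧ HasSide q a b ∧
      (segment ℝ (a : ℂ) b ∩ A).Nonempty ∧ (a : ℂ) ∈ Q.boundary ∧ (b : ℂ) ∈ Q.boundary) ∨
    ∀ p ∈ A, p ∉ Q.outerFace ∧
      ∃ q, (Q.adjGraph A).Reachable q₀ q ∧ q ∈ Q.quads ∧ p ∈ closure (faceOf q) := by
  have hv' : ∀ p ∈ A, ∀ v : Q.verts, (v : ℂ) ≠ p := fun p hp v e => hv v (e ▸ hp)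
  -- The quadrilaterals are divided by reachability from `q₀`, and the outer face is put with the
  -- unreachable ones. The closed sets `K₁` and `K₂` cover `A`.
  let S₁ : Set (Fin 4 → Q.verts) := {q | q ∈ Q.quads ∧ (Q.adjGraph A).Reachable q₀ q}
  let S₂ : Set (Fin 4 → Q.verts) := {q | q ∈ Q.quads ∧ ¬ (Q.adjGraph A).Reachable q₀ q}
  let K₁ : Set ℂ := ⋃ q ∈ S₁, closure (faceOf q)
  let K₂ : Set ℂ := (⋃ q ∈ S₂, closure (faceOf q)) ∪ closure Q.outerFace
  have hK₁ : IsClosed K₁ := (Set.toFinite S₁).isClosed_biUnion fun _ _ => isClosed_closure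
  have hK₂ : IsClosed K₂ :=
    ((Set.toFinite S₂).isClosed_biUnion fun _ _ => isClosed_closure).union isClosed_closure
  have hcov : A ⊆ K₁ ∪ K₂ := by
    intro p hp
    obtain ⟨F, hF, hpF⟩ := exists_face_mem_closure (hv' p hp)
    by_cases hb : Bornology.IsBounded F
    · obtain ⟨q, hq, rfl⟩ := exists_quad ho hF hb
      by_cases hr : (Q.adjGraph A).Reachable q₀ q
      · exact Or.inl (Set.mem_biUnion (show q ∈ S₁ from ⟨hq, hr⟩) hpF)
      · exact Or.inr (Or.inl (Set.mem_biUnion (show q ∈ S₂ from ⟨hq, hr⟩) hpF))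
    · exact Or.inr (Or.inr (closure_mono (fun x hx => hF.mem_outerFace hb hx) hpF))
  have hne₁ : (A ∩ K₁).Nonempty := by
    obtain ⟨j, p, hp, hpA⟩ := hm
    refine ⟨p, hpA, Set.mem_biUnion (show q₀ ∈ S₁ from ⟨hq₀, .refl _⟩) ?_⟩
    exact frontier_subset_closure ((isQuadOf_faceOf hq₀).segment_subset_frontier ⟨j, rfl⟩ hp)
  by_cases hne₂ : (A ∩ K₂).Nonempty
  · left
    -- By connectedness of `A` the two closed sets share a point `p` of `A`. It is not a vertex, so
    -- it is interior to a side. If two faces meet there they have this side in common, contrary to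
    -- the division; hence `p` adheres to the outer face and the side is on the boundary.
    obtain ⟨p, hpA, hp₁, hp₂⟩ := isPreconnected_closed_iff.1 hA K₁ K₂ hK₁ hK₂ hcov hne₁ hne₂
    obtain ⟨q, ⟨hq, hqr⟩, hpq⟩ := Set.mem_iUnion₂.1 hp₁
    rcases hp₂ with hp₂ | hp₂
    · obtain ⟨q', ⟨hq', hqr'⟩, hpq'⟩ := Set.mem_iUnion₂.1 hp₂
      exfalso
      have hneF : faceOf q ≠ faceOf q' := by
        intro e
        rw [faceOf_injective hq hq' e] at hqr
        exact hqr' hqr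
      exact hqr' (hqr.trans (adjGraph_reachable_of_mem hq hq' hpA (hv' p hpA)
        ((isFace_faceOf hq).mem_frontier_of_mem_closure (isFace_faceOf hq') hneF hpq hpq')
        ((isFace_faceOf hq').mem_frontier_of_mem_closure (isFace_faceOf hq) hneF.symm hpq' hpq)))
    · have hpf : p ∈ frontier (faceOf q) := by
        rw [(isFace_faceOf hq).isOpen.frontier_eq]
        refine ⟨hpq, fun hpF => ?_⟩
        obtain ⟨y, hy, hy'⟩ := mem_closure_iff.1 hp₂ _ (isFace_faceOf hq).isOpen hpF
        exact Set.disjoint_left.1 ((isFace_faceOf hq).disjoint_outerFace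
          (isBounded_of_mem_boundedFaces (faceOf_mem hq))) hy hy'
      obtain ⟨a, b, hab, hs, hpo⟩ := exists_side_of_mem_frontier hq hpf (hv' p hpA)
      have hsb := segment_subset_boundary hab hpo hp₂
      exact ⟨q, hqr, hq, a, b, hab, hs, ⟨p, openSegment_subset_segment ℝ _ _ hpo, hpA⟩,
        hsb (left_mem_segment ℝ _ _), hsb (right_mem_segment ℝ _ _)⟩
  · right
    intro p hp
    have hp₂ : p ∉ K₂ := fun h => hne₂ ⟨p, hp, h⟩
    refine ⟨fun h => hp₂ (Or.inr (subset_closure h)), ?_⟩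
    obtain ⟨q, ⟨hq, hqr⟩, hpq⟩ := Set.mem_iUnion₂.1 ((hcov hp).resolve_right hp₂)
    exact ⟨q, hqr, hq, hpq⟩

theorem dist_le_maxEdge {a b : Q.verts} (h : Q.graph.Adj a b) :
    dist (a : ℂ) b ≤ Q.maxEdge := by
  apply le_csSup
  · apply Set.Finite.bddAbove
    apply (Set.finite_range fun p : Q.verts × Q.verts => dist (p.1 : ℂ) p.2).subset
    rintro l ⟨a, b, -, rfl⟩
    exact ⟨(a, b), rfl⟩
  · exact ⟨a, b, h, rfl⟩

theorem bddAbove_boundaryOsc (u : Q.verts → ℝ) (B : Q.diagGraph.ConnectedComponent) (R : Set ℂ) :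
    BddAbove {x | ∃ z' ∈ B.supp, ∃ w' ∈ B.supp, (z' : ℂ) ∈ R ∩ Q.boundary ∧
      (w' : ℂ) ∈ R ∩ Q.boundary ∧ x = |u z' - u w'|} := by
  apply Set.Finite.bddAbove
  apply (Set.finite_range fun p : Q.verts × Q.verts => |u p.1 - u p.2|).subset
  rintro l ⟨a, -, b, -, -, -, rfl⟩
  exact ⟨(a, b), rfl⟩

theorem boundaryOsc_nonneg (u : Q.verts → ℝ) (B : Q.diagGraph.ConnectedComponent) (R : Set ℂ) :
    0 ≤ Q.boundaryOsc u B R := by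
  apply Real.sSup_nonneg
  rintro x ⟨a, -, b, -, -, -, rfl⟩
  exact abs_nonneg _

theorem sub_le_boundaryOsc (u : Q.verts → ℝ) {B : Q.diagGraph.ConnectedComponent} {R : Set ℂ}
    {x y : Q.verts} (hx : x ∈ B.supp) (hy : y ∈ B.supp) (hxR : (x : ℂ) ∈ R ∩ Q.boundary)
    (hyR : (y : ℂ) ∈ R ∩ Q.boundary) : u x - u y ≤ Q.boundaryOsc u B R :=
  (le_abs_self _).trans (le_csSup (bddAbove_boundaryOsc u B R) ⟨x, hx, y, hy, hxR, hyR, rfl⟩)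

theorem meets_sphere {q : Fin 4 → Q.verts} {i : Fin 4} {c : ℂ} {ρ : ℝ}
    (h1 : dist (q i : ℂ) c ≤ ρ) (h2 : ρ ≤ dist (q (i + 2) : ℂ) c) :
    Meets q (Metric.sphere c ρ) := by
  rcases le_total ρ (dist (q (i + 1) : ℂ) c) with h | h
  · exact ⟨i, exists_mem_sphere_of_isPreconnected (convex_segment _ _).isPreconnected
      (left_mem_segment ℝ _ _) (right_mem_segment ℝ _ _) h1 h⟩
  · refine ⟨i + 1, exists_mem_sphere_of_isPreconnected (convex_segment _ _).isPreconnected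
      (left_mem_segment ℝ _ _) (right_mem_segment ℝ _ _) h ?_⟩
    rwa [add_assoc]

/-- In a disk the values of a discrete harmonic function on `B` are bounded by its values at the
boundary vertices or at the quadrilaterals leaving the disk. -/
theorem IsDiscreteHarmonic.exists_le (ho : Q.IsOrthogonal) {u : Q.verts → ℝ}
    (hu : Q.IsDiscreteHarmonic u) {B : Q.diagGraph.ConnectedComponent} {z : Q.verts}
    (hz : z ∈ B.supp) {c : ℂ} {ρ : ℝ} (hzc : dist (z : ℂ) c < ρ) :
    (∃ x ∈ B.supp, u z ≤ u x ∧ dist (x : ℂ) c < ρ ∧ (x : ℂ) ∈ Q.boundary) ∨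
    (∃ q ∈ Q.quads, ∃ i, q i ∈ B.supp ∧ u z ≤ u (q i) ∧ Meets q (Metric.sphere c ρ)) ∨
    ∀ x ∈ B.supp, ∀ y ∈ B.supp, u x = u y := by
  let D : Set Q.verts := {v | v ∈ B.supp ∧ dist (v : ℂ) c < ρ}
  -- Take a maximum of `u` over the vertices of `B` in the open disk. If it is attained neither on
  -- the boundary nor at a diagonal leaving the disk, the maximum principle spreads it to all of
  -- `B`.
  obtain ⟨s, hsD, hs⟩ := Set.exists_max_image D u (Set.toFinite D) ⟨z, hz, hzc⟩
  by_cases h1 : ∃ x ∈ D, u s ≤ u x ∧ (x : ℂ) ∈ Q.boundary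
  · obtain ⟨x, hx, hsx, hxb⟩ := h1
    exact Or.inl ⟨x, hx.1, (hs z ⟨hz, hzc⟩).trans hsx, hx.2, hxb⟩
  by_cases h2 : ∃ q ∈ Q.quads, ∃ i, q i ∈ D ∧ u s ≤ u (q i) ∧ ρ ≤ dist (q (i + 2) : ℂ) c
  · obtain ⟨q, hq, i, hi, hle, hρ⟩ := h2
    exact Or.inr (Or.inl ⟨q, hq, i, hi.1, (hs z ⟨hz, hzc⟩).trans hle, meets_sphere hi.2.le hρ⟩)
  push Not at h1 h2
  right; right
  have hstep : ∀ x, x ∈ D ∧ u x = u s → ∀ y, Q.diagGraph.Adj x y → y ∈ D ∧ u y = u s := by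
    rintro x ⟨hx, hxs⟩ y hxy
    have hin : ∀ q ∈ Q.quads, ∀ j, q j = x → q (j + 2) ∈ D := by
      rintro q hq j rfl
      exact ⟨add_two_mem_supp hq hx.1, h2 q hq j hx hxs.ge⟩
    obtain ⟨q, hq, i, hxi, rfl⟩ := diagGraph_adj.1 hxy
    refine ⟨hin q hq i hxi.symm, ?_⟩
    rw [← hxs]
    exact hu.eq_of_le ho (h1 x hx hxs.ge) (fun q hq j hj => hxs ▸ hs _ (hin q hq j hj)) q hq i
      hxi.symm
  have hall : ∀ x ∈ B.supp, u x = u s := by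
    intro x hx
    have hr : Q.diagGraph.Reachable s x := by
      have hs1 := hsD.1
      rw [SimpleGraph.ConnectedComponent.mem_supp_iff] at hs1 hx
      exact SimpleGraph.ConnectedComponent.exact (hs1.trans hx.symm)
    obtain ⟨p⟩ := hr
    have : ∀ {y x : Q.verts} (p : Q.diagGraph.Walk y x), y ∈ D ∧ u y = u s → u x = u s := by
      intro y x p
      induction p with
      | nil => exact fun h => h.2
      | cons h p ih => exact fun h' => ih (hstep _ h' _ h)
    exact this p ⟨hsD, rfl⟩
  intro x hx y hy
  rw [hall x hx, hall y hy]

/-- An unbounded component of the outer face that enters the disk must cross the circle.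
Consequently a circle fully covered by bounded faces encloses no boundary point. -/
theorem outerFace_meets_sphere {x : ℂ} (hx : x ∈ Q.boundary) {c : ℂ} {ρ : ℝ}
    (hxc : dist x c < ρ) : (Q.outerFace ∩ Metric.sphere c ρ).Nonempty := by
  rw [Q.boundary_eq] at hx
  obtain ⟨y, hy, hyo⟩ := mem_closure_iff.1 hx.1 (Metric.ball c ρ) Metric.isOpen_ball hxc
  have hF := IsFace.component (G := Q.toPlaneGraph) hyo.1
  have hyF := mem_connectedComponentIn (F := Q.toPlaneGraph.drawingᶜ) hyo.1
  obtain ⟨y', hy', hyρ⟩ : ∃ y' ∈ connectedComponentIn Q.toPlaneGraph.drawingᶜ y,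
      ρ ≤ dist y' c := by
    by_contra! h
    exact hyo.2 (Metric.isBounded_ball.subset fun p hp => h p hp)
  obtain ⟨p, hp, hpρ⟩ := exists_mem_sphere_of_isPreconnected hF.isPreconnected hyF hy'
    (le_of_lt hy) hyρ
  exact ⟨p, hF.mem_outerFace hyo.2 hp, hpρ⟩

theorem mem_closedBall_of_meets {a b v : Q.verts} (hab : Q.graph.Adj a b) {c : ℂ} {ρ : ℝ}
    (h : (segment ℝ (a : ℂ) b ∩ Metric.sphere c ρ).Nonempty) (hv : v = a ∨ v = b) :
    dist (v : ℂ) c ≤ ρ + Q.maxEdge := by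
  obtain ⟨p, hp, hpc⟩ := h
  have h1 : dist (v : ℂ) p ≤ Q.maxEdge := by
    refine le_trans ?_ (dist_le_maxEdge hab)
    rcases hv with rfl | rfl
    · rw [dist_comm (v : ℂ) b]
      rw [dist_comm (v : ℂ) p, dist_eq_norm, dist_eq_norm]
      exact norm_sub_le_of_mem_segment hp
    · rw [dist_comm (v : ℂ) p, dist_eq_norm, dist_comm, dist_eq_norm]
      rw [segment_symm] at hp
      rw [norm_sub_rev (v : ℂ)]
      exact norm_sub_le_of_mem_segment hp
  have h2 := dist_triangle (v : ℂ) p c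
  rw [Metric.mem_sphere.1 hpc] at h2
  linarith

/-- The oscillation of a discrete harmonic function in a disk is bounded by its oscillation on
the boundary of the lattice and its variation along the boundary of the disk. -/
theorem IsDiscreteHarmonic.sub_le (ho : Q.IsOrthogonal) {u : Q.verts → ℝ}
    (hu : Q.IsDiscreteHarmonic u) {B : Q.diagGraph.ConnectedComponent} {z w : Q.verts}
    (hz : z ∈ B.supp) (hw : w ∈ B.supp) {c : ℂ} {ρ : ℝ} (hzc : dist (z : ℂ) c < ρ)
    (hwc : dist (w : ℂ) c < ρ) (hv : ∀ v : Q.verts, (v : ℂ) ∉ Metric.sphere c ρ) {R : Set ℂ}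
    (hM : 0 ≤ Q.maxEdge)
    (hR : Metric.closedBall c (ρ + Q.maxEdge) ⊆ R) :
    u z - u w ≤ Q.boundaryOsc u B R + 2 * varAlong u (Metric.sphere c ρ) := by
  set A := Metric.sphere c ρ with hAdef
  have hT := varAlong_nonneg u A
  have hO := boundaryOsc_nonneg u B R
  have hA : IsPreconnected A := isPreconnected_sphere (by rw [Complex.rank_real_complex]; norm_num) c ρ
  -- A quadrilateral on the circle is joined along it either to a boundary vertex of `B` in `R`, or
  -- to all other quadrilaterals on the circle. In the latter case no boundary vertex of `B` is
  -- inside the disk.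
  have hreach : ∀ q ∈ Q.quads, Meets q A → ∀ i, q i ∈ B.supp →
      (∃ x ∈ B.supp, (x : ℂ) ∈ R ∩ Q.boundary ∧ |u (q i) - u x| ≤ varAlong u A) ∨
      (∀ x ∈ B.supp, dist (x : ℂ) c < ρ → (x : ℂ) ∉ Q.boundary) ∧
      (∀ q' ∈ Q.quads, Meets q' A → ∀ k, q' k ∈ B.supp →
        |u (q i) - u (q' k)| ≤ varAlong u A) := by
    intro q hq hm i hi
    rcases reach_boundary_or_cover ho hA hv hq hm with
      ⟨q', hr, hq', a, b, hab, hs, hsA, ha, hb⟩ | hcov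
    · left
      obtain ⟨k, hk⟩ : ∃ k, q' k ∈ B.supp ∧ (q' k = a ∨ q' k = b) := by
        obtain ⟨w⟩ := hr
        have : ∀ {q q' : Fin 4 → Q.verts} (w : (Q.adjGraph A).Walk q q'), q ∈ Q.quads →
            ∀ i, q i ∈ B.supp → ∃ i, q' i ∈ B.supp := by
          intro q q' w
          induction w with
          | nil => exact fun _ i hi => ⟨i, hi⟩
          | cons h w ih =>
            intro hq i hi
            obtain ⟨-, -, hq1, a, b, h1, h2, -⟩ := h
            obtain ⟨k', hk', hkB, -⟩ := exists_mem_side u hq hi h1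
            obtain ⟨i', hi'⟩ : ∃ i', (_ : Fin 4 → Q.verts) i' = _ := hk'.elim
              (fun e => e ▸ (HasSide.exists_index h2).1) (fun e => e ▸ (HasSide.exists_index h2).2)
            exact ih hq1 i' (hi'.symm ▸ hkB)
        obtain ⟨i', hi'⟩ := this w hq i hi
        obtain ⟨k, hk, hkB, -⟩ := exists_mem_side u hq' hi' hs
        exact ⟨k, hkB, hk⟩
      refine ⟨q' k, hk.1, ⟨hR (mem_closedBall_of_meets hab hsA hk.2), ?_⟩,
        abs_sub_le_varAlong ho u hr hq hm hi hk.1⟩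
      rcases hk.2 with e | e
      · rw [e]; exact ha
      · rw [e]; exact hb
    · right
      constructor
      · intro x _ hxc hxb
        obtain ⟨p, hpo, hpA⟩ := outerFace_meets_sphere hxb hxc
        exact (hcov p hpA).1 hpo
      · intro q' hq' hm' k hk
        refine abs_sub_le_varAlong ho u ?_ hq hm hi hk
        obtain ⟨j, p, hp, hpA⟩ := hm'
        obtain ⟨-, q₁, hr₁, hq₁, hp₁⟩ := hcov p hpA
        refine hr₁.trans (adjGraph_reachable_of_mem hq₁ hq' hpA (fun v e => hv v (e ▸ hpA)) ?_ ?_)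
        · rw [(isFace_faceOf hq₁).frontier_eq]
          exact ⟨hp₁, segment_subset_drawing (adj_of_mem hq' j) hp⟩
        · exact (isQuadOf_faceOf hq').segment_subset_frontier ⟨j, rfl⟩ hp
  have hinR : ∀ x : Q.verts, dist (x : ℂ) c < ρ → (x : ℂ) ∈ R := fun x hx =>
    hR (Metric.mem_closedBall.2 (by linarith))
  have hconst : (∀ x ∈ B.supp, ∀ y ∈ B.supp, u x = u y) →
      u z - u w ≤ Q.boundaryOsc u B R + 2 * varAlong u A := by
    intro h; rw [h z hz w hw]; linarith
  have hfin : ∀ x ∈ B.supp, ∀ y ∈ B.supp, (x : ℂ) ∈ R ∩ Q.boundary → (y : ℂ) ∈ R ∩ Q.boundary →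
      u z ≤ u x + varAlong u A → u y - varAlong u A ≤ u w →
      u z - u w ≤ Q.boundaryOsc u B R + 2 * varAlong u A := by
    intro x hx y hy hxR hyR h1 h2
    have := sub_le_boundaryOsc u hx hy hxR hyR
    linarith
  -- The maximum principle is applied to `u` at `z` and to `-u` at `w`. Each of the two may need one
  -- passage along the circle, whence the factor 2; a boundary vertex in the disk is incompatible
  -- with a fully covered circle.
  rcases hu.exists_le ho hz hzc with ⟨x, hx, hzx, hxc, hxb⟩ | ⟨q, hq, i, hi, hzi, hm⟩ | h
  · rcases hu.neg.exists_le ho hw hwc with ⟨y, hy, hwy, hyc, hyb⟩ | ⟨q', hq', k, hk, hwk, hm'⟩ | h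
    · simp only [Pi.neg_apply, neg_le_neg_iff] at hwy
      exact hfin x hx y hy ⟨hinR x hxc, hxb⟩ ⟨hinR y hyc, hyb⟩ (by linarith) (by linarith)
    · simp only [Pi.neg_apply, neg_le_neg_iff] at hwk
      rcases hreach q' hq' hm' k hk with ⟨y, hy, hyR, hle⟩ | ⟨hno, -⟩
      · rw [abs_le] at hle
        exact hfin x hx y hy ⟨hinR x hxc, hxb⟩ hyR (by linarith) (by linarith)
      · exact absurd hxb (hno x hx hxc)
    · exact hconst fun x hx y hy => neg_injective (h x hx y hy)
  · rcases hu.neg.exists_le ho hw hwc with ⟨y, hy, hwy, hyc, hyb⟩ | ⟨q', hq', k, hk, hwk, hm'⟩ | h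
    · simp only [Pi.neg_apply, neg_le_neg_iff] at hwy
      rcases hreach q hq hm i hi with ⟨x, hx, hxR, hle⟩ | ⟨hno, -⟩
      · rw [abs_le] at hle
        exact hfin x hx y hy hxR ⟨hinR y hyc, hyb⟩ (by linarith) (by linarith)
      · exact absurd hyb (hno y hy hyc)
    · simp only [Pi.neg_apply, neg_le_neg_iff] at hwk
      rcases hreach q hq hm i hi with ⟨x, hx, hxR, hle⟩ | ⟨-, hcov⟩
      · rcases hreach q' hq' hm' k hk with ⟨y, hy, hyR, hle'⟩ | ⟨-, hcov⟩
        · rw [abs_le] at hle hle'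
          exact hfin x hx y hy hxR hyR (by linarith) (by linarith)
        · have := hcov q hq hm i hi
          rw [abs_le] at this
          linarith
      · have := hcov q' hq' hm' k hk
        rw [abs_le] at this
        linarith
    · exact hconst fun x hx y hy => neg_injective (h x hx y hy)
  · exact hconst h

end QuadLattice

/-! ### Averaging over radii and counting points in an annulus -/

open MeasureTheory in
-- The inequality is integrated over the radii: the left side gives the logarithm, and each `a i` is
-- counted on an interval of length `2 * M`. The finite set `E` of exceptional radii has measure
-- zero.
theorem mul_log_le_of_forall {ι : Type*} (s : Finset ι) {a d : ι → ℝ} (ha : ∀ i ∈ s, 0 ≤ a i)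
    {ρ₁ ρ₂ M X : ℝ} (h1 : 0 < ρ₁) (h2 : ρ₁ ≤ ρ₂) (hM : 0 < M) {E : Set ℝ} (hE : E.Finite)
    (h : ∀ ρ, ρ₁ < ρ → ρ < ρ₂ → ρ ∉ E → X / ρ ≤ ∑ i ∈ s, if |d i - ρ| ≤ M then a i else 0) :
    X * Real.log (ρ₂ / ρ₁) ≤ 2 * M * ∑ i ∈ s, a i := by
  let g : ℝ → ℝ := fun ρ => ∑ i ∈ s, (Set.Icc (d i - M) (d i + M)).indicator (fun _ => a i) ρ
  have hind : ∀ i, Integrable ((Set.Icc (d i - M) (d i + M)).indicator (fun _ => a i)) volume := by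
    intro i
    rw [integrable_indicator_iff measurableSet_Icc]
    exact integrableOn_const (by simp)
  have hg : Integrable g volume := integrable_finsetSum _ fun i _ => hind i
  have hg0 : ∀ ρ, 0 ≤ g ρ := fun ρ => Finset.sum_nonneg fun i hi =>
    Set.indicator_nonneg (fun _ _ => ha i hi) ρ
  have hgi : ∫ ρ, g ρ = 2 * M * ∑ i ∈ s, a i := by
    rw [integral_finsetSum _ fun i _ => hind i, Finset.mul_sum]
    refine Finset.sum_congr rfl fun i _ => ?_
    rw [integral_indicator_const _ measurableSet_Icc, Real.volume_real_Icc_of_le (by linarith)]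
    simp only [smul_eq_mul]; ring
  have hpos : ∀ ρ ∈ Set.uIcc ρ₁ ρ₂, ρ ≠ 0 := by
    intro ρ hρ
    rw [Set.uIcc_of_le h2] at hρ
    linarith [hρ.1]
  have hX : ∫ ρ in ρ₁..ρ₂, X / ρ = X * Real.log (ρ₂ / ρ₁) := by
    simp_rw [div_eq_mul_inv X]
    rw [intervalIntegral.integral_const_mul, integral_inv_of_pos h1 (h1.trans_le h2)]
  have hXi : IntervalIntegrable (fun ρ => X / ρ) volume ρ₁ ρ₂ :=
    (continuousOn_const.div continuousOn_id hpos).intervalIntegrable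
  rw [← hX, ← hgi, intervalIntegral.integral_of_le h2]
  rw [intervalIntegrable_iff_integrableOn_Ioc_of_le h2] at hXi
  refine le_trans ?_ (setIntegral_le_integral (s := Set.Ioc ρ₁ ρ₂) hg
    (Filter.Eventually.of_forall hg0))
  refine setIntegral_mono_on_ae hXi hg.integrableOn measurableSet_Ioc ?_
  have hnull : volume (E ∪ {ρ₂}) = 0 := (hE.union (Set.finite_singleton _)).measure_zero _
  filter_upwards [compl_mem_ae_iff.2 hnull] with ρ hρ hρI
  simp only [Set.mem_compl_iff, Set.mem_union, Set.mem_singleton_iff, not_or] at hρ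
  refine (h ρ hρI.1 (lt_of_le_of_ne hρI.2 hρ.2) hρ.1).trans (le_of_eq ?_)
  refine Finset.sum_congr rfl fun i _ => ?_
  rw [Set.indicator_apply]
  congr 1
  rw [abs_le, Set.mem_Icc]
  apply propext
  constructor <;> rintro ⟨_, _⟩ <;> constructor <;> linarith

theorem norm_exp_mul_I_sub_le (φ ψ : ℝ) :
    ‖Complex.exp (φ * Complex.I) - Complex.exp (ψ * Complex.I)‖ ≤ |φ - ψ| := by
  have h : Complex.exp (φ * Complex.I) - Complex.exp (ψ * Complex.I) =
      Complex.exp (ψ * Complex.I) * (Complex.exp (Complex.I * ((φ - ψ : ℝ) : ℂ)) - 1) := by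
    rw [mul_sub, ← Complex.exp_add, mul_one]
    congr 2
    push_cast; ring
  rw [h, norm_mul, Complex.norm_exp_ofReal_mul_I, one_mul]
  exact Real.norm_exp_I_mul_ofReal_sub_one_le

/-- The number of points in an annulus whose width is comparable to `M`, if a disk of radius `M`
contains at most `N` of the points. -/
theorem card_annulus_le (S : Finset ℂ) {M ρ : ℝ} {N : ℕ} (hM : 0 < M) (hρ : M ≤ ρ) (c : ℂ)
    (hU : ∀ p, (S.filter fun v => dist v p ≤ M).card ≤ N) :
    ((S.filter fun v => |dist v c - ρ| ≤ 2 * M).card : ℝ) ≤ 387 * N * (ρ / M) := by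
  classical
  have hρ0 : 0 < ρ := hM.trans_le hρ
  have hpi := Real.pi_pos
  set n : ℕ := ⌈20 * (ρ / M)⌉₊ with hn
  have hρM : 1 ≤ ρ / M := by rwa [one_le_div hM]
  have hn1 : 20 * (ρ / M) ≤ n := Nat.le_ceil _
  have hn2 : (n : ℝ) ≤ 21 * (ρ / M) := by
    have := Nat.ceil_lt_add_one (show 0 ≤ 20 * (ρ / M) by positivity)
    rw [← hn] at this
    linarith
  have hn0 : (0 : ℝ) < n := by linarith
  -- The annulus is cut into polar cells of radial step `M / 2` and angular step `2π / n`. The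
  -- choice `n ≥ 20ρ/M` keeps each cell within distance `M` of its centre: at most `M / 4` radially
  -- and `3ρπ/n ≤ 3M/4` along the arc.
  let f : ℂ → ℤ × ℤ := fun v => (round ((dist v c - ρ) / (M / 2)),
    round (Complex.arg (v - c) * n / (2 * Real.pi)))
  have hmaps : ∀ v ∈ S.filter fun v => |dist v c - ρ| ≤ 2 * M,
      f v ∈ Finset.Icc (-4 : ℤ) 4 ×ˢ Finset.Icc (-n : ℤ) n := by
    intro v hv
    have hv := (Finset.mem_filter.1 hv).2
    rw [abs_le] at hv
    have r1 := abs_le.1 (abs_sub_round ((dist v c - ρ) / (M / 2)))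
    have r2 := abs_le.1 (abs_sub_round (Complex.arg (v - c) * n / (2 * Real.pi)))
    have h1 : (dist v c - ρ) / (M / 2) ≤ 4 := by rw [div_le_iff₀ (by positivity)]; linarith
    have h2 : -4 ≤ (dist v c - ρ) / (M / 2) := by rw [le_div_iff₀ (by positivity)]; linarith
    have h3 : Complex.arg (v - c) * n / (2 * Real.pi) ≤ n / 2 := by
      rw [div_le_iff₀ (by positivity)]
      have := Complex.arg_le_pi (v - c)
      nlinarith
    have h4 : -(n / 2 : ℝ) ≤ Complex.arg (v - c) * n / (2 * Real.pi) := by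
      rw [le_div_iff₀ (by positivity)]
      have := (Complex.neg_pi_lt_arg (v - c)).le
      nlinarith
    have hn1' : (1 : ℝ) ≤ n := by linarith
    simp only [f, Finset.mem_product, Finset.mem_Icc]
    refine ⟨⟨?_, ?_⟩, ?_, ?_⟩
    · have : ((-5 : ℤ) : ℝ) < (round ((dist v c - ρ) / (M / 2)) : ℤ) := by push_cast; linarith
      have := Int.cast_lt.1 this
      omega
    · have : ((round ((dist v c - ρ) / (M / 2)) : ℤ) : ℝ) < (5 : ℤ) := by push_cast; linarith
      have := Int.cast_lt.1 this
      omega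
    · have : ((-(n : ℤ) : ℤ) : ℝ) ≤
        (round (Complex.arg (v - c) * n / (2 * Real.pi)) : ℤ) := by push_cast; linarith
      exact Int.cast_le.1 this
    · have : ((round (Complex.arg (v - c) * n / (2 * Real.pi)) : ℤ) : ℝ) ≤ (n : ℤ) := by
        push_cast; linarith
      exact Int.cast_le.1 this
  have hfib : ∀ b ∈ Finset.Icc (-4 : ℤ) 4 ×ˢ Finset.Icc (-n : ℤ) n,
      ((S.filter fun v => |dist v c - ρ| ≤ 2 * M).filter fun v => f v = b).card ≤ N := by
    rintro ⟨k, j⟩ -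
    refine (Finset.card_le_card ?_).trans (hU (c + ((ρ + k * (M / 2) : ℝ) : ℂ) *
      Complex.exp ((j * (2 * Real.pi) / n : ℝ) * Complex.I)))
    intro v hv
    rw [Finset.mem_filter, Finset.mem_filter] at hv
    obtain ⟨⟨hvS, hvd⟩, hvf⟩ := hv
    refine Finset.mem_filter.2 ⟨hvS, ?_⟩
    simp only [f, Prod.mk.injEq] at hvf
    have r1 := abs_sub_round ((dist v c - ρ) / (M / 2))
    have r2 := abs_sub_round (Complex.arg (v - c) * n / (2 * Real.pi))
    rw [hvf.1] at r1
    rw [hvf.2] at r2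
    set φ := Complex.arg (v - c) with hφ
    set ψ : ℝ := j * (2 * Real.pi) / n with hψ
    have hdist : dist v c = ‖v - c‖ := dist_eq_norm _ _
    have hpolar : v - c = (dist v c : ℂ) * Complex.exp (φ * Complex.I) := by
      rw [hdist]; exact (Complex.norm_mul_exp_arg_mul_I _).symm
    have e : v - (c + ((ρ + k * (M / 2) : ℝ) : ℂ) * Complex.exp (ψ * Complex.I)) =
        (dist v c : ℂ) * (Complex.exp (φ * Complex.I) - Complex.exp (ψ * Complex.I)) +
        ((dist v c - (ρ + k * (M / 2)) : ℝ) : ℂ) * Complex.exp (ψ * Complex.I) := by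
      push_cast
      linear_combination hpolar
    have b1 : |dist v c - (ρ + k * (M / 2))| ≤ M / 4 := by
      have : dist v c - (ρ + k * (M / 2)) = ((dist v c - ρ) / (M / 2) - k) * (M / 2) := by
        field_simp; ring
      rw [this, abs_mul, abs_of_pos (by positivity : 0 < M / 2)]
      calc _ ≤ 1 / 2 * (M / 2) := by gcongr
        _ = M / 4 := by ring
    have b2 : |φ - ψ| ≤ Real.pi / n := by
      have : φ - ψ = (φ * n / (2 * Real.pi) - j) * (2 * Real.pi / n) := by
        rw [hψ]; field_simp
      rw [this, abs_mul, abs_of_pos (by positivity : 0 < 2 * Real.pi / n)]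
      calc _ ≤ 1 / 2 * (2 * Real.pi / n) := by gcongr
        _ = Real.pi / n := by ring
    have b3 : dist v c ≤ 3 * ρ := by
      have := (abs_le.1 hvd).2; linarith
    have b4 : 3 * ρ * (Real.pi / n) ≤ M * (3 / 4) := by
      rw [mul_div_assoc', div_le_iff₀ hn0]
      have h5 : 20 * ρ ≤ n * M := by
        rw [← mul_div_assoc, div_le_iff₀ hM] at hn1; exact hn1
      have h6 := Real.pi_lt_d2
      nlinarith
    rw [dist_eq_norm, e]
    refine (norm_add_le _ _).trans ?_
    rw [norm_mul, norm_mul, Complex.norm_exp_ofReal_mul_I, Complex.norm_real, Complex.norm_real,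
      mul_one, Real.norm_eq_abs, Real.norm_eq_abs, abs_of_nonneg dist_nonneg]
    have b5 := norm_exp_mul_I_sub_le φ ψ
    calc _ ≤ 3 * ρ * (Real.pi / n) + M / 4 := by
          gcongr
          exact b5.trans b2
      _ ≤ M := by linarith
  have := Finset.card_le_mul_card_image_of_maps_to hmaps N hfib
  rw [Finset.card_product, Int.card_Icc, Int.card_Icc] at this
  have h7 : ((4 + 1 - -4 : ℤ).toNat) = 9 := rfl
  have h8 : ((n + 1 - -n : ℤ).toNat) = 2 * n + 1 := by omega
  rw [h7, h8] at this
  have h9 : ((S.filter fun v => |dist v c - ρ| ≤ 2 * M).card : ℝ) ≤ N * (9 * (2 * n + 1)) := by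
    exact_mod_cast this
  refine h9.trans ?_
  have hN : (0 : ℝ) ≤ N := Nat.cast_nonneg _
  -- There are 9 radial and `2 * n + 1` angular indices; with `n ≤ 21ρ/M` and `1 ≤ ρ/M` this gives
  -- `9 * 43 = 387`.
  have : (9 * (2 * n + 1) : ℝ) ≤ 387 * (ρ / M) := by linarith
  calc _ ≤ N * (387 * (ρ / M)) := by gcongr
    _ = _ := by ring

/-! ### From energy to variation, and the logarithmic estimate -/

namespace QuadLattice

open PlaneGraph

variable {Q : QuadLattice}

theorem quadArea_eq (q : Fin 4 → Q.verts) :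
    quadArea (fun i => (q i : ℂ)) = |planeCross (Q.diag₁ q) (Q.diag₂ q)| / 2 := by
  rw [quadArea, Fin.sum_univ_four]
  congr 2
  simp [planeCross, diag₁, diag₂]
  ring

/-- For orthogonal diagonals the energy of a face splits into the squared increments along the two
diagonals, weighted by the ratios of their lengths. -/
theorem norm_dualVector_sq {a b : ℂ} (ha : a ≠ 0) (hb : b ≠ 0) (h : ⟪a, b⟫_ℝ = 0) (s t : ℝ) :
    ‖dualVector a b s t‖ ^ 2 * |planeCross a b| =
      s ^ 2 * (‖b‖ / ‖a‖) + t ^ 2 * (‖a‖ / ‖b‖) := by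
  have hna := norm_pos_iff.2 ha
  have hnb := norm_pos_iff.2 hb
  have hsa : ‖a‖ ^ 2 = a.re * a.re + a.im * a.im := by
    rw [← Complex.normSq_eq_norm_sq, Complex.normSq_apply]
  have hsb : ‖b‖ ^ 2 = b.re * b.re + b.im * b.im := by
    rw [← Complex.normSq_eq_norm_sq, Complex.normSq_apply]
  have hin : a.re * b.re + a.im * b.im = 0 := by
    rw [Complex.inner] at h; simpa [mul_comm] using h
  have hden : ⟪a, Complex.I * b⟫_ℝ = - planeCross a b := by
    rw [Complex.inner]; simp [planeCross]; ring
  have hcr : |planeCross a b| = ‖a‖ * ‖b‖ := by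
    rw [← abs_of_pos (mul_pos hna hnb), ← sq_eq_sq_iff_abs_eq_abs, mul_pow, hsa, hsb, planeCross]
    linear_combination (-(a.re * b.re + a.im * b.im)) * hin
  have hnum : ‖(s : ℂ) * (Complex.I * b) - (t : ℂ) * (Complex.I * a)‖ ^ 2 =
      s ^ 2 * ‖b‖ ^ 2 + t ^ 2 * ‖a‖ ^ 2 := by
    rw [← Complex.normSq_eq_norm_sq, Complex.normSq_apply, hsa, hsb]
    simp
    linear_combination (-2 * s * t) * hin
  rw [dualVector, hden, norm_div, div_pow, hnum, Complex.norm_real, Real.norm_eq_abs, abs_neg, hcr]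
  field_simp

theorem diag_ne_zero {q : Fin 4 → Q.verts} (hq : q ∈ Q.quads) :
    Q.diag₁ q ≠ 0 ∧ Q.diag₂ q ≠ 0 :=
  ⟨sub_ne_zero.2 fun e => absurd (injective_of_mem hq (Subtype.ext e)) (by decide),
    sub_ne_zero.2 fun e => absurd (injective_of_mem hq (Subtype.ext e)) (by decide)⟩

/-- Condition (D) bounds the weights of both squared increments below by `1 / K`. One factor 2 comes
from `(|s| + |t|)² ≤ 2(s² + t²)`, the other from the area being half the cross product. -/
theorem diagVar_sq_le (ho : Q.IsOrthogonal) {K : ℝ} (hD : Q.CondD K)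
    (u : Q.verts → ℝ) {q : Fin 4 → Q.verts} (hq : q ∈ Q.quads) :
    diagVar u q ^ 2 ≤ 4 * K * (‖Q.grad u q‖ ^ 2 * quadArea (fun i => (q i : ℂ))) := by
  obtain ⟨ha, hb⟩ := diag_ne_zero hq
  obtain ⟨h1, h2, -, -⟩ := hD q hq
  rw [quadArea_eq, grad, ← mul_div_assoc, norm_dualVector_sq ha hb (ho q hq)]
  have hna := norm_pos_iff.2 ha
  have hnb := norm_pos_iff.2 hb
  have hβ : 1 ≤ K * (‖Q.diag₂ q‖ / ‖Q.diag₁ q‖) := by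
    rw [div_lt_iff₀ hnb] at h1
    rw [← mul_div_assoc, one_le_div hna]; exact h1.le
  have hβ' : 1 ≤ K * (‖Q.diag₁ q‖ / ‖Q.diag₂ q‖) := by
    rw [div_lt_iff₀ hna] at h2
    rw [← mul_div_assoc, one_le_div hnb]; exact h2.le
  rw [diagVar]
  set s := u (q 2) - u (q 0)
  set t := u (q 3) - u (q 1)
  have e1 : (|s| + |t|) ^ 2 ≤ 2 * (s ^ 2 + t ^ 2) := by
    rw [← sq_abs s, ← sq_abs t]; nlinarith [sq_nonneg (|s| - |t|)]
  have e2 : s ^ 2 * 1 ≤ s ^ 2 * (K * (‖Q.diag₂ q‖ / ‖Q.diag₁ q‖)) := by gcongr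
  have e3 : t ^ 2 * 1 ≤ t ^ 2 * (K * (‖Q.diag₁ q‖ / ‖Q.diag₂ q‖)) := by gcongr
  linarith

theorem card_filter_le_of_condU {K : ℝ} (hU : Q.CondU K) (p : ℂ) :
    (Q.verts.filter fun v => dist v p ≤ Q.maxEdge).card ≤ ⌈K⌉₊ := by
  have h := hU p
  have e : (Q.verts : Set ℂ) ∩ Metric.closedBall p Q.maxEdge =
      ((Q.verts.filter fun v => dist v p ≤ Q.maxEdge : Finset ℂ) : Set ℂ) := by
    ext x; simp
  rw [e, Set.ncard_coe_finset] at h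
  exact_mod_cast h.le.trans (Nat.le_ceil K)

/-- Once a vertex is fixed, the next one is at distance at most the maximal edge length, so
condition (U) leaves at most `⌈K⌉₊` choices for it. -/
theorem card_image_side_le {K : ℝ} (hU : Q.CondU K) {s : Finset (Fin 4 → Q.verts)}
    (hs : s ⊆ Q.quads) (i : Fin 4) (v : ℂ) (hv : ∀ q ∈ s, (q i : ℂ) = v) {N : ℕ}
    (hN : ∀ x : ℂ, (s.filter fun q => (q (i + 1) : ℂ) = x).card ≤ N) : s.card ≤ N * ⌈K⌉₊ := by
  refine (Finset.card_le_mul_card_image_of_maps_to (f := fun q => (q (i + 1) : ℂ))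
    (t := Q.verts.filter fun x => dist x v ≤ Q.maxEdge) ?_ N (fun x _ => hN x)).trans
    (Nat.mul_le_mul_left _ (card_filter_le_of_condU hU v))
  intro q hq
  rw [Finset.mem_filter]
  refine ⟨(q (i + 1)).2, ?_⟩
  rw [← hv q hq, dist_comm]
  exact dist_le_maxEdge (adj_of_mem (hs hq) i)

theorem card_quads_le {K : ℝ} (hU : Q.CondU K) (v : ℂ) :
    (Q.quads.filter fun q => (q 0 : ℂ) = v).card ≤ ⌈K⌉₊ ^ 3 := by
  have h3 : ∀ v x y : ℂ, ((((Q.quads.filter fun q => (q 0 : ℂ) = v).filter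
      fun q => (q 1 : ℂ) = x).filter fun q => (q 2 : ℂ) = y)).card ≤ ⌈K⌉₊ := by
    intro v x y
    rw [← one_mul ⌈K⌉₊]
    refine card_image_side_le hU ?_ 2 y (fun q hq => (Finset.mem_filter.1 hq).2) fun z => ?_
    · exact (Finset.filter_subset _ _).trans ((Finset.filter_subset _ _).trans
        (Finset.filter_subset _ _))
    · rw [Finset.card_le_one]
      intro q hq q' hq'
      simp only [Finset.mem_filter] at hq hq'
      obtain ⟨⟨⟨⟨-, a0⟩, a1⟩, a2⟩, a3⟩ := hq
      obtain ⟨⟨⟨⟨-, b0⟩, b1⟩, b2⟩, b3⟩ := hq'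
      funext i
      apply Subtype.ext
      fin_cases i
      exacts [a0.trans b0.symm, a1.trans b1.symm, a2.trans b2.symm, a3.trans b3.symm]
  have h2 : ∀ v x : ℂ, (((Q.quads.filter fun q => (q 0 : ℂ) = v).filter
      fun q => (q 1 : ℂ) = x)).card ≤ ⌈K⌉₊ * ⌈K⌉₊ := by
    intro v x
    refine card_image_side_le hU ?_ 1 x (fun q hq => (Finset.mem_filter.1 hq).2) fun z => h3 v x z
    exact (Finset.filter_subset _ _).trans (Finset.filter_subset _ _)
  have h1 := card_image_side_le hU (Finset.filter_subset (fun q => (q 0 : ℂ) = v) Q.quads) 0 v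
    (fun q hq => (Finset.mem_filter.1 hq).2) fun z => h2 v z
  exact h1.trans_eq (by ring)

theorem dist_le_of_meets {q : Fin 4 → Q.verts} (hq : q ∈ Q.quads) {c : ℂ} {ρ : ℝ}
    (h : Meets q (Metric.sphere c ρ)) : |dist (q 0 : ℂ) c - ρ| ≤ 2 * Q.maxEdge := by
  have hd := fun j => dist_le_maxEdge (adj_of_mem hq j)
  have hM : 0 ≤ Q.maxEdge := dist_nonneg.trans (hd 0)
  obtain ⟨j, p, hp, hpc⟩ := h
  have hb : ∀ i, (q i : ℂ) ∈ Metric.closedBall (q 0 : ℂ) (2 * Q.maxEdge) := by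
    intro i
    rw [Metric.mem_closedBall]
    have h01 := hd 0
    have h12 := hd 1
    have h30 := hd 3
    rw [show (0 : Fin 4) + 1 = 1 from rfl] at h01
    rw [show (1 : Fin 4) + 1 = 2 from rfl] at h12
    rw [show (3 : Fin 4) + 1 = 0 from rfl] at h30
    have htri := dist_triangle (q 0 : ℂ) (q 1) (q 2)
    fin_cases i
    · simpa using hM
    · simp only [Fin.mk_one]; rw [dist_comm]; linarith
    · simp only [Fin.reduceFinMk]; rw [dist_comm]; linarith
    · simp only [Fin.reduceFinMk]; linarith
  have hpb := (convex_closedBall (q 0 : ℂ) (2 * Q.maxEdge)).segment_subset (hb j) (hb (j + 1)) hp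
  rw [Metric.mem_closedBall] at hpb
  rw [← Metric.mem_sphere.1 hpc]
  refine (abs_dist_sub_le _ _ _).trans ?_
  rwa [dist_comm]

theorem card_meets_le {K : ℝ} (hU : Q.CondU K) (hM : 0 < Q.maxEdge) (c : ℂ) {ρ : ℝ}
    (hρ : Q.maxEdge ≤ ρ) :
    ((Q.quads.filter fun q => |dist (q 0 : ℂ) c - ρ| ≤ 2 * Q.maxEdge).card : ℝ) ≤
      387 * (⌈K⌉₊ : ℝ) ^ 4 * (ρ / Q.maxEdge) := by
  have h1 := Finset.card_le_mul_card_image_of_maps_to (f := fun q => (q 0 : ℂ))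
    (s := Q.quads.filter fun q => |dist (q 0 : ℂ) c - ρ| ≤ 2 * Q.maxEdge)
    (t := Q.verts.filter fun v => |dist v c - ρ| ≤ 2 * Q.maxEdge) (fun q hq => by
      rw [Finset.mem_filter] at *
      exact ⟨(q 0).2, hq.2⟩) (⌈K⌉₊ ^ 3) (fun v _ => by
      refine (Finset.card_le_card ?_).trans (card_quads_le hU v)
      exact Finset.filter_subset_filter _ (Finset.filter_subset _ _))
  have h2 := card_annulus_le Q.verts hM hρ c (card_filter_le_of_condU hU)
  calc _ ≤ ((⌈K⌉₊ ^ 3 : ℕ) : ℝ) *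
        ((Q.verts.filter fun v => |dist v c - ρ| ≤ 2 * Q.maxEdge).card : ℝ) := by exact_mod_cast h1
    _ ≤ ((⌈K⌉₊ ^ 3 : ℕ) : ℝ) * (387 * ⌈K⌉₊ * (ρ / Q.maxEdge)) := by gcongr
    _ = _ := by push_cast; ring

/-- Cauchy-Schwarz over the quadrilaterals with first vertex in the annulus. Every quadrilateral
meeting the circle is among them, since each of its vertices is within two edge lengths of the
first. -/
theorem varAlong_sq_le {K : ℝ} (hU : Q.CondU K) (hM : 0 < Q.maxEdge) (u : Q.verts → ℝ) (c : ℂ)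
    {ρ : ℝ} (hρ : Q.maxEdge ≤ ρ) :
    varAlong u (Metric.sphere c ρ) ^ 2 ≤ 387 * (⌈K⌉₊ : ℝ) ^ 4 * (ρ / Q.maxEdge) *
      ∑ q ∈ Q.quads, if |dist (q 0 : ℂ) c - ρ| ≤ 2 * Q.maxEdge then diagVar u q ^ 2 else 0 := by
  classical
  have h1 : varAlong u (Metric.sphere c ρ) ≤
      ∑ q ∈ Q.quads.filter fun q => |dist (q 0 : ℂ) c - ρ| ≤ 2 * Q.maxEdge, diagVar u q := by
    apply Finset.sum_le_sum_of_subset_of_nonneg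
    · intro q hq
      rw [Finset.mem_filter] at *
      exact ⟨hq.1, dist_le_of_meets hq.1 hq.2⟩
    · exact fun q _ _ => diagVar_nonneg u q
  have h2 := sq_sum_le_card_mul_sum_sq
    (s := Q.quads.filter fun q => |dist (q 0 : ℂ) c - ρ| ≤ 2 * Q.maxEdge) (f := diagVar u)
  have h3 := card_meets_le hU hM c hρ
  rw [← Finset.sum_filter]
  calc _ ≤ _ := pow_le_pow_left₀ (varAlong_nonneg u _) h1 2
    _ ≤ _ := h2
    _ ≤ _ := by gcongr

/-- The estimate for the difference of the values of a discrete harmonic function at two vertices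
in a disk of radius `ρ₁` via the energy in a larger disk. -/
theorem sq_mul_log_le (ho : Q.IsOrthogonal) {K : ℝ} (hD : Q.CondD K)
    (hU : Q.CondU K) (hM : 0 < Q.maxEdge) {u : Q.verts → ℝ} (hu : Q.IsDiscreteHarmonic u)
    {B : Q.diagGraph.ConnectedComponent} {z w : Q.verts} (hz : z ∈ B.supp) (hw : w ∈ B.supp)
    {c : ℂ} {ρ₁ ρ₂ : ℝ} (hρ₁ : Q.maxEdge ≤ ρ₁) (hρ : ρ₁ ≤ ρ₂) (hzc : dist (z : ℂ) c ≤ ρ₁)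
    (hwc : dist (w : ℂ) c ≤ ρ₁) {R : Set ℂ}
    (hR : Metric.closedBall c (ρ₂ + Q.maxEdge) ⊆ R) (hpos : 0 ≤ u z - u w - Q.boundaryOsc u B R) :
    (u z - u w - Q.boundaryOsc u B R) ^ 2 * Real.log (ρ₂ / ρ₁) ≤
      24768 * (⌈K⌉₊ : ℝ) ^ 4 * K * Q.energy u := by
  set U := u z - u w - Q.boundaryOsc u B R with hUdef
  set C : ℝ := 387 * (⌈K⌉₊ : ℝ) ^ 4 with hC
  have hρ₁0 : 0 < ρ₁ := hM.trans_le hρ₁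
  -- The exceptional radii are those of circles through a vertex. The constant is `4 * 387` from
  -- squaring `U ≤ 2 * varAlong`, times 4 from the intervals of length `4 * Q.maxEdge`, times `4 *
  -- K` from `diagVar_sq_le`: `64 * 387 = 24768`.
  have hmain := mul_log_le_of_forall Q.quads
    (a := fun q => 4 * C / Q.maxEdge * diagVar u q ^ 2) (d := fun q => dist (q 0 : ℂ) c)
    (fun q _ => by positivity) hρ₁0 hρ (M := 2 * Q.maxEdge) (X := U ^ 2) (by positivity)
    (E := (fun v : ℂ => dist v c) '' (Q.verts : Set ℂ)) (Q.verts.finite_toSet.image _) (by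
      intro ρ h1 h2 hE
      have h3 := hu.sub_le ho hz hw (hzc.trans_lt h1) (hwc.trans_lt h1)
        (fun v hv => hE ⟨v, v.2, hv⟩) (R := R) hM.le
        ((Metric.closedBall_subset_closedBall (by linarith)).trans hR)
      have h4 : U ≤ 2 * varAlong u (Metric.sphere c ρ) := by rw [hUdef]; linarith
      have h5 := varAlong_sq_le hU hM u c (hρ₁.trans h1.le)
      have hρ0 : 0 < ρ := hρ₁0.trans h1
      have h6 : U ^ 2 ≤ 4 * varAlong u (Metric.sphere c ρ) ^ 2 := by nlinarith
      rw [div_le_iff₀ hρ0]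
      simp_rw [← mul_ite_zero]
      rw [← Finset.mul_sum]
      refine h6.trans ((mul_le_mul_of_nonneg_left h5 (by norm_num)).trans_eq ?_)
      ring)
  refine hmain.trans ?_
  have hsum : ∑ q ∈ Q.quads, diagVar u q ^ 2 ≤ 4 * K * Q.energy u := by
    rw [energy, Finset.mul_sum]
    exact Finset.sum_le_sum fun q hq => diagVar_sq_le ho hD u hq
  rw [← Finset.mul_sum]
  calc 2 * (2 * Q.maxEdge) * (4 * C / Q.maxEdge * ∑ q ∈ Q.quads, diagVar u q ^ 2)
      = 16 * C * ∑ q ∈ Q.quads, diagVar u q ^ 2 := by field_simp; ring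
    _ ≤ 16 * C * (4 * K * Q.energy u) := by gcongr
    _ = _ := by rw [hC]; ring

/-! ### Eccentricity, the constant and the conclusion -/

theorem condD_mono {K K' : ℝ} (hK : 0 < K) (h : K ≤ K') (hD : Q.CondD K) : Q.CondD K' := by
  intro q hq
  obtain ⟨h1, h2, h3, h4⟩ := hD q hq
  have := one_div_le_one_div_of_le hK h
  exact ⟨h1.trans_le h, h2.trans_le h, this.trans_lt h3, this.trans_lt h4⟩

theorem pos_of_condU {K : ℝ} (hU : Q.CondU K) : 0 < K :=
  (Nat.cast_nonneg _).trans_lt (hU 0)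

/-- Needed because the infimum of an empty set would carry no information. The lattice is finite,
and the diagonals meet at right angles, which exceed `1 / K` as soon as `K ≥ 1`. -/
theorem exists_cond (ho : Q.IsOrthogonal) : ∃ K, Q.CondD K ∧ Q.CondU K := by
  let S : ℝ := ∑ q ∈ Q.quads, (‖Q.diag₁ q‖ / ‖Q.diag₂ q‖ + ‖Q.diag₂ q‖ / ‖Q.diag₁ q‖)
  have hS : 0 ≤ S := Finset.sum_nonneg fun q _ => by positivity
  refine ⟨S + Q.verts.card + 1, fun q hq => ?_, fun p => ?_⟩
  · have h1 : ‖Q.diag₁ q‖ / ‖Q.diag₂ q‖ + ‖Q.diag₂ q‖ / ‖Q.diag₁ q‖ ≤ S :=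
      Finset.single_le_sum (f := fun q => ‖Q.diag₁ q‖ / ‖Q.diag₂ q‖ + ‖Q.diag₂ q‖ / ‖Q.diag₁ q‖)
        (fun q _ => by positivity) hq
    have h2 : 0 ≤ ‖Q.diag₁ q‖ / ‖Q.diag₂ q‖ := by positivity
    have h3 : 0 ≤ ‖Q.diag₂ q‖ / ‖Q.diag₁ q‖ := by positivity
    have h4 : (0 : ℝ) ≤ Q.verts.card := Nat.cast_nonneg _
    rw [InnerProductGeometry.inner_eq_zero_iff_angle_eq_pi_div_two _ _ |>.1 (ho q hq)]
    have h5 : 1 / (S + Q.verts.card + 1) ≤ 1 := by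
      rw [div_le_one (by positivity)]; linarith
    have h6 := Real.pi_gt_three
    refine ⟨by linarith, by linarith, by linarith, by linarith⟩
  · have h1 : ((Q.verts : Set ℂ) ∩ Metric.closedBall p Q.maxEdge).ncard ≤ Q.verts.card := by
      rw [← Set.ncard_coe_finset]
      exact Set.ncard_le_ncard Set.inter_subset_left Q.verts.finite_toSet
    have h2 : (((Q.verts : Set ℂ) ∩ Metric.closedBall p Q.maxEdge).ncard : ℝ) ≤ Q.verts.card := by
      exact_mod_cast h1
    linarith

theorem ecc_nonneg : 0 ≤ Q.ecc := Real.sInf_nonneg fun _ h => (pos_of_condU h.2).le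

/-- The strict conditions may fail at the infimum itself; adding 1 restores them and still depends
only on the eccentricity. -/
theorem cond_ecc_add_one (ho : Q.IsOrthogonal) :
    Q.CondD (Q.ecc + 1) ∧ Q.CondU (Q.ecc + 1) := by
  obtain ⟨K, ⟨hD, hU⟩, hlt⟩ := exists_lt_of_csInf_lt
    (s := {K | Q.CondD K ∧ Q.CondU K}) (exists_cond ho) (lt_add_one Q.ecc)
  exact ⟨condD_mono (pos_of_condU hU) hlt.le hD, fun p => (hU p).trans hlt⟩

theorem energy_nonneg (u : Q.verts → ℝ) : 0 ≤ Q.energy u :=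
  Finset.sum_nonneg fun q _ => mul_nonneg (sq_nonneg _) (by rw [quadArea]; positivity)

theorem maxEdge_pos {B : Q.diagGraph.ConnectedComponent} {z w : Q.verts} (hz : z ∈ B.supp)
    (hw : w ∈ B.supp) (hzw : z ≠ w) : 0 < Q.maxEdge := by
  have hr : Q.diagGraph.Reachable z w := by
    rw [SimpleGraph.ConnectedComponent.mem_supp_iff] at hz hw
    exact SimpleGraph.ConnectedComponent.exact (hz.trans hw.symm)
  obtain ⟨p⟩ := hr
  cases p with
  | nil => exact absurd rfl hzw
  | cons h _ =>
    obtain ⟨q, hq, i, -, -⟩ := diagGraph_adj.1 h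
    have hadj := adj_of_mem hq i
    exact (dist_pos.2 (coe_ne_of_adj hadj)).trans_le (dist_le_maxEdge hadj)

theorem closedBall_subset_square {c θ : ℂ} (hθ : ‖θ‖ = 1) (r : ℝ) :
    Metric.closedBall c (r / 2) ⊆ square c θ r := by
  intro p hp
  rw [mem_closedBall_iff_norm] at hp
  constructor
  · refine (abs_real_inner_le_norm _ _).trans ?_
    rw [hθ, one_mul]; exact hp
  · refine (abs_real_inner_le_norm _ _).trans ?_
    rw [norm_mul, Complex.norm_I, hθ, one_mul, one_mul]; exact hp

/-- The constant in the equicontinuity estimate. -/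
noncomputable def equiConst (e : ℝ) : ℝ :=
  Real.sqrt (24768 * (⌈|e| + 1⌉₊ : ℝ) ^ 4 * (|e| + 1))

theorem equiConst_pos (e : ℝ) : 0 < equiConst e := by
  have h1 : 0 < |e| + 1 := by positivity
  have h2 : 0 < (⌈|e| + 1⌉₊ : ℝ) := by exact_mod_cast Nat.ceil_pos.2 h1
  apply Real.sqrt_pos.2
  positivity

theorem sub_le_of_sq_mul_le {U L A E : ℝ} (hL : 0 < L) (hA : 0 ≤ A) (hE : 0 ≤ E)
    (h : 0 ≤ U → U ^ 2 * L ≤ A * E) :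
    U ≤ Real.sqrt A * E ^ (1 / 2 : ℝ) * L ^ (-(1 / 2) : ℝ) := by
  rw [Real.rpow_neg hL.le, ← Real.sqrt_eq_rpow, ← Real.sqrt_eq_rpow, ← Real.sqrt_mul hA,
    ← div_eq_mul_inv, ← Real.sqrt_div (mul_nonneg hA hE)]
  rcases le_total 0 U with hU | hU
  · apply Real.le_sqrt_of_sq_le
    rw [le_div_iff₀ hL]; exact h hU
  · exact hU.trans (Real.sqrt_nonneg _)

/-- The parameter `D` treats both cases at once: it is `‖z - w‖` or `Q.h`. The disks about the
midpoint have radii from `D / 2` to `(r - D) / 2`; since `2 * Q.maxEdge ≤ D`, even the largest one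
enlarged by an edge length lies in the square. -/
theorem sub_le_equiConst (ho : Q.IsOrthogonal) {u : Q.verts → ℝ} (hu : Q.IsDiscreteHarmonic u)
    {B : Q.diagGraph.ConnectedComponent} {z w : Q.verts} (hz : z ∈ B.supp) (hw : w ∈ B.supp)
    {θ : ℂ} (hθ : ‖θ‖ = 1) {r D : ℝ} (hzw : z ≠ w) (hD : ‖(z : ℂ) - w‖ ≤ D) (hh : Q.h ≤ D)
    (hr : 3 * D < r) :
    u z - u w ≤ equiConst Q.ecc * Q.energy u ^ (1 / 2 : ℝ) *
      Real.log (r / (3 * D)) ^ (-(1 / 2) : ℝ) +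
      Q.boundaryOsc u B (square (midpoint ℝ (z : ℂ) (w : ℂ)) θ r) := by
  have hM := maxEdge_pos hz hw hzw
  rw [QuadLattice.h] at hh
  have hD0 : 0 < D := by linarith
  have he := ecc_nonneg (Q := Q)
  obtain ⟨hcD, hcU⟩ := cond_ecc_add_one ho
  have hK : 0 < Q.ecc + 1 := by positivity
  have hL : 0 < Real.log (r / (3 * D)) := by
    apply Real.log_pos
    rw [lt_div_iff₀ (by positivity)]; linarith
  -- The ratio of the radii is `(r - D) / D`, and `r / 3 ≤ r - D` because `3 * D < r`.
  have hLle : Real.log (r / (3 * D)) ≤ Real.log ((r - D) / 2 / (D / 2)) := by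
    apply Real.log_le_log (by apply div_pos <;> linarith)
    rw [div_le_div_iff₀ (by positivity) (by positivity)]
    nlinarith
  -- The absolute value in `equiConst` makes it positive at every real argument; it disappears here
  -- as the eccentricity is nonnegative.
  rw [← sub_le_iff_le_add, equiConst, abs_of_nonneg he]
  apply sub_le_of_sq_mul_le hL (by positivity) (energy_nonneg u)
  intro hU
  refine (mul_le_mul_of_nonneg_left hLle (sq_nonneg _)).trans ?_
  have hmid₁ : dist (z : ℂ) (midpoint ℝ (z : ℂ) w) ≤ D / 2 := by
    rw [dist_left_midpoint, dist_eq_norm]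
    norm_num
    linarith
  have hmid₂ : dist (w : ℂ) (midpoint ℝ (z : ℂ) w) ≤ D / 2 := by
    rw [dist_right_midpoint, dist_eq_norm]
    norm_num
    linarith
  refine sq_mul_log_le ho hcD hcU hM hu hz hw (by linarith) (by linarith) hmid₁ hmid₂ ?_ hU
  exact (Metric.closedBall_subset_closedBall (by linarith)).trans (closedBall_subset_square hθ r)

theorem abs_sub_le_equiConst (ho : Q.IsOrthogonal) {u : Q.verts → ℝ}
    (hu : Q.IsDiscreteHarmonic u)
    {B : Q.diagGraph.ConnectedComponent} {z w : Q.verts} (hz : z ∈ B.supp) (hw : w ∈ B.supp)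
    {θ : ℂ} (hθ : ‖θ‖ = 1) {r D : ℝ} (hD : ‖(z : ℂ) - w‖ ≤ D) (hh : Q.h ≤ D)
    (hr : 3 * D < r) :
    |u z - u w| ≤ equiConst Q.ecc * Q.energy u ^ (1 / 2 : ℝ) *
      Real.log (r / (3 * D)) ^ (-(1 / 2) : ℝ) +
      Q.boundaryOsc u B (square (midpoint ℝ (z : ℂ) (w : ℂ)) θ r) := by
  by_cases hzw : z = w
  · have hD0 : 0 ≤ D := (norm_nonneg _).trans hD
    have hL : 0 ≤ Real.log (r / (3 * D)) := by
      rcases hD0.eq_or_lt with h0 | h0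
      -- For `D = 0` the quotient is `0` by convention and `Real.log 0 = 0`, so the right side
      -- remains nonnegative.
      · rw [← h0]; simp
      · apply Real.log_nonneg
        rw [le_div_iff₀ (by positivity)]; linarith
    rw [hzw, sub_self, abs_zero]
    exact add_nonneg (mul_nonneg (mul_nonneg (equiConst_pos _).le
      (Real.rpow_nonneg (energy_nonneg u) _)) (Real.rpow_nonneg hL _)) (boundaryOsc_nonneg _ _ _)
  · rw [abs_le']
    refine ⟨sub_le_equiConst ho hu hz hw hθ hzw hD hh hr, ?_⟩
    have := sub_le_equiConst ho hu hw hz hθ (Ne.symm hzw) (norm_sub_rev (z : ℂ) w ▸ hD) hh hr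
    rw [neg_sub, midpoint_comm]
    exact this

end QuadLattice

theorem mainTheorem7 :
    ∃ C : ℝ → ℝ, (∀ e, 0 < C e) ∧
      ∀ Q : QuadLattice, Q.IsOrthogonal →
      ∀ u : Q.verts → ℝ, Q.IsDiscreteHarmonic u →
      ∀ B : Q.diagGraph.ConnectedComponent, ∀ z ∈ B.supp, ∀ w ∈ B.supp,
      ∀ θ : ℂ, ‖θ‖ = 1 → (w : ℂ) - (z : ℂ) = (‖(w : ℂ) - (z : ℂ)‖ : ℂ) * θ →
      ∀ r : ℝ,
        (Q.h ≤ ‖(z : ℂ) - (w : ℂ)‖ → 3 * ‖(z : ℂ) - (w : ℂ)‖ < r →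
          |u z - u w| ≤
            C Q.ecc * Q.energy u ^ (1 / 2 : ℝ) *
                Real.log (r / (3 * ‖(z : ℂ) - (w : ℂ)‖)) ^ (-(1 / 2) : ℝ) +
              Q.boundaryOsc u B (square (midpoint ℝ (z : ℂ) (w : ℂ)) θ r)) ∧
        (‖(z : ℂ) - (w : ℂ)‖ < Q.h → Q.h < r / 3 →
          |u z - u w| ≤
            C Q.ecc * Q.energy u ^ (1 / 2 : ℝ) *
                Real.log (r / (3 * Q.h)) ^ (-(1 / 2) : ℝ) +
              Q.boundaryOsc u B (square (midpoint ℝ (z : ℂ) (w : ℂ)) θ r)) := by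
  refine ⟨QuadLattice.equiConst, QuadLattice.equiConst_pos, ?_⟩
  intro Q ho u hu B z hz w hw θ hθ _ r
  exact ⟨fun h1 h2 => QuadLattice.abs_sub_le_equiConst ho hu hz hw hθ le_rfl h1 h2,
    fun h1 h2 => QuadLattice.abs_sub_le_equiConst ho hu hz hw hθ h1.le le_rfl (by linarith)⟩
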